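/- **Conventions.** Let $X$ be a complex Banach space. A *semigroup* on $X$ is a strongly continuous map $T:(0,\infty)\to\mathcal L(X)$ with $T(t+s)=T(t)T(s)$ for $s,t>0$, $\sup_{0<t<1}\|T(t)\|<\infty$, and such that $T(t)x=0$ for all $t>0$ implies $x=0$; it is a *$C_0$-semigroup* if moreover $T(t)x\to x$ as $t\to0^+$ for every $x\in X$. Its *generator* is the operator $-A$ with $(\lambda+A)^{-1}x=\int_0^\infty e^{-\lambda t}T(t)x\,dt$ for all large $\lambda$ and all $x\in X$. The semigroup is *bounded analytic* if it extends to a bounded holomorphic function on some sector $S_\theta=\{z\ne0:|\arg z|<\theta\}$, $0<\theta\le\pi/2$. The sectoriality angle $\omega_A$ of $A$ is the least $\varphi\in[0,\pi)$ such that $\sigma(A)\subset\overline{S_\varphi}$ and $\sup_{z\notin\overline{S_{\varphi'}}}\|z(z-A)^{-1}\|<\infty$ for all $\varphi'\in(\varphi,\pi)$. $H^\infty_0(S_\omega)$ is the set of bounded holomorphic functions $\gamma$ on $S_\omega$ for which there are $C,\alpha>0$ with $|\gamma(z)|\le C\min(|z|^\alpha,|z|^{-\alpha})$ on $S_\omega$.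 For such $\gamma$ with $\omega>\omega_A$, and $t>0$, $$\gamma(tA)=\frac1{2\pi i}\int_{\partial S_\nu}\gamma(z)(z-tA)^{-1}\,dz\in\mathcal L(X),$$ where $\nu\in(\omega_A,\omega)$ is arbitrary and $\partial S_\nu$ has $S_\nu$ on its left. For $p\in[1,\infty]$, $A$ has *$L^p$-maximal regularity on $\mathbb R_+$* if for every $f\in L^p(\mathbb R_+;X)$ there is a unique $u\in W^{1,1}_{loc}([0,\infty);X)$ such that $u(0)=0$, $u(t)\in D(A)$ and $u'(t)+Au(t)=f(t)$ for a.e. $t>0$, and $u',Au\in L^p(\mathbb R_+;X)$. **Proposition 2.20.** Let $-A$ be the generator of a bounded analytic semigroup $T$ on $X$, let $\omega\in(\omega_A,\frac\pi2)$, and let $0\ne\gamma\in H^\infty_0(S_\omega)$. (i) $A$ has $L^1$-maximal regularity on $\mathbb R_+$ if and only if there is a constant $C$ such that $$\int_0^\infty\Big\|\frac1t\gamma(tA)x\Big\|\,dt\le C\|x\|\qquad(x\in X).$$ In particular, for every $\varepsilon>0$ the function $\gamma(z)=z(1+z)^{-1-\varepsilon}$ is a nonzero element of $H^\infty_0(S_\omega)$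 and the equivalence holds for it. Moreover, if there is a constant $C$ such that $\int_0^\infty\|A(1+tA)^{-1}x\|\,dt\le C\|x\|$ for all $x\in X$, then $A=0\in\mathcal L(X)$ (that is, $D(A)=X$ and $Ax=0$ for all $x$). (ii) If there is a constant $C$ such that $$\|x\|\le C\sup_{t>0}\|\gamma(tA)x\|+\limsup_{t\to\infty}\|T(t)x\|\qquad(x\in X),$$ then $A$ has $L^\infty$-maximal regularity on $\mathbb R_+$. If $T$ is a $C_0$-semigroup, then conversely $L^\infty$-maximal regularity of $A$ on $\mathbb R_+$ implies the existence of such a constant $C$, so that the two properties are equivalent. -/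

import Mathlib

open MeasureTheory Set Filter Topology
open scoped ENNReal NNReal

noncomputable section

/-- The open sector `S_ω = {z ≠ 0 : |arg z| < ω}`. -/
def sector (ω : ℝ) : Set ℂ := {z | z ≠ 0 ∧ |Complex.arg z| < ω}

section Operators

variable {X : Type*} [NormedAddCommGroup X] [NormedSpace ℂ X]

/-- `R` is the bounded, everywhere defined, two-sided inverse of `z - A : D(A) → X`. -/
def IsResolventAt (A : X →ₗ.[ℂ] X) (z : ℂ) (R : X →L[ℂ] X) : Prop :=
  (∀ x : X, ∃ h : R x ∈ A.domain, z • R x - A ⟨R x, h⟩ = x) ∧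
    ∀ y : A.domain, R (z • (y : X) - A y) = y

/-- `z` belongs to the resolvent set `ρ(A)`. -/
def InResolventSet (A : X →ₗ.[ℂ] X) (z : ℂ) : Prop := ∃ R : X →L[ℂ] X, IsResolventAt A z R

open Classical in
/-- The resolvent `R(z, A) = (z - A)⁻¹` for `z ∈ ρ(A)` (and `0` for other `z`). -/
def resolventOp (A : X →ₗ.[ℂ] X) (z : ℂ) : X →L[ℂ] X :=
  if h : InResolventSet A z then h.choose else 0

open Classical in
/-- The value `A x` for `x ∈ D(A)` (and `0` for other `x`). -/
def opApply (A : X →ₗ.[ℂ] X) (x : X) : X := if h : x ∈ A.domain then A ⟨x, h⟩ else 0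

/-! ### Sectorial operators and the sectoriality angle -/

/-- `A` is sectorial of angle `φ`: the spectrum lies in the closure of `S_φ`, and `z R(z, A)` is
bounded outside the closure of `S_φ'` for every `φ' ∈ (φ, π)`. -/
def IsSectorial (A : X →ₗ.[ℂ] X) (φ : ℝ) : Prop :=
  (∀ z : ℂ, z ≠ 0 → φ < |Complex.arg z| → InResolventSet A z) ∧
    ∀ φ' : ℝ, φ < φ' → φ' < Real.pi → ∃ M : ℝ, ∀ z : ℂ, z ≠ 0 → φ' < |Complex.arg z| →
      ‖z • resolventOp A z‖ ≤ M

/-- The sectoriality angle `ω_A`: the smallest `φ ∈ [0, π)` such that `A` is sectorial of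
angle `φ`. -/
def sectorialityAngle (A : X →ₗ.[ℂ] X) : ℝ :=
  sInf {φ : ℝ | 0 ≤ φ ∧ φ < Real.pi ∧ IsSectorial A φ}

/-! ### Semigroups and generators -/

/-- `T` is a semigroup on `X`. Only the values `T t` for `t > 0` matter; strong continuity at `0`
is not required. -/
structure IsSemigroup (T : ℝ → X →L[ℂ] X) : Prop where
  continuousOn : ∀ x : X, ContinuousOn (fun t : ℝ => T t x) (Ioi 0)
  add : ∀ s t : ℝ, 0 < s → 0 < t → T (s + t) = (T s).comp (T t)
  bounded : ∃ M : ℝ, ∀ t : ℝ, 0 < t → t < 1 → ‖T t‖ ≤ M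
  injective : ∀ x : X, (∀ t : ℝ, 0 < t → T t x = 0) → x = 0

/-- `T` is a `C₀`-semigroup: a semigroup with `T(t) x → x` as `t → 0⁺` for every `x`. -/
def IsC0Semigroup (T : ℝ → X →L[ℂ] X) : Prop :=
  IsSemigroup T ∧ ∀ x : X, Tendsto (fun t : ℝ => T t x) (𝓝[>] 0) (𝓝 x)

/-- `T` is a bounded analytic semigroup: a semigroup with a bounded holomorphic extension to
some sector around `(0, ∞)`. -/
def IsBoundedAnalyticSemigroup (T : ℝ → X →L[ℂ] X) : Prop :=
  IsSemigroup T ∧ ∃ θ : ℝ, 0 < θ ∧ θ ≤ Real.pi / 2 ∧ ∃ F : ℂ → X →L[ℂ] X,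
    DifferentiableOn ℂ F (sector θ) ∧ (∃ M : ℝ, ∀ z ∈ sector θ, ‖F z‖ ≤ M) ∧
      ∀ t : ℝ, 0 < t → F (t : ℂ) = T t

/-- `B` is the generator of `T`: for all large real `l`, `l ∈ ρ(B)` and
`(l - B)⁻¹ x = ∫₀^∞ e^{-lt} T(t) x dt`. -/
def IsGenerator (B : X →ₗ.[ℂ] X) (T : ℝ → X →L[ℂ] X) : Prop :=
  ∃ w : ℝ, ∀ l : ℝ, w < l → ∃ R : X →L[ℂ] X, IsResolventAt B (l : ℂ) R ∧
    ∀ x : X, IntegrableOn (fun t : ℝ => (Real.exp (-(l * t)) : ℂ) • T t x) (Ioi 0) ∧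
      R x = ∫ t in Ioi (0 : ℝ), (Real.exp (-(l * t)) : ℂ) • T t x

/-! ### The functional calculus for `H^∞_0` -/

/-- `γ` is a bounded holomorphic function on `S_ω`, i.e. `γ ∈ H^∞(S_ω)`. -/
def MemHInf (ω : ℝ) (γ : ℂ → ℂ) : Prop :=
  DifferentiableOn ℂ γ (sector ω) ∧ ∃ M : ℝ, ∀ z ∈ sector ω, ‖γ z‖ ≤ M

/-- `γ ∈ H^∞_0(S_ω)`. -/
def MemHInfZero (ω : ℝ) (γ : ℂ → ℂ) : Prop :=
  MemHInf ω γ ∧ ∃ C α : ℝ, 0 < C ∧ 0 < α ∧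
    ∀ z ∈ sector ω, ‖γ z‖ ≤ C * min (‖z‖ ^ α) (‖z‖ ^ (-α))

/-- The operator `γ(A) = (2πi)⁻¹ ∫_Γ γ(z) R(z, A) dz`, where `Γ` is the boundary of `S_ν`,
run through so that `S_ν` lies on its left: inwards along the ray `ℝ₊ e^{iν}` and outwards along
the ray `ℝ₊ e^{-iν}`. For `γ ∈ H^∞_0(S_ω)` and `ω_A < ν < ω` the integrals converge absolutely
and the value does not depend on `ν`. -/
def funCalc (A : X →ₗ.[ℂ] X) (ν : ℝ) (γ : ℂ → ℂ) : X →L[ℂ] X :=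
  (2 * Real.pi * Complex.I : ℂ)⁻¹ •
    ((∫ r in Ioi (0 : ℝ), (γ (r * Complex.exp (-(ν * Complex.I))) *
        Complex.exp (-(ν * Complex.I))) • resolventOp A (r * Complex.exp (-(ν * Complex.I)))) -
      ∫ r in Ioi (0 : ℝ), (γ (r * Complex.exp (ν * Complex.I)) *
        Complex.exp (ν * Complex.I)) • resolventOp A (r * Complex.exp (ν * Complex.I)))

/-! ### Maximal regularity on `(0, ∞)` -/

/-- `u ∈ W^{1,1}_loc([0, ∞); X)` with derivative `v`: `v` is integrable on bounded intervals and
`u` is (the continuous representative) an antiderivative of `v`. -/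
def HasLocDeriv (u v : ℝ → X) : Prop :=
  ∀ t : ℝ, 0 ≤ t → IntervalIntegrable v volume 0 t ∧ u t = u 0 + ∫ s in (0 : ℝ)..t, v s

/-- `u` is a strong solution on `(0, ∞)` of `u' + A u = f`, `u(0) = x`. -/
def IsStrongSolution (A : X →ₗ.[ℂ] X) (f : ℝ → X) (x : X) (u : ℝ → X) : Prop :=
  u 0 = x ∧ ∃ v : ℝ → X, HasLocDeriv u v ∧
    ∀ᵐ t ∂volume.restrict (Ioi (0 : ℝ)), ∃ h : u t ∈ A.domain, v t + A ⟨u t, h⟩ = f t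

/-- `u'` and `A u` belong to `L^p(ℝ₊; X)`. -/
def HasMaximalLp (A : X →ₗ.[ℂ] X) (p : ℝ≥0∞) (u : ℝ → X) : Prop :=
  (∃ v : ℝ → X, HasLocDeriv u v ∧ MemLp v p (volume.restrict (Ioi (0 : ℝ)))) ∧
    ∃ w : ℝ → X, MemLp w p (volume.restrict (Ioi (0 : ℝ))) ∧
      ∀ᵐ t ∂volume.restrict (Ioi (0 : ℝ)), ∃ h : u t ∈ A.domain, A ⟨u t, h⟩ = w t

/-- `A` has `L^p`-maximal regularity on `ℝ₊`: for every `f ∈ L^p(ℝ₊; X)` there is a unique strong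
solution `u` of `u' + A u = f`, `u(0) = 0`, with `u'` and `A u` in `L^p(ℝ₊; X)`. -/
def HasMaximalRegularity (A : X →ₗ.[ℂ] X) (p : ℝ≥0∞) : Prop :=
  ∀ f : ℝ → X, MemLp f p (volume.restrict (Ioi (0 : ℝ))) →
    ∃ u : ℝ → X, (IsStrongSolution A f 0 u ∧ HasMaximalLp A p u) ∧
      ∀ u₁ : ℝ → X, IsStrongSolution A f 0 u₁ → HasMaximalLp A p u₁ → EqOn u₁ u (Ici 0)

/-! ### The two conditions on `γ` -/

/-- `∫₀^∞ ‖t⁻¹ γ(tA) x‖ dt ≤ C ‖x‖` for all `x`, with some constant `C`. -/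
def L1Condition (A : X →ₗ.[ℂ] X) (ν : ℝ) (γ : ℂ → ℂ) : Prop :=
  ∃ C : ℝ≥0, ∀ x : X,
    ∫⁻ t in Ioi (0 : ℝ), ‖(t : ℂ)⁻¹ • funCalc ((t : ℂ) • A) ν γ x‖ₑ ≤ C * ‖x‖ₑ

/-- `‖x‖ ≤ C sup_{t>0} ‖γ(tA) x‖ + limsup_{t→∞} ‖T(t) x‖` for all `x`, with some constant `C`. -/
def LInfCondition (A : X →ₗ.[ℂ] X) (T : ℝ → X →L[ℂ] X) (ν : ℝ) (γ : ℂ → ℂ) : Prop :=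
  ∃ C : ℝ≥0, ∀ x : X,
    ‖x‖ₑ ≤ C * (⨆ t ∈ Ioi (0 : ℝ), ‖funCalc ((t : ℂ) • A) ν γ x‖ₑ) +
      limsup (fun t : ℝ => ‖T t x‖ₑ) atTop

end Operators

end

/-! Write J = (1 + A)⁻¹ and D(t) = A T(t). Bounded analyticity and Cauchy's estimate give ‖T(t)‖ ≤ M
and ‖D(t)‖ ≤ M/t; what is needed about A later on is collected in `IsAnalyticGenerator`. Since D(A)
need not be dense and T need not be continuous at 0, "y ∈ D(A) and A y = w" is expressed as y = J(y
+ w), where J is bounded and injective, commutes with T, and T(t) tends to the identity on the range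
of J. A strong solution of u' + A u = f with u(0) = 0 must be the mild solution ∫₀ᵗ T(t - s) f(s)
ds, so maximal regularity means that A u lies in L^p for this u (`hasMaximalRegularity_iff`); the
closed graph theorem then makes f ↦ A u bounded.

Case p = 1. Maximal regularity is equivalent to ∫ ‖D(t) x‖ dt ≤ C ‖x‖. For f = 1_(0,r] x one has A
u(t) = T(t - r) x - T(t) x when t > r; divide by r and let r → 0. The converse is Tonelli's theorem
for the convolution of D with f.

Case p = ∞. The counterpart is `DerivSupCondition`. Necessity comes from f(s) = (t₀ - s) D(t₀ - s) x
on (0, t₀), which is bounded by sup ‖t D(t) x‖ and for which A u(t₀) = (x - T(2t₀) x)/4 - (t₀/2)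
D(2t₀) x when T is a C₀-semigroup. For sufficiency the condition is applied to vectors D(e) z, where
the limsup term vanishes. It then involves r D(r) D(e + s), whose norm is at most 4M² r/(r + s)².
These kernels are controlled by averages over (0, τ], so at a Lebesgue point t of f, D(e) converges
as e → 0 on the contribution of f(t - s) - f(t) to u(t); the contribution of the constant f(t) is
explicit.

Passage to γ. With t = e^τ and z = e^w dilations become translations. Let l(w) = (1 + e^w)⁻¹ and
P(τ) = tA(1 + tA)⁻². The families γ(tA), P and t A T(t) dominate one another, through bounded
factors or convolution with exponentially decaying kernels, so their L¹(dt/t) and sup norms are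
comparable by Young's inequality. The bound of γ(tA) by P uses ∫ 6 (l(1 - l))²(w + σ) dσ = 1
(`kernelDominated_logCalc`). The reverse bound uses ∫ η(w + τ) γ(e^(w+τ)) dτ = c with η = (1 -
l)^(k+1) l (`kernelDominated_logSquare`); c does not depend on w by Cauchy's theorem, and c ≠ 0 for
some k by Weierstrass approximation and the identity theorem. As η and l(1 - l) are polynomials in
l, only products of γ(tA) with resolvents are needed, never a general product formula. Finally P is
a Laplace-type integral of D, and t A T(t) = ((1 + tA) T(t/2))² P.

For the function z(1 + z)⁻¹ the integrand is at least a positive constant over t for t ≥ 1 unless J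
x = x; hence J = 1 and A = 0. -/

noncomputable section

/-! ### Resolvents -/

section Resolvents

variable {X : Type*} [NormedAddCommGroup X] [NormedSpace ℂ X]

/-- Only the limit from the right at `a` enters, because `T t x` carries no information at `t = 0`;
the value of `f` at `a` is overwritten by that limit. -/
theorem MeasureTheory.integral_Ioi_of_hasDerivAt_of_tendsto_nhdsGT {E : Type*}
    [NormedAddCommGroup E] [NormedSpace ℝ E] [CompleteSpace E] {f f' : ℝ → E} {a : ℝ} {m n : E}
    (hderiv : ∀ x ∈ Ioi a, HasDerivAt f (f' x) x) (f'int : IntegrableOn f' (Ioi a))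
    (ha : Tendsto f (𝓝[>] a) (𝓝 n)) (hf : Tendsto f atTop (𝓝 m)) :
    ∫ x in Ioi a, f' x = m - n := by
  have h := integral_Ioi_of_hasDerivAt_of_tendsto (f := Function.update f a n) (f' := f') (a := a)
    (m := m) ?_ ?_ f'int ?_
  · simpa using h
  · rw [continuousWithinAt_update_same]
    simpa using ha
  · intro x hx
    refine (hderiv x hx).congr_of_eventuallyEq ?_
    filter_upwards [Ioi_mem_nhds hx] with y hy
    exact Function.update_of_ne (ne_of_gt hy) _ _
  · refine hf.congr' ?_
    filter_upwards [Ioi_mem_atTop a] with y hy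
    exact (Function.update_of_ne (ne_of_gt hy) _ _).symm

theorem MeasureTheory.setIntegral_Ioi_comp_add_right {E : Type*} [NormedAddCommGroup E]
    [NormedSpace ℝ E] (f : ℝ → E) (t : ℝ) : ∫ s in Ioi 0, f (s + t) = ∫ s in Ioi t, f s := by
  have := (measurePreserving_add_right volume t).setIntegral_preimage_emb
    (MeasurableEquiv.addRight t).measurableEmbedding f (Ioi t)
  simpa using this

theorem IsResolventAt.eq {A : X →ₗ.[ℂ] X} {z : ℂ} {R R' : X →L[ℂ] X}
    (h : IsResolventAt A z R) (h' : IsResolventAt A z R') : R = R' := by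
  ext x
  obtain ⟨hx, hx'⟩ := h.1 x
  have := h'.2 ⟨R x, hx⟩
  rw [hx'] at this
  exact this.symm

theorem IsResolventAt.inResolventSet {A : X →ₗ.[ℂ] X} {z : ℂ} {R : X →L[ℂ] X}
    (h : IsResolventAt A z R) : InResolventSet A z := ⟨R, h⟩

theorem InResolventSet.isResolventAt {A : X →ₗ.[ℂ] X} {z : ℂ} (h : InResolventSet A z) :
    IsResolventAt A z (resolventOp A z) := by
  rw [resolventOp, dif_pos h]
  exact h.choose_spec

theorem IsResolventAt.resolventOp_eq {A : X →ₗ.[ℂ] X} {z : ℂ} {R : X →L[ℂ] X}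
    (h : IsResolventAt A z R) : resolventOp A z = R :=
  h.inResolventSet.isResolventAt.eq h

theorem IsResolventAt.of_neg {A : X →ₗ.[ℂ] X} {z : ℂ} {R : X →L[ℂ] X}
    (h : IsResolventAt (-A) z R) : IsResolventAt A (-z) (-R) := by
  refine ⟨fun x => ?_, fun y => ?_⟩
  · obtain ⟨hx, hx'⟩ := h.1 x
    have hx2 : R x ∈ A.domain := hx
    refine ⟨A.domain.neg_mem hx2, ?_⟩
    have e : (⟨(-R) x, A.domain.neg_mem hx2⟩ : A.domain) = -⟨R x, hx2⟩ := rfl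
    rw [e, A.map_neg]
    refine Eq.trans ?_ hx'
    rw [neg_apply, neg_smul_neg]
    rfl
  · have := h.2 y
    simp only [LinearPMap.neg_apply, sub_neg_eq_add] at this
    conv_rhs => rw [← this]
    rw [neg_apply, ← map_neg]
    congr 1
    simp
    abel

theorem IsResolventAt.smul {A : X →ₗ.[ℂ] X} {z : ℂ} {R : X →L[ℂ] X} {t : ℂ} (ht : t ≠ 0)
    (h : IsResolventAt A z R) : IsResolventAt (t • A) (t * z) (t⁻¹ • R) := by
  refine ⟨fun x => ?_, fun y => ?_⟩
  · obtain ⟨hx, hx'⟩ := h.1 x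
    refine ⟨A.domain.smul_mem _ hx, ?_⟩
    have e : (t • A) ⟨(t⁻¹ • R) x, A.domain.smul_mem _ hx⟩ = A ⟨R x, hx⟩ := by
      change t • A (t⁻¹ • ⟨R x, hx⟩) = _
      rw [A.map_smul, smul_inv_smul₀ ht]
    rw [e, smul_apply, mul_comm t z, mul_smul, smul_inv_smul₀ ht, hx']
  · have := h.2 y
    change (t⁻¹ • R) ((t * z) • (y : X) - t • A y) = y
    rw [mul_smul, ← smul_sub, smul_apply, map_smul, inv_smul_smul₀ ht, this]

theorem resolventOp_smul (A : X →ₗ.[ℂ] X) {t : ℂ} (ht : t ≠ 0) (z : ℂ) :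
    resolventOp (t • A) (t * z) = t⁻¹ • resolventOp A z := by
  by_cases h : InResolventSet A z
  · exact (h.isResolventAt.smul ht).resolventOp_eq
  -- Off the resolvent set both sides take the default value 0, so the scaling rule needs no
  -- hypothesis on `z`.
  · have h' : ¬ InResolventSet (t • A) (t * z) := fun ⟨R, hR⟩ => h ⟨_, by
      have := hR.smul (inv_ne_zero ht)
      rwa [inv_mul_cancel_left₀ ht, smul_smul, inv_mul_cancel₀ ht, one_smul] at this⟩
    rw [resolventOp, dif_neg h', resolventOp, dif_neg h, smul_zero]

/-- The resolvent identity. -/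
theorem IsResolventAt.sub_smul_comp {A : X →ₗ.[ℂ] X} {z w : ℂ} {R S : X →L[ℂ] X}
    (hR : IsResolventAt A z R) (hS : IsResolventAt A w S) :
    (w - z) • (R * S) = R - S := by
  ext x
  obtain ⟨hx, hx'⟩ := hS.1 x
  have h1 := hR.2 ⟨S x, hx⟩
  have h2 : A ⟨S x, hx⟩ = w • S x - x := by
    rw [eq_sub_iff_add_eq', ← eq_sub_iff_add_eq]
    exact hx'.symm
  rw [h2] at h1
  simp only [map_sub, map_smul] at h1
  simp only [smul_apply, mul_apply_eq_comp,
    sub_apply, sub_smul]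
  rw [← sub_eq_zero] at h1 ⊢
  rw [← neg_eq_zero, ← h1]
  abel

end Resolvents

/-! ### Bounded analytic semigroups -/

section Semigroups

variable {X : Type*} [NormedAddCommGroup X] [NormedSpace ℂ X]

/-- The basic properties of a bounded analytic semigroup `T` with generator `-A`, where
`D t = A T(t)`. -/
structure IsAnalyticGenerator (A : X →ₗ.[ℂ] X) (T D : ℝ → X →L[ℂ] X) (M : ℝ) : Prop where
  pos : 0 < M
  norm_le : ∀ t, 0 < t → ‖T t‖ ≤ M
  norm_deriv_le : ∀ t, 0 < t → ‖D t‖ ≤ M / t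
  add : ∀ s t, 0 < s → 0 < t → T (s + t) = T s * T t
  hasDerivAt : ∀ t, 0 < t → HasDerivAt T (-(D t)) t
  mem_domain : ∀ t, 0 < t → ∀ x, ∃ h : T t x ∈ A.domain, A ⟨T t x, h⟩ = D t x
  apply_map : ∀ t, 0 < t → ∀ y : A.domain, T t (A y) = D t y
  tendsto : ∀ y ∈ A.domain, Tendsto (fun t => T t y) (𝓝[>] 0) (𝓝 y)
  resolvent : ∀ l : ℂ, 0 < l.re → ∃ R : X →L[ℂ] X, IsResolventAt A (-l) (-R) ∧ ‖R‖ ≤ M / l.re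

/-- The sector is a cone, so a disc about 1 rescales to discs about `t` of radius proportional to
`t`. Cauchy's estimate on these discs yields the bound M/t for the derivative. -/
theorem isOpen_sector_one {θ : ℝ} (h : 0 < θ) :
    ∃ c, 0 < c ∧ c < 1 ∧ ∀ t : ℝ, 0 < t → Metric.closedBall (t : ℂ) (t * c) ⊆ sector θ := by
  have h1 : sector θ ∈ 𝓝 (1 : ℂ) := by
    have h2 : ContinuousAt (fun z : ℂ => |Complex.arg z|) 1 :=
      (Complex.continuousAt_arg (by simp)).abs
    filter_upwards [h2.eventually_lt_const (u := θ) (by simpa using h),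
      isOpen_ne.mem_nhds (one_ne_zero (α := ℂ))] with z hz hz'
    exact ⟨hz', hz⟩
  obtain ⟨e, he, hball⟩ := Metric.nhds_basis_closedBall.mem_iff.1 h1
  refine ⟨min e (1 / 2), by positivity, by
    exact (min_le_right _ _).trans_lt (by norm_num), fun t ht z hz => ?_⟩
  have ht' : (t : ℂ) ≠ 0 := by exact_mod_cast ht.ne'
  have hz' : (t : ℂ)⁻¹ * z ∈ Metric.closedBall (1 : ℂ) e := by
    rw [mem_closedBall_iff_norm] at hz ⊢
    have : (t : ℂ)⁻¹ * z - 1 = (t : ℂ)⁻¹ * (z - t) := by field_simp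
    rw [this, norm_mul, norm_inv, Complex.norm_real, Real.norm_of_nonneg ht.le]
    rw [inv_mul_le_iff₀ ht]
    exact hz.trans (by gcongr; exact min_le_left _ _)
  obtain ⟨h3, h4⟩ := hball hz'
  refine ⟨fun h0 => h3 (by simp [h0]), ?_⟩
  rwa [← Complex.ofReal_inv, Complex.arg_real_mul _ (inv_pos.2 ht)] at h4

theorem IsBoundedAnalyticSemigroup.exists_deriv [CompleteSpace X] {T : ℝ → X →L[ℂ] X}
    (hT : IsBoundedAnalyticSemigroup T) :
    ∃ (D : ℝ → X →L[ℂ] X) (M : ℝ), 0 < M ∧ (∀ t, 0 < t → ‖T t‖ ≤ M) ∧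
      (∀ t, 0 < t → ‖D t‖ ≤ M / t) ∧ ∀ t, 0 < t → HasDerivAt T (-(D t)) t := by
  obtain ⟨-, θ, hθ, -, F, hF, ⟨M, hM⟩, hFT⟩ := hT
  obtain ⟨c, hc, hc1, hball⟩ := isOpen_sector_one hθ
  have hmem : ∀ t : ℝ, 0 < t → (t : ℂ) ∈ sector θ := fun t ht =>
    hball t ht (Metric.mem_closedBall_self (by positivity))
  have hM0 : 0 ≤ M := (norm_nonneg _).trans (hM _ (hmem 1 one_pos))
  -- One constant serves both bounds; `M + 1` replaces `M` to make it strictly positive.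
  have hMc : M ≤ (M + 1) / c := by
    rw [le_div_iff₀ hc]
    nlinarith
  refine ⟨fun t => -deriv F t, (M + 1) / c, by positivity, fun t ht => ?_, fun t ht => ?_,
    fun t ht => ?_⟩
  · rw [← hFT t ht]
    exact (hM _ (hmem t ht)).trans hMc
  · rw [norm_neg]
    have htc : 0 < t * c := by positivity
    have := Complex.norm_deriv_le_of_forall_mem_sphere_norm_le (c := (t : ℂ)) (f := F) (C := M)
      htc ?_ fun z hz => hM z (hball t ht (Metric.sphere_subset_closedBall hz))
    · refine this.trans ?_
      rw [div_div, mul_comm c t]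
      gcongr
      linarith
    · refine DifferentiableOn.diffContOnCl (hF.mono ?_)
      rw [closure_ball _ htc.ne']
      exact hball t ht
  · have hd : HasDerivAt F (deriv F t) (t : ℂ) := by
      refine (hF.differentiableAt ?_).hasDerivAt
      exact mem_of_superset (Metric.closedBall_mem_nhds _ (by positivity)) (hball t ht)
    have h2 := hd.scomp_of_eq t Complex.ofRealCLM.hasDerivAt (by simp)
    simp only [Complex.ofRealCLM_apply, Complex.ofReal_one, one_smul] at h2
    rw [neg_neg]
    refine h2.congr_of_eventuallyEq ?_
    filter_upwards [Ioi_mem_nhds ht] with s hs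
    exact (hFT s hs).symm

/-- Shifting the variable in the Laplace integral gives T(t) R x = e^{lt} (R x - ∫₀ᵗ e^{-ls} T(s) x
ds). The derivative and the limit at 0 are read off from this formula, without any continuity of T
at 0 on all of X. -/
theorem laplace_deriv_semigroup [CompleteSpace X] {T : ℝ → X →L[ℂ] X}
    (hc : ∀ x, ContinuousOn (fun t => T t x) (Ioi 0))
    (hadd : ∀ s t, 0 < s → 0 < t → T (s + t) = T s * T t) {l : ℝ} {R : X →L[ℂ] X}
    (hint : ∀ x, IntegrableOn (fun t : ℝ => (Real.exp (-(l * t)) : ℂ) • T t x) (Ioi 0))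
    (hR : ∀ x, R x = ∫ t in Ioi (0 : ℝ), (Real.exp (-(l * t)) : ℂ) • T t x) :
    (∀ t, 0 < t → T t * R = R * T t) ∧
    (∀ t, 0 < t → ∀ x, HasDerivAt (fun s => T s (R x)) ((l : ℂ) • T t (R x) - T t x) t) ∧
    ∀ x, Tendsto (fun t => T t (R x)) (𝓝[>] 0) (𝓝 (R x)) := by
  have hcomm : ∀ t, 0 < t → T t * R = R * T t := by
    intro t ht
    ext x
    simp only [mul_apply_eq_comp]
    rw [hR, hR, ← ContinuousLinearMap.integral_comp_comm _ (hint x)]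
    refine setIntegral_congr_fun measurableSet_Ioi fun s hs => ?_
    simp only [map_smul]
    congr 1
    rw [← mul_apply_eq_comp, ← hadd t s ht hs, add_comm, hadd s t hs ht]
    rfl
  have key : ∀ x t, 0 < t → T t (R x) = (Real.exp (l * t) : ℂ) •
      (R x - ∫ s in (0 : ℝ)..t, (Real.exp (-(l * s)) : ℂ) • T s x) := by
    intro x t ht
    have h1 : R x - ∫ s in (0 : ℝ)..t, (Real.exp (-(l * s)) : ℂ) • T s x =
        ∫ s in Ioi t, (Real.exp (-(l * s)) : ℂ) • T s x := by
      rw [hR, intervalIntegral.integral_of_le ht.le, ← Ioc_union_Ioi_eq_Ioi ht.le,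
        setIntegral_union (Ioc_disjoint_Ioi le_rfl) measurableSet_Ioi
          ((hint x).mono_set Ioc_subset_Ioi_self) ((hint x).mono_set (Ioi_subset_Ioi ht.le))]
      abel
    have h2 := setIntegral_Ioi_comp_add_right (fun s => (Real.exp (-(l * s)) : ℂ) • T s x) t
    rw [h1, hR, ← ContinuousLinearMap.integral_comp_comm _ (hint x)]
    rw [← h2, ← integral_smul]
    refine setIntegral_congr_fun measurableSet_Ioi fun s hs => ?_
    simp only [map_smul, smul_smul]
    rw [add_comm s t, hadd t s ht hs, ← Complex.ofReal_mul, ← Real.exp_add]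
    congr 3
    ring_nf
  have hcont : ∀ x, ContinuousOn (fun s : ℝ => (Real.exp (-(l * s)) : ℂ) • T s x) (Ioi 0) :=
    fun x => ContinuousOn.smul (by fun_prop) (hc x)
  have hII : ∀ x t, 0 ≤ t → IntervalIntegrable
      (fun s : ℝ => (Real.exp (-(l * s)) : ℂ) • T s x) volume 0 t := fun x t ht => by
    rw [intervalIntegrable_iff_integrableOn_Ioc_of_le ht]
    exact (hint x).mono_set Ioc_subset_Ioi_self
  refine ⟨hcomm, fun t ht x => ?_, fun x => ?_⟩
  · have h1 : HasDerivAt (fun u => ∫ s in (0 : ℝ)..u, (Real.exp (-(l * s)) : ℂ) • T s x)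
        ((Real.exp (-(l * t)) : ℂ) • T t x) t := by
      refine intervalIntegral.integral_hasDerivAt_right (hII x t ht.le) ?_ ?_
      · exact (hcont x).stronglyMeasurableAtFilter isOpen_Ioi t ht
      · exact (hcont x).continuousAt (Ioi_mem_nhds ht)
    have h2 : HasDerivAt (fun u : ℝ => (Real.exp (l * u) : ℂ)) (Real.exp (l * t) * l : ℝ) t := by
      have := ((hasDerivAt_id t).const_mul l).exp.ofReal_comp
      simpa using this
    have h3 := h2.smul (h1.const_sub (R x))
    refine (h3.congr_of_eventuallyEq ?_).congr_deriv ?_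
    · filter_upwards [Ioi_mem_nhds ht] with s hs
      exact key x s hs
    · rw [key x t ht, smul_neg, smul_smul, smul_smul, ← Complex.ofReal_mul, ← Real.exp_add]
      simp [mul_comm]
      abel
  · have h1 : Tendsto (fun t => ∫ s in (0 : ℝ)..t, (Real.exp (-(l * s)) : ℂ) • T s x) (𝓝[>] 0)
        (𝓝 0) := by
      have h2 := intervalIntegral.continuousOn_primitive_interval'
        (hII x 1 zero_le_one) left_mem_uIcc
      have h3 := h2 0 left_mem_uIcc
      simp only [ContinuousWithinAt, intervalIntegral.integral_same] at h3
      refine h3.mono_left ?_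
      rw [uIcc_of_le zero_le_one]
      exact nhdsWithin_le_of_mem (Icc_mem_nhdsGT one_pos)
    have h4 : Tendsto (fun t : ℝ => (Real.exp (l * t) : ℂ)) (𝓝[>] 0) (𝓝 1) := by
      have : Continuous (fun t : ℝ => (Real.exp (l * t) : ℂ)) := by fun_prop
      simpa using (this.tendsto 0).mono_left (nhdsWithin_le_nhds (s := Ioi 0))
    have h5 := h4.smul (h1.const_sub (R x))
    rw [one_smul, sub_zero] at h5
    refine h5.congr' ?_
    filter_upwards [self_mem_nhdsWithin] with t ht
    exact (key x t ht).symm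

end Semigroups

/-! ### From a generator to resolvent bounds on the right half-plane -/

section Generators

variable {X : Type*} [NormedAddCommGroup X] [NormedSpace ℂ X]

theorem HasDerivAt.clm_apply_const {T : ℝ → X →L[ℂ] X} {T' : X →L[ℂ] X} {t : ℝ}
    (h : HasDerivAt T T' t) (x : X) : HasDerivAt (fun s => T s x) (T' x) t :=
  (((ContinuousLinearMap.apply ℂ X) x).restrictScalars ℝ).hasFDerivAt.comp_hasDerivAt t h

theorem norm_cexp_neg_mul_ofReal (l : ℂ) (t : ℝ) :
    ‖Complex.exp (-(l * t))‖ = Real.exp (-(l.re * t)) := by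
  rw [Complex.norm_exp]
  simp

/-- For `Re l > 0`, the Laplace transform of a bounded semigroup at `l` is the resolvent of its
generator. -/
theorem exists_isResolventAt_laplace [CompleteSpace X] {A : X →ₗ.[ℂ] X}
    {T D : ℝ → X →L[ℂ] X} {M : ℝ}
    (hM : ∀ t, 0 < t → ‖T t‖ ≤ M) (hd : ∀ t, 0 < t → HasDerivAt T (-(D t)) t)
    (happ : ∀ t, 0 < t → ∀ y : A.domain, T t (A y) = D t y)
    (hlim : ∀ y ∈ A.domain, Tendsto (fun t => T t y) (𝓝[>] 0) (𝓝 y))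
    {r : ℂ} {R : X →L[ℂ] X} (hR : IsResolventAt A (-r) (-R)) (hcomm : ∀ t, 0 < t → T t * R = R * T t)
    {l : ℂ} (hl : 0 < l.re) :
    ∃ L : X →L[ℂ] X, IsResolventAt A (-l) (-L) ∧ ‖L‖ ≤ M / l.re := by
  have hTc : ContinuousOn T (Ioi 0) := fun t ht => (hd t ht).continuousAt.continuousWithinAt
  have hec : ContinuousOn (fun t : ℝ => Complex.exp (-(l * t)) • T t) (Ioi 0) :=
    (show Continuous fun t : ℝ => Complex.exp (-(l * t)) by fun_prop).continuousOn.smul hTc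
  have hexp : IntegrableOn (fun t : ℝ => Real.exp (-(l.re * t)) * M) (Ioi 0) := by
    have := (exp_neg_integrableOn_Ioi 0 hl).mul_const M
    simp only [neg_mul] at this
    exact this
  have hbd : ∀ t ∈ Ioi (0 : ℝ), ‖Complex.exp (-(l * t)) • T t‖ ≤ Real.exp (-(l.re * t)) * M := by
    intro t ht
    rw [norm_smul, norm_cexp_neg_mul_ofReal]
    gcongr
    exact hM t ht
  have hint : IntegrableOn (fun t : ℝ => Complex.exp (-(l * t)) • T t) (Ioi 0) := by
    refine hexp.mono' (hec.aestronglyMeasurable measurableSet_Ioi) ?_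
    filter_upwards [ae_restrict_mem measurableSet_Ioi] with t ht using hbd t ht
  set L : X →L[ℂ] X := ∫ t in Ioi (0 : ℝ), Complex.exp (-(l * t)) • T t with hL
  have hLx : ∀ x, L x = ∫ t in Ioi (0 : ℝ), Complex.exp (-(l * t)) • T t x := fun x => by
    rw [hL, ContinuousLinearMap.integral_apply hint]
    rfl
  have hintx : ∀ x, IntegrableOn (fun t : ℝ => Complex.exp (-(l * t)) • T t x) (Ioi 0) :=
    fun x => hint.apply_continuousLinearMap x
  have hLR : L * R = R * L := by
    ext x
    simp only [mul_apply_eq_comp]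
    rw [hLx, hLx, ← ContinuousLinearMap.integral_comp_comm _ (hintx x)]
    refine setIntegral_congr_fun measurableSet_Ioi fun t ht => ?_
    simp only [map_smul]
    rw [← mul_apply_eq_comp, hcomm t ht]
    rfl
  -- Left inverse: integrate the derivative of e^{-lt} T(t) y over (0, ∞). For y in D(A) the
  -- boundary value at 0 is y.
  have hinv : ∀ y : A.domain, L (l • (y : X) + A y) = y := by
    intro y
    have h1 : ∀ t ∈ Ioi (0 : ℝ), HasDerivAt (fun t : ℝ => Complex.exp (-(l * t)) • T t (y : X))
        (-(Complex.exp (-(l * t)) • T t (l • (y : X) + A y))) t := by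
      intro t ht
      have h2 : HasDerivAt (fun t : ℝ => Complex.exp (-(l * t))) (Complex.exp (-(l * t)) * -l) t := by
        have h3 := (((hasDerivAt_id (t : ℂ)).const_mul l).neg.cexp).comp_ofReal
        simpa using h3
      have h3 : HasDerivAt (fun t => T t (y : X)) (-(D t y)) t := by
        simpa using (hd t ht).clm_apply_const (y : X)
      refine (h2.smul h3).congr_deriv ?_
      rw [map_add, map_smul, happ t ht]
      module
    have h4 := integral_Ioi_of_hasDerivAt_of_tendsto_nhdsGT h1
      (hintx (l • (y : X) + A y)).neg (n := (y : X)) (m := 0) ?_ ?_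
    · rw [integral_neg, zero_sub, neg_inj] at h4
      rw [hLx]
      exact h4
    · have h5 : Tendsto (fun t : ℝ => Complex.exp (-(l * t))) (𝓝[>] 0) (𝓝 1) := by
        have : Continuous (fun t : ℝ => Complex.exp (-(l * t))) := by fun_prop
        simpa using (this.tendsto 0).mono_left (nhdsWithin_le_nhds (s := Ioi 0))
      simpa using h5.smul (hlim y y.2)
    · have h6 : Tendsto (fun t : ℝ => Real.exp (-(l.re * t)) * M * ‖(y : X)‖) atTop (𝓝 0) := by
        have : Tendsto (fun t : ℝ => Real.exp (-(l.re * t))) atTop (𝓝 0) :=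
          Real.tendsto_exp_neg_atTop_nhds_zero.comp (tendsto_id.const_mul_atTop hl)
        simpa using (this.mul_const M).mul_const ‖(y : X)‖
      refine squeeze_zero_norm' ?_ h6
      filter_upwards [Ioi_mem_atTop 0] with t ht
      exact ((Complex.exp (-(l * t)) • T t).le_opNorm y).trans (by gcongr; exact hbd t ht)
  have hRA : ∀ x, ∃ h : R x ∈ A.domain, A ⟨R x, h⟩ = x - r • R x := by
    intro x
    obtain ⟨h, h'⟩ := hR.1 (-x)
    refine ⟨by simpa using h, ?_⟩
    simp only [neg_apply, map_neg, neg_neg, neg_smul] at h'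
    linear_combination (norm := module) (-1 : ℂ) • h'
  refine ⟨L, ⟨fun x => ?_, fun y => ?_⟩, ?_⟩
  -- L commutes with R and is a left inverse on the range of R; this puts L x into that range, hence
  -- into D(A), and makes L a right inverse as well.
  · have h1 : L x = R (x - (l - r) • L x) := by
      obtain ⟨h, h'⟩ := hRA x
      have h2 := hinv ⟨R x, h⟩
      rw [h'] at h2
      rw [map_sub, map_smul, ← mul_apply_eq_comp, ← hLR, mul_apply_eq_comp]
      simp only [map_add, map_sub, map_smul] at h2
      rw [eq_sub_iff_add_eq]
      refine Eq.trans ?_ h2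
      module
    obtain ⟨h, h'⟩ := hRA (x - (l - r) • L x)
    rw [← h1] at h
    refine ⟨A.domain.neg_mem h, ?_⟩
    have e : (⟨(-L) x, A.domain.neg_mem h⟩ : A.domain) = -⟨L x, h⟩ := rfl
    have e2 : A ⟨L x, h⟩ = x - (l - r) • L x - r • L x := by
      rw [show (⟨L x, h⟩ : A.domain) = ⟨R (x - (l - r) • L x), h1 ▸ h⟩ from Subtype.ext h1, h', ← h1]
    rw [e, A.map_neg, e2]
    simp
    module
  · have := hinv y
    conv_rhs => rw [← this]
    rw [neg_apply, ← map_neg]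
    congr 1
    module
  · refine (norm_integral_le_integral_norm _).trans ?_
    refine (setIntegral_mono_on hint.norm hexp measurableSet_Ioi hbd).trans_eq ?_
    rw [integral_mul_const]
    have := integral_exp_mul_Ioi (neg_neg_of_pos hl) 0
    simp only [mul_zero, Real.exp_zero, neg_mul, neg_div_neg_eq] at this
    rw [this]
    ring

/-- The Laplace representation at one large `l` suffices: on the range of R the derivative of T is
known, D commutes with R because T does, and the elements of D(A) are exactly the values of R. -/
theorem IsBoundedAnalyticSemigroup.exists_isAnalyticGenerator [CompleteSpace X]
    {A : X →ₗ.[ℂ] X} {T : ℝ → X →L[ℂ] X}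
    (hT : IsBoundedAnalyticSemigroup T) (hA : IsGenerator (-A) T) :
    ∃ D M, IsAnalyticGenerator A T D M := by
  obtain ⟨D, M, hM0, hM, hDM, hd⟩ := hT.exists_deriv
  obtain ⟨w, hw⟩ := hA
  obtain ⟨R, hR, hRl⟩ := hw (max w 0 + 1) (by linarith [le_max_left w 0])
  set l : ℝ := max w 0 + 1
  have hadd : ∀ s t, 0 < s → 0 < t → T (s + t) = T s * T t := hT.1.add
  obtain ⟨hcomm, hdR, hlim⟩ := laplace_deriv_semigroup hT.1.continuousOn hadd
    (fun x => (hRl x).1) (fun x => (hRl x).2)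
  have hR' := hR.of_neg
  have hDR : ∀ t, 0 < t → ∀ x, D t (R x) = T t x - (l : ℂ) • T t (R x) := by
    intro t ht x
    have h1 : HasDerivAt (fun s => T s (R x)) (-(D t (R x))) t := by
      simpa using (hd t ht).clm_apply_const (R x)
    rw [← neg_inj, h1.unique (hdR t ht x)]
    abel
  have hcommD : ∀ t, 0 < t → D t * R = R * D t := by
    intro t ht
    have h1 := (hd t ht).mul_const R
    have h2 := (hd t ht).const_mul R
    have h3 := (h1.congr_of_eventuallyEq (f₁ := fun y => R * T y) (by
      filter_upwards [Ioi_mem_nhds ht] with s hs using (hcomm s hs).symm)).unique h2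
    simpa using h3
  have hRA : ∀ x, ∃ h : R x ∈ A.domain, A ⟨R x, h⟩ = x - (l : ℂ) • R x := by
    intro x
    obtain ⟨h, h'⟩ := hR.1 x
    refine ⟨h, ?_⟩
    rw [LinearPMap.neg_apply, sub_neg_eq_add] at h'
    rw [eq_sub_iff_add_eq']
    exact h'
  have hRA' : ∀ y : A.domain, (y : X) = R ((l : ℂ) • (y : X) + A y) := by
    intro y
    have := hR.2 y
    rw [LinearPMap.neg_apply, sub_neg_eq_add] at this
    exact this.symm
  have happ : ∀ t, 0 < t → ∀ y : A.domain, T t (A y) = D t y := by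
    intro t ht y
    conv_rhs => rw [hRA' y, hDR t ht, ← hRA' y]
    simp
  have hlimA : ∀ y ∈ A.domain, Tendsto (fun t => T t y) (𝓝[>] 0) (𝓝 y) := by
    intro y hy
    have := hRA' ⟨y, hy⟩
    simp only at this
    rw [this]
    exact hlim _
  refine ⟨D, M, hM0, hM, hDM, hadd, hd, fun t ht x => ?_, happ, hlimA, fun r hr => ?_⟩
  -- Analyticity enters here: D(t) x exists for every x, which exhibits T(t) x as a value of R.
  · have h1 : T t x = R (D t x + (l : ℂ) • T t x) := by
      have h2 := hDR t ht x
      rw [← mul_apply_eq_comp, hcommD t ht, ← mul_apply_eq_comp, hcomm t ht] at h2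
      rw [map_add, map_smul, ← mul_apply_eq_comp, h2, ← mul_apply_eq_comp]
      simp
    obtain ⟨h, h'⟩ := hRA (D t x + (l : ℂ) • T t x)
    rw [← h1] at h
    refine ⟨h, ?_⟩
    rw [show (⟨T t x, h⟩ : A.domain) = ⟨R (D t x + (l : ℂ) • T t x), h1 ▸ h⟩ from Subtype.ext h1,
      h', ← h1]
    simp
  · exact exists_isResolventAt_laplace hM hd happ hlimA hR' hcomm hr

/-- For |arg z| > φ > π/2 one has Re(-z) > -|z| cos φ, so the half-plane bound M / Re(-z) is at most
a constant over |z|. This also shows that the infimum defining the sectoriality angle is over a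
nonempty set. -/
theorem IsAnalyticGenerator.isSectorial {A : X →ₗ.[ℂ] X} {T D : ℝ → X →L[ℂ] X} {M : ℝ}
    (h : IsAnalyticGenerator A T D M) : IsSectorial A (Real.pi / 2) := by
  have hre : ∀ z : ℂ, z ≠ 0 → ∀ φ, Real.pi / 2 ≤ φ → φ < Real.pi → φ < |Complex.arg z| →
      z.re < ‖z‖ * Real.cos φ := by
    intro z hz φ h1 h2 h3
    have h4 : Real.cos |Complex.arg z| < Real.cos φ := by
      refine Real.strictAntiOn_cos ⟨by linarith [Real.pi_pos], h2.le⟩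
        ⟨abs_nonneg _, Complex.abs_arg_le_pi z⟩ h3
    rw [Real.cos_abs, Complex.cos_arg hz, div_lt_iff₀ (by positivity)] at h4
    linarith
  refine ⟨fun z hz hz' => ?_, fun φ hφ hφ' => ⟨M / (-Real.cos φ), fun z hz hz' => ?_⟩⟩
  · have := hre z hz _ le_rfl (by linarith [Real.pi_pos]) hz'
    rw [Real.cos_pi_div_two, mul_zero] at this
    obtain ⟨R, hR, -⟩ := h.resolvent (-z) (by simpa using this)
    rw [neg_neg] at hR
    exact hR.inResolventSet
  · have h1 := hre z hz φ hφ.le hφ' hz'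
    have hcos : Real.cos φ < 0 := Real.cos_neg_of_pi_div_two_lt_of_lt hφ (by linarith [Real.pi_pos])
    have hz0 : 0 < ‖z‖ := by positivity
    have h0 : 0 < (-z).re := by
      simp only [Complex.neg_re]
      nlinarith
    obtain ⟨R, hR, hRM⟩ := h.resolvent (-z) h0
    rw [neg_neg] at hR
    rw [hR.resolventOp_eq, norm_smul, norm_neg]
    calc ‖z‖ * ‖R‖ ≤ ‖z‖ * (M / (-z).re) := by gcongr
      _ ≤ ‖z‖ * (M / (‖z‖ * (-Real.cos φ))) := by
        have := h.pos
        gcongr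
        · nlinarith
        · simp only [Complex.neg_re]
          linarith
      _ = M / (-Real.cos φ) := by
        field_simp

/-- The infimum need not be attained, and sectoriality of an angle bounds z R(z, A) only outside
strictly larger sectors; hence the midpoint between ν and an admissible angle below it. -/
theorem IsAnalyticGenerator.exists_bound {A : X →ₗ.[ℂ] X} {T D : ℝ → X →L[ℂ] X} {M : ℝ}
    (h : IsAnalyticGenerator A T D M) {ν : ℝ} (hν : sectorialityAngle A < ν) (hν' : ν < Real.pi) :
    ∃ φ K, 0 < φ ∧ φ < ν ∧ 0 < K ∧ ∀ z : ℂ, z ≠ 0 → φ < |Complex.arg z| →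
      InResolventSet A z ∧ ‖z • resolventOp A z‖ ≤ K := by
  have hne : {φ : ℝ | 0 ≤ φ ∧ φ < Real.pi ∧ IsSectorial A φ}.Nonempty :=
    ⟨Real.pi / 2, by linarith [Real.pi_pos], by linarith [Real.pi_pos], h.isSectorial⟩
  obtain ⟨φ, ⟨h0, -, h1, h2⟩, hφ⟩ := exists_lt_of_csInf_lt hne hν
  obtain ⟨K, hK⟩ := h2 ((φ + ν) / 2) (by linarith) (by linarith)
  refine ⟨(φ + ν) / 2, max K 1, by linarith, by linarith, by positivity, fun z hz hz' =>
    ⟨h1 z hz (by linarith), (hK z hz hz').trans (le_max_left _ _)⟩⟩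

end Generators

/-! ### Algebra of the operators (1 + tA)⁻¹, T(t) and A T(t) -/

section Algebra

variable {X : Type*} [NormedAddCommGroup X] [NormedSpace ℂ X]

theorem MeasureTheory.AEStronglyMeasurable.clm_apply_complex {α : Type*} [MeasurableSpace α]
    {μ : Measure α} {S : α → X →L[ℂ] X} {f : α → X} (hS : AEStronglyMeasurable S μ)
    (hf : AEStronglyMeasurable f μ) : AEStronglyMeasurable (fun a => S a (f a)) μ :=
  (ContinuousLinearMap.id ℂ (X →L[ℂ] X)).aestronglyMeasurable_comp₂ hS hf

theorem HasDerivAt.clm_apply_complex {S : ℝ → X →L[ℂ] X} {S' : X →L[ℂ] X} {u : ℝ → X} {u' : X}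
    {t : ℝ} (hS : HasDerivAt S S' t) (hu : HasDerivAt u u' t) :
    HasDerivAt (fun s => S s (u s)) (S' (u t) + S t u') t :=
  ((ContinuousLinearMap.restrictScalarsL ℂ X X ℝ ℝ).hasFDerivAt.comp_hasDerivAt t hS).clm_apply hu

/-- The bounded operator `z R(z, A)`. -/
def zResolvent (A : X →ₗ.[ℂ] X) (z : ℂ) : X →L[ℂ] X := z • resolventOp A z

/-- The operator `(1 + t A)⁻¹`, for `t > 0` such that `-1/t` is in the resolvent set. -/
def oneAddInv (A : X →ₗ.[ℂ] X) (t : ℝ) : X →L[ℂ] X := zResolvent A (-(t : ℂ)⁻¹)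

theorem sub_smul_zResolvent_mul {A : X →ₗ.[ℂ] X} {z w : ℂ} (hz : InResolventSet A z)
    (hw : InResolventSet A w) :
    (w - z) • (zResolvent A z * zResolvent A w) = w • zResolvent A z - z • zResolvent A w := by
  have h := hz.isResolventAt.sub_smul_comp hw.isResolventAt
  simp only [zResolvent, smul_mul_assoc, mul_smul_comm]
  calc (w - z) • w • z • (resolventOp A z * resolventOp A w)
      = (w * z) • ((w - z) • (resolventOp A z * resolventOp A w)) := by module
    _ = _ := by rw [h]; module

theorem zResolvent_comm {A : X →ₗ.[ℂ] X} {z w : ℂ} (hz : InResolventSet A z)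
    (hw : InResolventSet A w) :
    zResolvent A z * zResolvent A w = zResolvent A w * zResolvent A z := by
  rcases eq_or_ne z w with rfl | h
  · rfl
  have h1 := sub_smul_zResolvent_mul hz hw
  have h2 := sub_smul_zResolvent_mul hw hz
  have h3 : (w - z) • (zResolvent A z * zResolvent A w) =
      (w - z) • (zResolvent A w * zResolvent A z) := by
    rw [h1, ← neg_sub z w, neg_smul, h2]
    abel
  exact smul_right_injective _ (sub_ne_zero.2 h.symm) h3

theorem one_add_smul_zResolvent_mul_oneAddInv {A : X →ₗ.[ℂ] X} {z : ℂ} {t : ℝ} (ht : 0 < t)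
    (hz : InResolventSet A z) (ht' : InResolventSet A (-(t : ℂ)⁻¹)) :
    (1 + t * z) • (zResolvent A z * oneAddInv A t) = zResolvent A z + (t * z) • oneAddInv A t := by
  have h := sub_smul_zResolvent_mul hz ht'
  have ht0 : (t : ℂ) ≠ 0 := by exact_mod_cast ht.ne'
  have h1 := congrArg (fun S => (-(t : ℂ)) • S) h
  simp only [smul_smul, smul_sub] at h1
  rw [oneAddInv]
  convert h1 using 1
  · congr 1
    field_simp
    ring
  · rw [neg_mul_neg, mul_inv_cancel₀ ht0, one_smul, neg_mul, neg_smul, sub_neg_eq_add]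

namespace IsAnalyticGenerator

variable {A : X →ₗ.[ℂ] X} {T D : ℝ → X →L[ℂ] X} {M : ℝ}

theorem inResolventSet (h : IsAnalyticGenerator A T D M) {t : ℝ} (ht : 0 < t) :
    InResolventSet A (-(t : ℂ)⁻¹) := by
  obtain ⟨R, hR, -⟩ := h.resolvent ((t : ℂ)⁻¹) (by
    rw [← Complex.ofReal_inv, Complex.ofReal_re]; positivity)
  exact hR.inResolventSet

theorem norm_oneAddInv_le (h : IsAnalyticGenerator A T D M) {t : ℝ} (ht : 0 < t) :
    ‖oneAddInv A t‖ ≤ M := by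
  obtain ⟨R, hR, hR'⟩ := h.resolvent ((t : ℂ)⁻¹) (by
    rw [← Complex.ofReal_inv, Complex.ofReal_re]; positivity)
  rw [oneAddInv, zResolvent, hR.resolventOp_eq, norm_smul, norm_neg, norm_neg, norm_inv,
    Complex.norm_real, Real.norm_of_nonneg ht.le]
  rw [← Complex.ofReal_inv, Complex.ofReal_re, div_inv_eq_mul] at hR'
  rw [inv_mul_le_iff₀ ht]
  linarith

theorem oneAddInv_apply_add (h : IsAnalyticGenerator A T D M) {t : ℝ} (ht : 0 < t)
    (y : A.domain) : oneAddInv A t (y + (t : ℂ) • A y) = y := by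
  have ht0 : (t : ℂ) ≠ 0 := by exact_mod_cast ht.ne'
  have h1 := (h.inResolventSet ht).isResolventAt.2 y
  conv_rhs => rw [← h1]
  rw [oneAddInv, zResolvent, smul_apply, ← map_smul]
  congr 1
  rw [smul_add, smul_smul, neg_mul, inv_mul_cancel₀ ht0]
  module

theorem oneAddInv_mem (h : IsAnalyticGenerator A T D M) {t : ℝ} (ht : 0 < t) (x : X) :
    ∃ hx : oneAddInv A t x ∈ A.domain, oneAddInv A t x + (t : ℂ) • A ⟨oneAddInv A t x, hx⟩ = x := by
  have ht0 : (t : ℂ) ≠ 0 := by exact_mod_cast ht.ne'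
  obtain ⟨h1, h2⟩ := (h.inResolventSet ht).isResolventAt.1 x
  refine ⟨A.domain.smul_mem _ h1, ?_⟩
  have e : A ⟨oneAddInv A t x, A.domain.smul_mem _ h1⟩ = (-(t : ℂ)⁻¹) • A ⟨_, h1⟩ := by
    rw [← A.map_smul]
    rfl
  rw [e, smul_smul, mul_neg, mul_inv_cancel₀ ht0]
  refine Eq.trans ?_ h2
  rw [oneAddInv, zResolvent, smul_apply]
  module

/-- `y ∈ D(A)` and `A y = w` if and only if `y = (1 + A)⁻¹ (y + w)`. -/
theorem mem_domain_iff (h : IsAnalyticGenerator A T D M) {y w : X} :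
    (∃ hy : y ∈ A.domain, A ⟨y, hy⟩ = w) ↔ y = oneAddInv A 1 (y + w) := by
  constructor
  · rintro ⟨hy, rfl⟩
    simpa using (h.oneAddInv_apply_add one_pos ⟨y, hy⟩).symm
  · intro hy
    obtain ⟨h1', h2⟩ := h.oneAddInv_mem one_pos (y + w)
    have h1 : y ∈ A.domain := by rwa [← hy] at h1'
    refine ⟨h1, ?_⟩
    have e : A ⟨_, h1'⟩ = A ⟨y, h1⟩ := congrArg A (Subtype.ext hy.symm)
    rw [e, ← hy] at h2
    simpa using h2

theorem oneAddInv_injective (h : IsAnalyticGenerator A T D M) {t : ℝ} (ht : 0 < t) {x y : X}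
    (hxy : oneAddInv A t x = oneAddInv A t y) : x = y := by
  obtain ⟨h1, h2⟩ := h.oneAddInv_mem ht (x - y)
  have h3 : oneAddInv A t (x - y) = 0 := by rw [map_sub, hxy, sub_self]
  rw [show (⟨_, h1⟩ : A.domain) = 0 from Subtype.ext h3, h3, A.map_zero] at h2
  simpa [sub_eq_zero, eq_comm] using h2

theorem comm_oneAddInv (h : IsAnalyticGenerator A T D M) {t s : ℝ} (ht : 0 < t) (hs : 0 < s) :
    T s * oneAddInv A t = oneAddInv A t * T s := by
  ext x
  obtain ⟨h1, h2⟩ := h.oneAddInv_mem ht x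
  obtain ⟨h3, h4⟩ := h.mem_domain s hs (oneAddInv A t x)
  have h5 := h.oneAddInv_apply_add ht ⟨_, h3⟩
  simp only at h5
  rw [h4, ← h.apply_map s hs ⟨_, h1⟩, ← map_smul, ← map_add, h2] at h5
  exact h5.symm

theorem add_deriv_mul_oneAddInv (h : IsAnalyticGenerator A T D M) {t s : ℝ} (ht : 0 < t)
    (hs : 0 < s) : oneAddInv A t * (T s + (t : ℂ) • D s) = T s := by
  ext x
  obtain ⟨h3, h4⟩ := h.mem_domain s hs x
  have h5 := h.oneAddInv_apply_add ht ⟨_, h3⟩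
  simpa [h4] using h5

theorem comm_oneAddInv_deriv (h : IsAnalyticGenerator A T D M) {t s : ℝ} (ht : 0 < t)
    (hs : 0 < s) : D s * oneAddInv A t = oneAddInv A t * D s := by
  have h1 := (h.hasDerivAt s hs).mul_const (oneAddInv A t)
  have h2 := (h.hasDerivAt s hs).const_mul (oneAddInv A t)
  have h3 := (h1.congr_of_eventuallyEq (f₁ := fun y => oneAddInv A t * T y) (by
    filter_upwards [Ioi_mem_nhds hs] with s hs using (h.comm_oneAddInv ht hs).symm)).unique h2
  simpa using h3

theorem deriv_add (h : IsAnalyticGenerator A T D M) {s t : ℝ} (hs : 0 < s) (ht : 0 < t) :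
    D (s + t) = T s * D t := by
  ext x
  obtain ⟨h1, h2⟩ := h.mem_domain t ht x
  obtain ⟨h3, h4⟩ := h.mem_domain s hs (T t x)
  obtain ⟨h5, h6⟩ := h.mem_domain (s + t) (by positivity) x
  rw [mul_apply_eq_comp, ← h6, ← h2, h.apply_map s hs ⟨_, h1⟩, ← h4]
  congr 2
  rw [h.add s t hs ht]
  rfl

theorem deriv_add' (h : IsAnalyticGenerator A T D M) {s t : ℝ} (hs : 0 < s) (ht : 0 < t) :
    D (s + t) = D s * T t := by
  ext x
  obtain ⟨h1, h2⟩ := h.mem_domain t ht x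
  have h3 := h.apply_map s hs ⟨_, h1⟩
  rw [h.deriv_add hs ht, mul_apply_eq_comp, mul_apply_eq_comp, ← h2, h3]

/-- Near `t` one has D(s) = T(s - t/2) D(t/2), so only the derivative of T is used. The square
D(t/2)² stands for A² T(t) throughout. -/
theorem hasDerivAt_deriv (h : IsAnalyticGenerator A T D M) {t : ℝ} (ht : 0 < t) :
    HasDerivAt D (-(D (t / 2) * D (t / 2))) t := by
  have h2 : 0 < t / 2 := by positivity
  have h1 := ((h.hasDerivAt (t / 2) h2).scomp_of_eq t
    ((hasDerivAt_id t).sub_const (t / 2)) (by simp only [id]; ring)).mul_const (D (t / 2))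
  refine (h1.congr_of_eventuallyEq ?_).congr_deriv (by simp)
  filter_upwards [Ioi_mem_nhds (half_lt_self ht)] with s hs
  have := h.deriv_add (sub_pos.2 hs) h2
  simpa using this

theorem continuousOn (h : IsAnalyticGenerator A T D M) : ContinuousOn T (Ioi 0) :=
  fun t ht => (h.hasDerivAt t ht).continuousAt.continuousWithinAt

theorem continuousOn_deriv (h : IsAnalyticGenerator A T D M) : ContinuousOn D (Ioi 0) :=
  fun _ ht => (h.hasDerivAt_deriv ht).continuousAt.continuousWithinAt

/-- This is tA(1 + tA)⁻¹ = 1 - (1 + tA)⁻¹ with T(s) in front, which keeps every factor bounded. -/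
theorem deriv_mul_oneAddInv (h : IsAnalyticGenerator A T D M) {t s : ℝ} (ht : 0 < t)
    (hs : 0 < s) : (t : ℂ) • (D s * oneAddInv A t) = T s * (1 - oneAddInv A t) := by
  have h1 := h.add_deriv_mul_oneAddInv ht hs
  rw [mul_add, mul_smul_comm, ← h.comm_oneAddInv_deriv ht hs, ← h.comm_oneAddInv ht hs] at h1
  rw [mul_sub, mul_one, eq_sub_iff_add_eq', h1]

theorem tendsto_oneAddInv (h : IsAnalyticGenerator A T D M) {t : ℝ} (ht : 0 < t) (x : X) :
    Tendsto (fun s => T s (oneAddInv A t x)) (𝓝[>] 0) (𝓝 (oneAddInv A t x)) :=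
  h.tendsto _ (h.oneAddInv_mem ht x).1

/-- `T t x = (1 + A)⁻¹ (T t x + A T t x)`. -/
theorem apply_eq (h : IsAnalyticGenerator A T D M) {t : ℝ} (ht : 0 < t) (x : X) :
    T t x = oneAddInv A 1 (T t x + D t x) :=
  h.mem_domain_iff.1 (h.mem_domain t ht x)

end IsAnalyticGenerator

end Algebra

/-! ### Mild solutions: continuity, integrated equation, uniqueness -/

section Mild

variable {X : Type*} [NormedAddCommGroup X] [NormedSpace ℂ X]

/-- The mild solution `t ↦ ∫₀ᵗ T(t - s) f(s) ds`. -/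
def mildSolution (T : ℝ → X →L[ℂ] X) (f : ℝ → X) (t : ℝ) : X :=
  ∫ s in (0 : ℝ)..t, T (t - s) (f s)

theorem aestronglyMeasurable_convolution_kernel {S : ℝ → X →L[ℂ] X} (hS : ContinuousOn S (Ioi 0))
    {μ ν : Measure ℝ} [SFinite μ] [SFinite ν] {f : ℝ → X} (hf : AEStronglyMeasurable f ν) :
    AEStronglyMeasurable
      ({p : ℝ × ℝ | p.2 < p.1}.indicator fun p : ℝ × ℝ => S (p.1 - p.2) (f p.2)) (μ.prod ν) := by
  have ho : IsOpen {p : ℝ × ℝ | p.2 < p.1} := isOpen_lt continuous_snd continuous_fst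
  rw [aestronglyMeasurable_indicator_iff ho.measurableSet]
  refine AEStronglyMeasurable.clm_apply_complex ?_ (hf.comp_snd.mono_measure Measure.restrict_le_self)
  refine ContinuousOn.aestronglyMeasurable ?_ ho.measurableSet
  exact hS.comp (by fun_prop) fun p hp => mem_Ioi.2 (sub_pos.2 hp)

namespace IsAnalyticGenerator

variable {A : X →ₗ.[ℂ] X} {T D : ℝ → X →L[ℂ] X} {M : ℝ}

theorem deriv_oneAddInv_apply (h : IsAnalyticGenerator A T D M) {t : ℝ} (ht : 0 < t) (x : X) :
    D t (oneAddInv A 1 x) = T t (x - oneAddInv A 1 x) := by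
  have := DFunLike.congr_fun (h.deriv_mul_oneAddInv one_pos ht) x
  simpa using this

theorem intervalIntegrable_mild (h : IsAnalyticGenerator A T D M) {f : ℝ → X} {t : ℝ} (ht : 0 ≤ t)
    (hf : IntervalIntegrable f volume 0 t) :
    IntervalIntegrable (fun s => T (t - s) (f s)) volume 0 t := by
  rw [intervalIntegrable_iff_integrableOn_Ioo_of_le ht] at hf ⊢
  refine (hf.norm.const_mul M).mono' (AEStronglyMeasurable.clm_apply_complex ?_ hf.1) ?_
  · refine ContinuousOn.aestronglyMeasurable ?_ measurableSet_Ioo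
    exact h.continuousOn.comp (by fun_prop) fun s hs => sub_pos.2 hs.2
  · filter_upwards [ae_restrict_mem measurableSet_Ioo] with s hs
    exact (T (t - s)).le_of_opNorm_le (h.norm_le _ (sub_pos.2 hs.2)) _

/-- A domain of integration independent of `t` makes dominated convergence and Fubini applicable. -/
theorem mildSolution_eq_integral_indicator {f : ℝ → X} {t : ℝ} (ht : 0 ≤ t) {b : ℝ} (hb : t ≤ b) :
    mildSolution T f t = ∫ s in Ioc 0 b, (Iio t).indicator (fun s => T (t - s) (f s)) s := by
  rw [mildSolution, intervalIntegral.integral_of_le ht, integral_Ioc_eq_integral_Ioo,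
    setIntegral_indicator measurableSet_Iio]
  congr 2
  ext s
  simp only [mem_Ioo, mem_inter_iff, mem_Ioc, mem_Iio]
  constructor
  · rintro ⟨h1, h2⟩
    exact ⟨⟨h1, by linarith⟩, h2⟩
  · rintro ⟨⟨h1, -⟩, h2⟩
    exact ⟨h1, h2⟩

theorem continuousOn_mildSolution (h : IsAnalyticGenerator A T D M) {f : ℝ → X}
    (hf : ∀ t, 0 ≤ t → IntervalIntegrable f volume 0 t) :
    ContinuousOn (mildSolution T f) (Ici 0) := by
  intro t₀ ht₀
  rw [mem_Ici] at ht₀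
  have hf1 : IntegrableOn f (Ioc 0 (t₀ + 1)) := by
    rw [← intervalIntegrable_iff_integrableOn_Ioc_of_le (by linarith)]
    exact hf _ (by linarith)
  have key : Tendsto (fun t => ∫ s in Ioc 0 (t₀ + 1), (Iio t).indicator (fun s => T (t - s) (f s)) s)
      (𝓝[Ici 0] t₀)
      (𝓝 (∫ s in Ioc 0 (t₀ + 1), (Iio t₀).indicator (fun s => T (t₀ - s) (f s)) s)) := by
    refine tendsto_integral_filter_of_dominated_convergence (fun s => M * ‖f s‖) ?_ ?_
      (hf1.norm.const_mul M) ?_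
    · refine Eventually.of_forall fun t => ?_
      rw [aestronglyMeasurable_indicator_iff measurableSet_Iio]
      refine AEStronglyMeasurable.clm_apply_complex ?_
        (hf1.1.mono_measure Measure.restrict_le_self)
      rw [Measure.restrict_restrict measurableSet_Iio]
      refine ContinuousOn.aestronglyMeasurable ?_ (measurableSet_Iio.inter measurableSet_Ioc)
      exact h.continuousOn.comp (by fun_prop) fun s hs => mem_Ioi.2 (sub_pos.2 hs.1)
    · refine Eventually.of_forall fun t => Eventually.of_forall fun s => ?_
      by_cases hs : s < t
      · rw [indicator_of_mem (mem_Iio.2 hs)]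
        exact (T (t - s)).le_of_opNorm_le (h.norm_le _ (sub_pos.2 hs)) _
      · rw [indicator_of_notMem (by simpa using hs), norm_zero]
        have := h.pos
        positivity
    -- T may be discontinuous at 0, so pointwise convergence of the integrand can fail at s = t₀, a
    -- null set.
    · have hne : ∀ᵐ s ∂volume.restrict (Ioc 0 (t₀ + 1)), s ≠ t₀ :=
        ae_restrict_of_ae (Measure.ae_ne volume t₀)
      filter_upwards [hne] with s hs
      refine Tendsto.mono_left ?_ nhdsWithin_le_nhds
      rcases lt_or_gt_of_ne hs with hs | hs
      · rw [indicator_of_mem (mem_Iio.2 hs)]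
        have h1 : ContinuousAt (fun t => T (t - s) (f s)) t₀ := by
          have h2 : ContinuousAt (fun t => T (t - s)) t₀ :=
            ContinuousAt.comp (f := fun t => t - s) (h.hasDerivAt _ (sub_pos.2 hs)).continuousAt
              (by fun_prop)
          exact ((ContinuousLinearMap.apply ℂ X) (f s)).continuous.continuousAt.comp h2
        refine h1.tendsto.congr' ?_
        filter_upwards [Ioi_mem_nhds hs] with t ht
        rw [indicator_of_mem (mem_Iio.2 ht)]
      · rw [indicator_of_notMem (by simpa using hs.le)]
        refine tendsto_const_nhds.congr' ?_
        filter_upwards [Iio_mem_nhds hs] with t ht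
        rw [indicator_of_notMem (by simpa using (mem_Iio.1 ht).le)]
  rw [ContinuousWithinAt, mildSolution_eq_integral_indicator ht₀ (b := t₀ + 1) (by linarith)]
  refine key.congr' ?_
  filter_upwards [self_mem_nhdsWithin, mem_nhdsWithin_of_mem_nhds (Iio_mem_nhds (lt_add_one t₀))]
    with t ht1 ht2
  exact (mildSolution_eq_integral_indicator ht1 (le_of_lt ht2)).symm

theorem integral_apply_one_sub [CompleteSpace X] (h : IsAnalyticGenerator A T D M) {t : ℝ} (ht : 0 < t) (x : X) :
    ∫ r in (0 : ℝ)..t, T r (x - oneAddInv A 1 x) = oneAddInv A 1 x - T t (oneAddInv A 1 x) := by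
  have h1 : ∀ r, 0 < r → HasDerivAt (fun r => T r (oneAddInv A 1 x))
      (-(T r (x - oneAddInv A 1 x))) r := by
    intro r hr
    refine ((h.hasDerivAt r hr).clm_apply_const (oneAddInv A 1 x)).congr_deriv ?_
    rw [neg_apply, h.deriv_oneAddInv_apply hr]
  have h2 := intervalIntegral.integral_eq_sub_of_hasDerivAt_of_tendsto ht
    (fun r hr => h1 r hr.1) ?_ (h.tendsto_oneAddInv one_pos x)
    (((h1 t ht).continuousAt.tendsto).mono_left nhdsWithin_le_nhds)
  · rw [intervalIntegral.integral_neg, neg_eq_iff_eq_neg, neg_sub] at h2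
    exact h2
  · have := (h.intervalIntegrable_mild ht.le (f := fun _ => x - oneAddInv A 1 x)
      intervalIntegrable_const).comp_sub_left t
    simp only [sub_zero, sub_self, sub_sub_cancel] at this
    exact this.symm.neg

/-- The integrated equation u(t) = ∫₀ᵗ (f - A u) after application of J, where A J = 1 - J is
bounded; it holds for every mild solution, whether or not u takes values in D(A). It follows from
Fubini on the triangle s < r < t and the formula for ∫ A T(r) J x dr. -/
theorem oneAddInv_mildSolution (h : IsAnalyticGenerator A T D M) [CompleteSpace X] {f : ℝ → X}
    (hf : ∀ t, 0 ≤ t → IntervalIntegrable f volume 0 t) {t : ℝ} (ht : 0 ≤ t) :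
    oneAddInv A 1 (mildSolution T f t) = ∫ s in (0 : ℝ)..t,
      (oneAddInv A 1 (f s) - (mildSolution T f s - oneAddInv A 1 (mildSolution T f s))) := by
  set J := oneAddInv A 1
  set μ : Measure ℝ := volume.restrict (Ioc 0 t)
  have hfμ : Integrable f μ := by
    rw [← IntegrableOn, ← intervalIntegrable_iff_integrableOn_Ioc_of_le ht]
    exact hf t ht
  have hgμ : Integrable (fun s => f s - J (f s)) μ := hfμ.sub (J.integrable_comp hfμ)
  set K : ℝ × ℝ → X := {p : ℝ × ℝ | p.2 < p.1}.indicator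
    fun p : ℝ × ℝ => T (p.1 - p.2) (f p.2 - J (f p.2))
  have hK : Integrable K (μ.prod μ) := by
    refine (Integrable.comp_snd (hgμ.norm.const_mul M) μ).mono'
      (aestronglyMeasurable_convolution_kernel h.continuousOn hgμ.1) ?_
    refine Eventually.of_forall fun p => ?_
    by_cases hp : p.2 < p.1
    · simp only [K]
      rw [indicator_of_mem (by exact hp)]
      exact (T (p.1 - p.2)).le_of_opNorm_le (h.norm_le _ (sub_pos.2 hp)) _
    · simp only [K]
      rw [indicator_of_notMem (by exact hp), norm_zero]
      have := h.pos
      positivity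
  have hmc := h.continuousOn_mildSolution hf
  have hm : IntegrableOn (mildSolution T f) (Ioc 0 t) :=
    ((hmc.mono Icc_subset_Ici_self).integrableOn_Icc).mono_set Ioc_subset_Icc_self
  have hcomm : ∀ r, 0 < r → ∀ y, T r (J y) = J (T r y) := fun r hr y =>
    DFunLike.congr_fun (h.comm_oneAddInv one_pos hr) y
  have e1 : ∫ r, ∫ s, K (r, s) ∂μ ∂μ =
      ∫ r in Ioc 0 t, (mildSolution T f r - J (mildSolution T f r)) := by
    refine setIntegral_congr_fun measurableSet_Ioc fun r hr => ?_
    have hi := h.intervalIntegrable_mild hr.1.le (hf r hr.1.le)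
    have h1 : ∫ s, K (r, s) ∂μ = ∫ s in Ioc 0 t,
        (Iio r).indicator (fun s => T (r - s) (f s - J (f s))) s := rfl
    rw [h1, ← mildSolution_eq_integral_indicator (f := fun s => f s - J (f s)) hr.1.le hr.2,
      mildSolution, mildSolution, ← ContinuousLinearMap.intervalIntegral_comp_comm _ hi]
    rw [← intervalIntegral.integral_sub hi]
    · rw [intervalIntegral.integral_of_le hr.1.le, intervalIntegral.integral_of_le hr.1.le,
        integral_Ioc_eq_integral_Ioo, integral_Ioc_eq_integral_Ioo]
      refine setIntegral_congr_fun measurableSet_Ioo fun s hs => ?_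
      rw [map_sub, hcomm _ (sub_pos.2 hs.2)]
    · rw [intervalIntegrable_iff_integrableOn_Ioc_of_le hr.1.le] at hi ⊢
      exact J.integrable_comp hi
  have e2 : ∫ s, ∫ r, K (r, s) ∂μ ∂μ = ∫ s in Ioo 0 t, (J (f s) - J (T (t - s) (f s))) := by
    rw [← integral_Ioc_eq_integral_Ioo]
    have hne : ∀ᵐ s ∂μ, s ≠ t := ae_restrict_of_ae (Measure.ae_ne volume t)
    refine integral_congr_ae ?_
    filter_upwards [hne, ae_restrict_mem measurableSet_Ioc] with s hs1 hs2
    have hst : s < t := lt_of_le_of_ne hs2.2 hs1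
    have h1 : ∫ r, K (r, s) ∂μ = ∫ r in Ioc 0 t,
        (Ioi s).indicator (fun r => T (r - s) (f s - J (f s))) r := rfl
    rw [h1, setIntegral_indicator measurableSet_Ioi]
    have h2 : Ioc 0 t ∩ Ioi s = Ioc s t := by
      ext r
      simp only [mem_inter_iff, mem_Ioc, mem_Ioi]
      constructor
      · rintro ⟨⟨-, h1⟩, h2⟩
        exact ⟨h2, h1⟩
      · rintro ⟨h1, h2⟩
        exact ⟨⟨hs2.1.trans h1, h2⟩, h1⟩
    rw [h2, ← intervalIntegral.integral_of_le hst.le,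
      intervalIntegral.integral_comp_sub_right (fun r => T r (f s - J (f s))), sub_self,
      h.integral_apply_one_sub (sub_pos.2 hst), hcomm _ (sub_pos.2 hst)]
  have e3 := integral_integral_swap (f := fun r s => K (r, s)) hK
  rw [e1, e2] at e3
  have hJf : IntegrableOn (fun s => J (f s)) (Ioc 0 t) := J.integrable_comp hfμ
  have hi := h.intervalIntegrable_mild ht (hf t ht)
  rw [intervalIntegrable_iff_integrableOn_Ioc_of_le ht] at hi
  have hJi : IntegrableOn (fun s => J (T (t - s) (f s))) (Ioc 0 t) := J.integrable_comp hi
  rw [intervalIntegral.integral_of_le ht,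
    integral_sub hJf (g := fun s => mildSolution T f s - J (mildSolution T f s))
      (hm.sub (J.integrable_comp hm)), e3, ← integral_Ioc_eq_integral_Ioo,
    integral_sub hJf hJi, sub_sub_cancel, mildSolution, intervalIntegral.integral_of_le ht,
    ← ContinuousLinearMap.integral_comp_comm _ hi]

/-- The function s ↦ T(t - s) J d(s) has derivative zero on (0, t), limit 0 at s = 0 and limit J
d(t) at s = t; J is injective. -/
theorem eqOn_zero_of_oneAddInv_eq (h : IsAnalyticGenerator A T D M) [CompleteSpace X] {d : ℝ → X}
    (hd : ContinuousOn d (Ici 0))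
    (hJ : ∀ t, 0 ≤ t → oneAddInv A 1 (d t) = -∫ s in (0 : ℝ)..t, (d s - oneAddInv A 1 (d s)))
    {t : ℝ} (ht : 0 ≤ t) : d t = 0 := by
  set J := oneAddInv A 1
  refine h.oneAddInv_injective one_pos ?_
  change J (d t) = J 0
  rw [map_zero]
  have hJ0 : J (d 0) = 0 := by simpa using hJ 0 le_rfl
  rcases ht.eq_or_lt with rfl | ht
  · exact hJ0
  have hgc : ContinuousOn (fun s => d s - J (d s)) (Ici 0) := hd.sub (J.continuous.comp_continuousOn hd)
  have hJd : ContinuousOn (fun s => J (d s)) (Ici 0) := J.continuous.comp_continuousOn hd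
  have hder : ∀ s, 0 < s → HasDerivAt (fun s => J (d s)) (-(d s - J (d s))) s := by
    intro s hs
    have h1 : HasDerivAt (fun u => ∫ r in (0 : ℝ)..u, (d r - J (d r))) (d s - J (d s)) s := by
      refine intervalIntegral.integral_hasDerivAt_right ?_ ?_ ?_
      · refine ContinuousOn.intervalIntegrable (hgc.mono ?_)
        rw [uIcc_of_le hs.le]
        exact Icc_subset_Ici_self
      · exact (hgc.mono Ioi_subset_Ici_self).stronglyMeasurableAtFilter isOpen_Ioi s hs
      · exact hgc.continuousAt (Ici_mem_nhds hs)
    refine h1.neg.congr_of_eventuallyEq ?_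
    filter_upwards [Ioi_mem_nhds hs] with r hr using hJ r (le_of_lt hr)
  have hprod : ∀ s ∈ Ioo 0 t, HasDerivAt (fun s => T (t - s) (J (d s))) 0 s := by
    intro s hs
    have hts : 0 < t - s := sub_pos.2 hs.2
    have h1 : HasDerivAt (fun s => T (t - s)) (D (t - s)) s := by
      have := (h.hasDerivAt _ hts).scomp s ((hasDerivAt_id s).const_sub t)
      simpa [Function.comp_def] using this
    refine (h1.clm_apply_complex (hder s hs.1)).congr_deriv ?_
    rw [h.deriv_oneAddInv_apply hts, map_neg, add_neg_cancel]
  have hzero : ∀ {l : Filter ℝ} {u : ℝ → X}, (∀ᶠ s in l, s < t) → Tendsto u l (𝓝 0) →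
      Tendsto (fun s => T (t - s) (u s)) l (𝓝 0) := by
    intro l u hl hu
    refine squeeze_zero_norm' (a := fun s => M * ‖u s‖) ?_ (by simpa using hu.norm.const_mul M)
    filter_upwards [hl] with s hs
    exact (T (t - s)).le_of_opNorm_le (h.norm_le _ (sub_pos.2 hs)) _
  have h0 : Tendsto (fun s => T (t - s) (J (d s))) (𝓝[>] 0) (𝓝 0) := by
    refine hzero (mem_nhdsWithin_of_mem_nhds (Iio_mem_nhds ht)) ?_
    have := (hJd 0 self_mem_Ici).mono_left (nhdsWithin_mono 0 Ioi_subset_Ici_self)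
    simpa only [hJ0] using this
  have h1 : Tendsto (fun s => T (t - s) (J (d s))) (𝓝[<] t) (𝓝 (J (d t))) := by
    have h2 : Tendsto (fun s => J (d s) - J (d t)) (𝓝[<] t) (𝓝 0) := by
      have := ((hder t ht).continuousAt.tendsto.mono_left (nhdsWithin_le_nhds (s := Iio t))).sub_const
        (J (d t))
      rwa [sub_self] at this
    have h3 := hzero (l := 𝓝[<] t) self_mem_nhdsWithin h2
    -- T(r) tends to the identity on the range of J even when T is not a C₀-semigroup.
    have h4 : Tendsto (fun s => T (t - s) (J (d t))) (𝓝[<] t) (𝓝 (J (d t))) := by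
      refine (h.tendsto_oneAddInv one_pos (d t)).comp ?_
      refine tendsto_nhdsWithin_iff.2 ⟨?_, ?_⟩
      · have : Continuous fun s : ℝ => t - s := by fun_prop
        simpa using (this.tendsto t).mono_left (nhdsWithin_le_nhds (s := Iio t))
      · filter_upwards [self_mem_nhdsWithin] with s hs using mem_Ioi.2 (sub_pos.2 hs)
    simpa using h3.add h4
  have := intervalIntegral.integral_eq_sub_of_hasDerivAt_of_tendsto ht hprod
    intervalIntegrable_const h0 h1
  simpa using this.symm

end IsAnalyticGenerator

end Mild

/-! ### Maximal regularity in terms of mild solutions, and the a priori estimate -/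

section MaximalRegularity

variable {X : Type*} [NormedAddCommGroup X] [NormedSpace ℂ X]

theorem MeasureTheory.MemLp.intervalIntegrable_zero {E : Type*}
    [NormedAddCommGroup E] {f : ℝ → E} {p : ℝ≥0∞} (hp : 1 ≤ p)
    (hf : MemLp f p (volume.restrict (Ioi (0 : ℝ)))) {t : ℝ} (ht : 0 ≤ t) :
    IntervalIntegrable f volume 0 t := by
  rw [intervalIntegrable_iff_integrableOn_Ioc_of_le ht]
  exact (hf.mono_measure (Measure.restrict_mono Ioc_subset_Ioi_self le_rfl)).integrable hp

theorem ae_Ioc_of_ae_Ioi {P : ℝ → Prop} (h : ∀ᵐ t ∂volume.restrict (Ioi (0 : ℝ)), P t) (t : ℝ) :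
    ∀ᵐ s ∂volume.restrict (Ioc 0 t), P s :=
  ae_mono (Measure.restrict_mono Ioc_subset_Ioi_self le_rfl) h

theorem intervalIntegral_congr_ae_Ioi {f g : ℝ → X}
    (h : ∀ᵐ t ∂volume.restrict (Ioi (0 : ℝ)), f t = g t) {t : ℝ} (ht : 0 ≤ t) :
    ∫ s in (0 : ℝ)..t, f s = ∫ s in (0 : ℝ)..t, g s := by
  rw [intervalIntegral.integral_of_le ht, intervalIntegral.integral_of_le ht]
  exact integral_congr_ae (ae_Ioc_of_ae_Ioi h t)

theorem mildSolution_congr (T : ℝ → X →L[ℂ] X) {f g : ℝ → X}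
    (h : ∀ᵐ t ∂volume.restrict (Ioi (0 : ℝ)), f t = g t) {t : ℝ} (ht : 0 ≤ t) :
    mildSolution T f t = mildSolution T g t :=
  intervalIntegral_congr_ae_Ioi (h.mono fun s hs => by rw [hs]) ht

theorem HasLocDeriv.continuousOn {u v : ℝ → X} (h : HasLocDeriv u v) :
    ContinuousOn u (Ici 0) := by
  intro t ht
  rw [mem_Ici] at ht
  have h1 := intervalIntegral.continuousOn_primitive_interval' (h (t + 1) (by linarith)).1
    (left_mem_uIcc)
  rw [uIcc_of_le (by linarith)] at h1
  have h2 : ContinuousOn u (Icc 0 (t + 1)) :=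
    (continuousOn_const.add h1).congr fun s hs => (h s hs.1).2
  refine (h2 t ⟨ht, by linarith⟩).mono_of_mem_nhdsWithin ?_
  rw [← Ici_inter_Iic]
  exact inter_mem_nhdsWithin _ (Iic_mem_nhds (by linarith))

namespace IsAnalyticGenerator

variable {A : X →ₗ.[ℂ] X} {T D : ℝ → X →L[ℂ] X} {M : ℝ}

theorem intervalIntegrable_mildSolution (h : IsAnalyticGenerator A T D M) {f : ℝ → X}
    (hf : ∀ t, 0 ≤ t → IntervalIntegrable f volume 0 t) {t : ℝ} (ht : 0 ≤ t) :
    IntervalIntegrable (mildSolution T f) volume 0 t := by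
  refine ContinuousOn.intervalIntegrable ((h.continuousOn_mildSolution hf).mono ?_)
  rw [uIcc_of_le ht]
  exact Icc_subset_Ici_self

theorem _root_.ContinuousLinearMap.intervalIntegrable_comp_complex (L : X →L[ℂ] X) {f : ℝ → X}
    {a b : ℝ} (hf : IntervalIntegrable f volume a b) :
    IntervalIntegrable (fun s => L (f s)) volume a b :=
  ⟨L.integrable_comp hf.1, L.integrable_comp hf.2⟩

/-- Strong solutions are mild solutions. -/
theorem eq_mildSolution_of_isStrongSolution [CompleteSpace X] (h : IsAnalyticGenerator A T D M)
    {f u : ℝ → X} (hf : ∀ t, 0 ≤ t → IntervalIntegrable f volume 0 t)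
    (hu : IsStrongSolution A f 0 u) {t : ℝ} (ht : 0 ≤ t) : u t = mildSolution T f t := by
  obtain ⟨hu0, v, hv, hAu⟩ := hu
  set J := oneAddInv A 1 with hJ
  have hmc := h.continuousOn_mildSolution hf
  have huc := hv.continuousOn
  rw [← sub_eq_zero]
  refine h.eqOn_zero_of_oneAddInv_eq (d := fun t => u t - mildSolution T f t) (huc.sub hmc) ?_ ht
  intro t ht
  have hui : IntervalIntegrable u volume 0 t := by
    refine ContinuousOn.intervalIntegrable (huc.mono ?_)
    rw [uIcc_of_le ht]
    exact Icc_subset_Ici_self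
  have hmi := h.intervalIntegrable_mildSolution hf ht
  have h1 : J (u t) = ∫ s in (0 : ℝ)..t, (J (f s) - (u s - J (u s))) := by
    rw [(hv t ht).2, hu0, zero_add, ← ContinuousLinearMap.intervalIntegral_comp_comm _ (hv t ht).1]
    refine intervalIntegral_congr_ae_Ioi ?_ ht
    filter_upwards [hAu] with s hs
    obtain ⟨hs1, hs2⟩ := hs
    have h2 := h.mem_domain_iff.1 ⟨hs1, rfl⟩
    rw [← hs2, map_add]
    rw [map_add] at h2
    linear_combination (norm := module) h2
  change J (u t - mildSolution T f t) = -∫ s in (0 : ℝ)..t,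
    (u s - mildSolution T f s - J (u s - mildSolution T f s))
  rw [map_sub, h1, h.oneAddInv_mildSolution hf ht, ← intervalIntegral.integral_sub,
    ← intervalIntegral.integral_neg]
  · congr 1
    ext s
    rw [map_sub]
    abel
  · exact (J.intervalIntegrable_comp_complex (hf t ht)).sub
      (hui.sub (J.intervalIntegrable_comp_complex hui))
  · exact (J.intervalIntegrable_comp_complex (hf t ht)).sub
      (hmi.sub (J.intervalIntegrable_comp_complex hmi))

/-- Once A u = w almost everywhere with w locally integrable, the integrated equation has the form
J(u) = J(∫ (f - w)), and injectivity removes J. -/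
theorem hasLocDeriv_mildSolution [CompleteSpace X] (h : IsAnalyticGenerator A T D M)
    {f w : ℝ → X} (hf : ∀ t, 0 ≤ t → IntervalIntegrable f volume 0 t)
    (hw : ∀ t, 0 ≤ t → IntervalIntegrable w volume 0 t)
    (hfw : ∀ᵐ t ∂volume.restrict (Ioi (0 : ℝ)),
      mildSolution T f t = oneAddInv A 1 (mildSolution T f t + w t)) :
    HasLocDeriv (mildSolution T f) (fun t => f t - w t) := by
  intro t ht
  refine ⟨(hf t ht).sub (hw t ht), h.oneAddInv_injective one_pos ?_⟩
  have h0 : mildSolution T f 0 = 0 := by simp [mildSolution]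
  rw [h.oneAddInv_mildSolution hf ht, h0, zero_add,
    ← ContinuousLinearMap.intervalIntegral_comp_comm _ ((hf t ht).sub (hw t ht))]
  refine intervalIntegral_congr_ae_Ioi ?_ ht
  filter_upwards [hfw] with s hs
  rw [map_add] at hs
  rw [map_sub]
  nth_rw 1 [hs]
  abel

/-- Uniqueness and the form of the solution are automatic, and u' = f - A u, so the only substantial
demand is that A u be in L^p for the mild solution u. -/
theorem hasMaximalRegularity_iff [CompleteSpace X] (h : IsAnalyticGenerator A T D M)
    {p : ℝ≥0∞} (hp : 1 ≤ p) : HasMaximalRegularity A p ↔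
      ∀ f : ℝ → X, MemLp f p (volume.restrict (Ioi (0 : ℝ))) →
        ∃ w : ℝ → X, MemLp w p (volume.restrict (Ioi (0 : ℝ))) ∧
          ∀ᵐ t ∂volume.restrict (Ioi (0 : ℝ)),
            mildSolution T f t = oneAddInv A 1 (mildSolution T f t + w t) := by
  constructor
  · intro hMR f hf
    have hfi := fun t (ht : 0 ≤ t) => hf.intervalIntegrable_zero hp ht
    obtain ⟨u, ⟨hu, -, w, hw, huw⟩, -⟩ := hMR f hf
    refine ⟨w, hw, ?_⟩
    filter_upwards [huw, ae_restrict_mem measurableSet_Ioi] with t ht ht0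
    rw [← h.eq_mildSolution_of_isStrongSolution hfi hu (le_of_lt ht0)]
    exact h.mem_domain_iff.1 ht
  · intro hw f hf
    have hfi := fun t (ht : 0 ≤ t) => hf.intervalIntegrable_zero hp ht
    obtain ⟨w, hw, hfw⟩ := hw f hf
    have hwi := fun t (ht : 0 ≤ t) => hw.intervalIntegrable_zero hp ht
    have hd := h.hasLocDeriv_mildSolution hfi hwi hfw
    refine ⟨mildSolution T f, ⟨⟨by simp [mildSolution], _, hd, ?_⟩, ⟨_, hd, hf.sub hw⟩, w, hw, ?_⟩,
      fun u hu _ t ht => h.eq_mildSolution_of_isStrongSolution hfi hu ht⟩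
    · filter_upwards [hfw] with t ht
      obtain ⟨h1, h2⟩ := h.mem_domain_iff.2 ht
      exact ⟨h1, by rw [h2, sub_add_cancel]⟩
    · filter_upwards [hfw] with t ht using h.mem_domain_iff.2 ht

/-- Hölder's inequality on (0, t). It makes L^p convergence of the data imply pointwise convergence
of the mild solutions, as the closed graph argument requires. -/
theorem exists_enorm_mildSolution_le (h : IsAnalyticGenerator A T D M) {p : ℝ≥0∞} (hp : 1 ≤ p)
    {t : ℝ} (ht : 0 ≤ t) : ∃ c : ℝ≥0∞, c ≠ ∞ ∧ ∀ f : ℝ → X,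
      AEStronglyMeasurable f (volume.restrict (Ioi (0 : ℝ))) →
      ‖mildSolution T f t‖ₑ ≤ c * eLpNorm f p (volume.restrict (Ioi (0 : ℝ))) := by
  set ν := volume.restrict (Ioc 0 t)
  refine ⟨ENNReal.ofReal M * ν univ ^ (1 / (1 : ℝ≥0∞).toReal - 1 / p.toReal), ?_, fun f hf => ?_⟩
  · refine ENNReal.mul_ne_top ENNReal.ofReal_ne_top (ENNReal.rpow_ne_top_of_nonneg ?_ ?_)
    · rw [ENNReal.toReal_one, div_one, sub_nonneg]
      rcases eq_or_ne p ∞ with rfl | hp'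
      · simp
      · have : 1 ≤ p.toReal := by
          rw [← ENNReal.toReal_one]
          exact ENNReal.toReal_mono hp' hp
        exact div_le_one_of_le₀ this (by positivity)
    · exact measure_ne_top _ _
  · have hle : ν ≤ volume.restrict (Ioi (0 : ℝ)) := Measure.restrict_mono Ioc_subset_Ioi_self le_rfl
    calc ‖mildSolution T f t‖ₑ ≤ ∫⁻ s in Ioo 0 t, ‖T (t - s) (f s)‖ₑ := by
          rw [mildSolution, intervalIntegral.integral_of_le ht, integral_Ioc_eq_integral_Ioo]
          exact enorm_integral_le_lintegral_enorm _
      _ ≤ ∫⁻ s in Ioo 0 t, ENNReal.ofReal M * ‖f s‖ₑ := by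
          refine setLIntegral_mono' measurableSet_Ioo fun s hs => ?_
          rw [← ofReal_norm, ← ofReal_norm, ← ENNReal.ofReal_mul h.pos.le]
          exact ENNReal.ofReal_le_ofReal
            ((T (t - s)).le_of_opNorm_le (h.norm_le _ (sub_pos.2 hs.2)) _)
      _ ≤ ENNReal.ofReal M * ∫⁻ s in Ioc 0 t, ‖f s‖ₑ := by
          rw [lintegral_const_mul' _ _ ENNReal.ofReal_ne_top]
          gcongr
          exact Ioo_subset_Ioc_self
      _ = ENNReal.ofReal M * eLpNorm f 1 ν := by rw [eLpNorm_one_eq_lintegral_enorm]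
      _ ≤ ENNReal.ofReal M * (eLpNorm f p ν * ν univ ^ (1 / (1 : ℝ≥0∞).toReal - 1 / p.toReal)) := by
          gcongr
          exact eLpNorm_le_eLpNorm_mul_rpow_measure_univ hp (hf.mono_measure hle)
      _ ≤ ENNReal.ofReal M * (eLpNorm f p (volume.restrict (Ioi (0 : ℝ))) *
            ν univ ^ (1 / (1 : ℝ≥0∞).toReal - 1 / p.toReal)) := by
          gcongr
      _ = _ := by ring

theorem mildSolution_add (h : IsAnalyticGenerator A T D M) {f g : ℝ → X} {t : ℝ} (ht : 0 ≤ t)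
    (hf : IntervalIntegrable f volume 0 t) (hg : IntervalIntegrable g volume 0 t) :
    mildSolution T (fun s => f s + g s) t = mildSolution T f t + mildSolution T g t := by
  simp only [mildSolution, map_add]
  exact intervalIntegral.integral_add (h.intervalIntegrable_mild ht hf)
    (h.intervalIntegrable_mild ht hg)

theorem mildSolution_sub (h : IsAnalyticGenerator A T D M) {f g : ℝ → X} {t : ℝ} (ht : 0 ≤ t)
    (hf : IntervalIntegrable f volume 0 t) (hg : IntervalIntegrable g volume 0 t) :
    mildSolution T (f - g) t = mildSolution T f t - mildSolution T g t := by
  simp only [mildSolution, Pi.sub_apply, map_sub]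
  exact intervalIntegral.integral_sub (h.intervalIntegrable_mild ht hf)
    (h.intervalIntegrable_mild ht hg)

theorem mildSolution_smul (T : ℝ → X →L[ℂ] X) (c : ℂ) (f : ℝ → X) (t : ℝ) :
    mildSolution T (fun s => c • f s) t = c • mildSolution T f t := by
  simp only [mildSolution, map_smul]
  exact intervalIntegral.integral_smul _ _

/-- Maximal regularity comes with an a priori estimate. -/
theorem exists_eLpNorm_le_of_hasMaximalRegularity [CompleteSpace X]
    (h : IsAnalyticGenerator A T D M) {p : ℝ≥0∞} [hp : Fact (1 ≤ p)]
    (hMR : HasMaximalRegularity A p) : ∃ K : ℝ≥0, ∀ f w : ℝ → X,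
      MemLp f p (volume.restrict (Ioi (0 : ℝ))) → MemLp w p (volume.restrict (Ioi (0 : ℝ))) →
      (∀ᵐ t ∂volume.restrict (Ioi (0 : ℝ)),
        mildSolution T f t = oneAddInv A 1 (mildSolution T f t + w t)) →
      eLpNorm w p (volume.restrict (Ioi (0 : ℝ))) ≤
        K * eLpNorm f p (volume.restrict (Ioi (0 : ℝ))) := by
  set μ := volume.restrict (Ioi (0 : ℝ))
  set J := oneAddInv A 1
  rw [h.hasMaximalRegularity_iff hp.out] at hMR
  have hex : ∀ F : Lp X p μ, ∃ W : Lp X p μ, ∀ᵐ t ∂μ,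
      mildSolution T F t = J (mildSolution T F t + W t) := by
    intro F
    obtain ⟨w, hw, hw'⟩ := hMR F (Lp.memLp F)
    refine ⟨hw.toLp w, ?_⟩
    filter_upwards [hw', hw.coeFn_toLp] with t h1 h2
    rw [h2]
    exact h1
  have hpos : ∀ᵐ t ∂μ, 0 ≤ t := (ae_restrict_mem measurableSet_Ioi).mono fun t ht => le_of_lt ht
  have huniq : ∀ (F W W' : Lp X p μ),
      (∀ᵐ t ∂μ, mildSolution T F t = J (mildSolution T F t + W t)) →
      (∀ᵐ t ∂μ, mildSolution T F t = J (mildSolution T F t + W' t)) → W = W' := by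
    intro F W W' h1 h2
    refine Lp.ext ?_
    filter_upwards [h1, h2] with t h1 h2
    exact add_left_cancel (h.oneAddInv_injective one_pos (h1.symm.trans h2))
  have hint : ∀ (F : Lp X p μ) t, 0 ≤ t → IntervalIntegrable F volume 0 t := fun F t ht =>
    (Lp.memLp F).intervalIntegrable_zero hp.out ht
  choose W hW using hex
  let L : Lp X p μ →ₗ[ℂ] Lp X p μ :=
    { toFun := W
      map_add' := fun F G => by
        refine huniq _ _ _ (hW (F + G)) ?_
        filter_upwards [hW F, hW G, Lp.coeFn_add (W F) (W G), hpos] with t h1 h2 h3 ht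
        rw [mildSolution_congr T (Lp.coeFn_add F G) ht]
        have := h.mildSolution_add ht (hint F t ht) (hint G t ht)
        change mildSolution T (fun s => F s + G s) t = J (mildSolution T (fun s => F s + G s) t + _)
        rw [this, h3, Pi.add_apply, add_add_add_comm, map_add, ← h1, ← h2]
      map_smul' := fun c F => by
        refine huniq _ _ _ (hW (c • F)) ?_
        filter_upwards [hW F, Lp.coeFn_smul c (W F), hpos] with t h1 h3 ht
        rw [mildSolution_congr T (Lp.coeFn_smul c F) ht]
        change mildSolution T (fun s => c • F s) t = J (mildSolution T (fun s => c • F s) t + _)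
        rw [mildSolution_smul, RingHom.id_apply, h3, Pi.smul_apply, ← smul_add, map_smul, ← h1] }
  have hLc : Continuous L := by
    -- Along a subsequence A u_n converges almost everywhere, while the mild solutions converge at
    -- every t ≥ 0; the identity u = J(u + w) passes to the limit because J is bounded.
    refine L.continuous_of_seq_closed_graph fun u F Y hu hY => ?_
    refine huniq F _ _ ?_ (hW F)
    obtain ⟨ns, hns, hae⟩ := (tendstoInMeasure_of_tendsto_Lp hY).exists_seq_tendsto_ae
    have hall : ∀ᵐ t ∂μ, ∀ i, mildSolution T (u (ns i)) t =
        J (mildSolution T (u (ns i)) t + W (u (ns i)) t) := ae_all_iff.2 fun i => hW _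
    filter_upwards [hae, hall, hpos] with t h1 h2 ht
    have h3 : Tendsto (fun i => mildSolution T (u (ns i)) t) atTop (𝓝 (mildSolution T F t)) := by
      obtain ⟨c, hc, hcle⟩ := h.exists_enorm_mildSolution_le hp.out ht
      have h4 := (Lp.tendsto_Lp_iff_tendsto_eLpNorm' _ _).1 (hu.comp hns.tendsto_atTop)
      rw [tendsto_iff_edist_tendsto_0]
      have h5 := ENNReal.Tendsto.const_mul h4 (Or.inr hc)
      rw [mul_zero] at h5
      refine tendsto_of_tendsto_of_tendsto_of_le_of_le tendsto_const_nhds h5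
        (fun _ => zero_le) fun i => ?_
      refine le_trans (le_of_eq ?_) (hcle _ ((Lp.aestronglyMeasurable _).sub
        (Lp.aestronglyMeasurable _)))
      rw [edist_eq_enorm_sub, ← h.mildSolution_sub ht (hint (u (ns i)) t ht) (hint F t ht)]
      rfl
    refine tendsto_nhds_unique h3 ?_
    have h4 := (J.continuous.tendsto _).comp (h3.add h1)
    exact h4.congr fun i => (h2 i).symm
  let Lc : Lp X p μ →L[ℂ] Lp X p μ := ⟨L, hLc⟩
  refine ⟨‖Lc‖₊, fun f w hf hw hfw => ?_⟩
  have h1 : W (hf.toLp f) = hw.toLp w := by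
    refine huniq _ _ _ (hW _) ?_
    filter_upwards [hfw, hw.coeFn_toLp, hpos] with t h1 h2 ht
    rw [mildSolution_congr T hf.coeFn_toLp ht, h2]
    exact h1
  have h2 := Lc.le_opNorm (hf.toLp f)
  change ‖W (hf.toLp f)‖ ≤ _ at h2
  rw [h1, Lp.norm_toLp, Lp.norm_toLp] at h2
  have h3 := ENNReal.ofReal_le_ofReal h2
  rw [ENNReal.ofReal_mul (norm_nonneg _), ENNReal.ofReal_toReal hw.2.ne,
    ENNReal.ofReal_toReal hf.2.ne, ofReal_norm] at h3
  exact h3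

end IsAnalyticGenerator

end MaximalRegularity

/-! ### L¹-maximal regularity and integrability of A T(t) x -/

section MaximalRegularityOne

variable {X : Type*} [NormedAddCommGroup X] [NormedSpace ℂ X]

theorem MeasureTheory.setLIntegral_Ioi_comp_add_right (f : ℝ → ℝ≥0∞) (t : ℝ) :
    ∫⁻ s in Ioi 0, f (s + t) = ∫⁻ s in Ioi t, f s := by
  have := (measurePreserving_add_right volume t).setLIntegral_comp_preimage_emb
    (MeasurableEquiv.addRight t).measurableEmbedding f (Ioi t)
  simpa using this

theorem MeasureTheory.setLIntegral_Ioi_comp_sub_right (f : ℝ → ℝ≥0∞) (t : ℝ) :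
    ∫⁻ s in Ioi t, f (s - t) = ∫⁻ s in Ioi 0, f s := by
  rw [← setLIntegral_Ioi_comp_add_right]
  simp

namespace IsAnalyticGenerator

variable {A : X →ₗ.[ℂ] X} {T D : ℝ → X →L[ℂ] X} {M : ℝ}

theorem intervalIntegrable_apply_of_pos {S : ℝ → X →L[ℂ] X} (hS : ContinuousOn S (Ioi 0))
    {a b : ℝ} (ha : 0 < a) (hab : a ≤ b) (x : X) :
    IntervalIntegrable (fun s => S s x) volume a b := by
  refine ContinuousOn.intervalIntegrable ?_
  rw [uIcc_of_le hab]
  exact ((ContinuousLinearMap.apply ℂ X) x).continuous.comp_continuousOn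
    (hS.mono fun s hs => ha.trans_le hs.1)

theorem integral_eq_oneAddInv [CompleteSpace X] (h : IsAnalyticGenerator A T D M) {a b : ℝ}
    (ha : 0 < a) (hab : a ≤ b) (x : X) : ∫ s in a..b, T s x =
      oneAddInv A 1 ((∫ s in a..b, T s x) + (T a x - T b x)) := by
  have hT := intervalIntegrable_apply_of_pos h.continuousOn ha hab x
  have hD := intervalIntegrable_apply_of_pos h.continuousOn_deriv ha hab x
  have h1 : ∫ s in a..b, D s x = T a x - T b x := by
    have := intervalIntegral.integral_eq_sub_of_hasDerivAt (a := a) (b := b)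
      (f := fun s => T s x) (f' := fun s => -(D s x)) (fun s hs => ?_) hD.neg
    · rw [intervalIntegral.integral_neg, neg_eq_iff_eq_neg, neg_sub] at this
      exact this
    · rw [uIcc_of_le hab] at hs
      simpa using (h.hasDerivAt s (ha.trans_le hs.1)).clm_apply_const x
  rw [← h1, ← intervalIntegral.integral_add hT hD,
    ← ContinuousLinearMap.intervalIntegral_comp_comm _ (hT.add hD)]
  refine intervalIntegral.integral_congr fun s hs => ?_
  rw [uIcc_of_le hab] at hs
  exact h.apply_eq (ha.trans_le hs.1) x

theorem mildSolution_indicator {f : ℝ → X} {x : X} {r t : ℝ} (hr : 0 ≤ r) (ht : r ≤ t)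
    (hf : f = (Ioc 0 r).indicator fun _ => x) :
    mildSolution T f t = ∫ s in (t - r)..t, T s x := by
  have h1 : mildSolution T f t = ∫ s in Ioc 0 t, (Ioc 0 r).indicator (fun s => T (t - s) x) s := by
    rw [mildSolution, intervalIntegral.integral_of_le (hr.trans ht)]
    congr 1
    ext s
    by_cases hs : s ∈ Ioc 0 r <;> simp [hf, hs]
  rw [h1, setIntegral_indicator measurableSet_Ioc,
    inter_eq_right.2 (Ioc_subset_Ioc_right ht), ← intervalIntegral.integral_of_le hr,
    intervalIntegral.integral_comp_sub_left (fun s => T s x), sub_zero]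

/-- The a priori estimate for f = 1_(0,r] x, of norm r ‖x‖, bounds the difference quotients of T(·)
x in L¹ uniformly in r; Fatou's lemma passes to the derivative. -/
theorem lintegral_le_of_hasMaximalRegularity_one [CompleteSpace X]
    (h : IsAnalyticGenerator A T D M) (hMR : HasMaximalRegularity A 1) :
    ∃ C : ℝ≥0, ∀ x : X, ∫⁻ t in Ioi (0 : ℝ), ‖D t x‖ₑ ≤ C * ‖x‖ₑ := by
  obtain ⟨K, hK⟩ := h.exists_eLpNorm_le_of_hasMaximalRegularity (p := 1) hMR
  rw [h.hasMaximalRegularity_iff le_rfl] at hMR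
  refine ⟨K, fun x => ?_⟩
  have key : ∀ r : ℝ, 0 < r →
      ∫⁻ t in Ioi (0 : ℝ), ‖T t x - T (t + r) x‖ₑ ≤ K * (ENNReal.ofReal r * ‖x‖ₑ) := by
    intro r hr
    set f : ℝ → X := (Ioc 0 r).indicator fun _ => x with hf
    have hfm : MemLp f 1 (volume.restrict (Ioi (0 : ℝ))) := by
      rw [memLp_one_iff_integrable, hf, integrable_indicator_iff measurableSet_Ioc]
      refine integrableOn_const ?_
      rw [Measure.restrict_apply measurableSet_Ioc]
      exact ((measure_mono inter_subset_left).trans_lt measure_Ioc_lt_top).ne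
    have hfn : eLpNorm f 1 (volume.restrict (Ioi (0 : ℝ))) = ENNReal.ofReal r * ‖x‖ₑ := by
      rw [eLpNorm_one_eq_lintegral_enorm]
      simp only [hf, enorm_indicator_eq_indicator_enorm]
      rw [lintegral_indicator measurableSet_Ioc, lintegral_const, Measure.restrict_restrict
        measurableSet_Ioc, inter_eq_left.2 Ioc_subset_Ioi_self]
      simp [mul_comm]
    obtain ⟨w, hw, hfw⟩ := hMR f hfm
    have h1 := hK f w hfm hw hfw
    rw [hfn, eLpNorm_one_eq_lintegral_enorm] at h1
    refine le_trans ?_ h1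
    have h2 := setLIntegral_Ioi_comp_add_right (fun s => ‖T (s - r) x - T s x‖ₑ) r
    simp only [add_sub_cancel_right] at h2
    rw [h2]
    refine le_trans ?_ (lintegral_mono_set (Ioi_subset_Ioi hr.le))
    refine lintegral_mono_ae ?_
    have h3 : ∀ᵐ t ∂volume.restrict (Ioi r),
        mildSolution T f t = oneAddInv A 1 (mildSolution T f t + w t) :=
      ae_mono (Measure.restrict_mono (Ioi_subset_Ioi hr.le) le_rfl) hfw
    filter_upwards [h3, ae_restrict_mem measurableSet_Ioi] with t ht1 ht2
    rw [mem_Ioi] at ht2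
    rw [mildSolution_indicator hr.le ht2.le hf] at ht1
    have h4 := h.integral_eq_oneAddInv (sub_pos.2 ht2) (by linarith : t - r ≤ t) x
    rw [add_left_cancel (h.oneAddInv_injective one_pos (h4.symm.trans ht1))]
  set r : ℕ → ℝ := fun n => 1 / ((n : ℝ) + 1)
  have hr : ∀ n, 0 < r n := fun n => by positivity
  have hTx : ContinuousOn (fun t => T t x) (Ioi 0) :=
    ((ContinuousLinearMap.apply ℂ X) x).continuous.comp_continuousOn h.continuousOn
  calc ∫⁻ t in Ioi (0 : ℝ), ‖D t x‖ₑ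
      = ∫⁻ t in Ioi (0 : ℝ), liminf (fun n => ‖(r n)⁻¹ • (T t x - T (t + r n) x)‖ₑ) atTop := by
        refine setLIntegral_congr_fun measurableSet_Ioi fun t ht => ?_
        refine (Tendsto.liminf_eq ?_).symm
        have h1 := ((h.hasDerivAt t ht).clm_apply_const x).tendsto_slope_zero_right
        have h2 : Tendsto r atTop (𝓝[>] 0) := tendsto_nhdsWithin_iff.2
          ⟨tendsto_one_div_add_atTop_nhds_zero_nat, Eventually.of_forall hr⟩
        have h3 := ((h1.comp h2).neg.enorm)
        simp only [neg_apply, neg_neg] at h3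
        refine h3.congr fun n => ?_
        simp only [Function.comp_apply]
        rw [← smul_neg, neg_sub]
    _ ≤ liminf (fun n => ∫⁻ t in Ioi (0 : ℝ), ‖(r n)⁻¹ • (T t x - T (t + r n) x)‖ₑ) atTop := by
        refine lintegral_liminf_le' fun n => ?_
        refine AEStronglyMeasurable.enorm (ContinuousOn.aestronglyMeasurable ?_ measurableSet_Ioi)
        refine (hTx.sub (hTx.comp (by fun_prop) fun t ht => ?_)).const_smul (r n)⁻¹
        exact add_pos ht (hr n)
    _ ≤ liminf (fun _ => K * ‖x‖ₑ) atTop := by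
        refine liminf_le_liminf (Eventually.of_forall fun n => ?_)
        simp only [enorm_smul]
        rw [lintegral_const_mul' _ _ enorm_ne_top]
        calc _ ≤ ‖(r n)⁻¹‖ₑ * (K * (ENNReal.ofReal (r n) * ‖x‖ₑ)) := by
              gcongr
              exact key _ (hr n)
          _ = (‖(r n)⁻¹‖ₑ * ENNReal.ofReal (r n)) * (K * ‖x‖ₑ) := by ring
          _ = K * ‖x‖ₑ := by
              rw [← ofReal_norm, ← ENNReal.ofReal_mul (norm_nonneg _), norm_inv,
                Real.norm_of_nonneg (hr n).le, inv_mul_cancel₀ (hr n).ne']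
              simp
    _ = K * ‖x‖ₑ := by simp

/-- For fixed s, the integral over t > s of ‖D(t - s) f(s)‖ is the assumed bound for the vector x =
f(s), hence at most C ‖f(s)‖. Tonelli then gives absolute convergence of ∫ D(t - s) f(s) ds for
almost every t. -/
theorem hasMaximalRegularity_one_of_lintegral_le [CompleteSpace X]
    (h : IsAnalyticGenerator A T D M)
    (hD : ∃ C : ℝ≥0, ∀ x : X, ∫⁻ t in Ioi (0 : ℝ), ‖D t x‖ₑ ≤ C * ‖x‖ₑ) :
    HasMaximalRegularity A 1 := by
  obtain ⟨C, hC⟩ := hD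
  rw [h.hasMaximalRegularity_iff le_rfl]
  intro f hf
  set μ := volume.restrict (Ioi (0 : ℝ))
  set K : ℝ × ℝ → X := {p : ℝ × ℝ | p.2 < p.1}.indicator fun p : ℝ × ℝ => D (p.1 - p.2) (f p.2)
  have hKm : AEStronglyMeasurable K (μ.prod μ) :=
    aestronglyMeasurable_convolution_kernel h.continuousOn_deriv hf.1
  have hK : Integrable K (μ.prod μ) := by
    refine ⟨hKm, ?_⟩
    rw [hasFiniteIntegral_iff_enorm, lintegral_prod_symm _ hKm.enorm]
    have hle : ∀ᵐ s ∂μ, ∫⁻ t, ‖K (t, s)‖ₑ ∂μ ≤ C * ‖f s‖ₑ := by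
      filter_upwards [ae_restrict_mem measurableSet_Ioi] with s hs
      rw [mem_Ioi] at hs
      have h1 : ∀ t, ‖K (t, s)‖ₑ = (Ioi s).indicator (fun t => ‖D (t - s) (f s)‖ₑ) t := by
        intro t
        by_cases hts : s < t <;> simp [K, hts]
      simp only [h1]
      rw [lintegral_indicator measurableSet_Ioi, Measure.restrict_restrict measurableSet_Ioi,
        inter_eq_left.2 (Ioi_subset_Ioi hs.le),
        setLIntegral_Ioi_comp_sub_right (fun t => ‖D t (f s)‖ₑ)]
      exact hC (f s)
    refine (lintegral_mono_ae hle).trans_lt ?_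
    rw [lintegral_const_mul' _ _ ENNReal.coe_ne_top]
    refine ENNReal.mul_lt_top ENNReal.coe_lt_top ?_
    rw [← hasFiniteIntegral_iff_enorm]
    exact (memLp_one_iff_integrable.1 hf).2
  refine ⟨fun t => ∫ s, K (t, s) ∂μ, memLp_one_iff_integrable.2 hK.integral_prod_left, ?_⟩
  filter_upwards [hK.prod_right_ae, ae_restrict_mem measurableSet_Ioi] with t ht1 ht0
  rw [mem_Ioi] at ht0
  have hi := h.intervalIntegrable_mild ht0.le (hf.intervalIntegrable_zero le_rfl ht0.le)
  rw [intervalIntegrable_iff_integrableOn_Ioo_of_le ht0.le] at hi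
  have h2 : ∀ s, K (t, s) = (Iio t).indicator (fun s => D (t - s) (f s)) s := fun s => rfl
  have hset : Ioi 0 ∩ Iio t = Ioo 0 t := Ioi_inter_Iio
  have hiD : IntegrableOn (fun s => D (t - s) (f s)) (Ioo 0 t) := by
    simp only [h2] at ht1
    rw [integrable_indicator_iff measurableSet_Iio, IntegrableOn,
      Measure.restrict_restrict measurableSet_Iio, inter_comm, hset] at ht1
    exact ht1
  have hsum : IntegrableOn (fun s => T (t - s) (f s) + D (t - s) (f s)) (Ioo 0 t) := hi.add hiD
  simp only [h2]
  rw [setIntegral_indicator measurableSet_Iio, hset, mildSolution,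
    intervalIntegral.integral_of_le ht0.le, integral_Ioc_eq_integral_Ioo,
    ← integral_add hi hiD, ← ContinuousLinearMap.integral_comp_comm _ hsum]
  exact setIntegral_congr_fun measurableSet_Ioo fun s hs => h.apply_eq (sub_pos.2 hs.2) _

theorem hasMaximalRegularity_one_iff [CompleteSpace X] (h : IsAnalyticGenerator A T D M) :
    HasMaximalRegularity A 1 ↔
      ∃ C : ℝ≥0, ∀ x : X, ∫⁻ t in Ioi (0 : ℝ), ‖D t x‖ₑ ≤ C * ‖x‖ₑ :=
  ⟨h.lintegral_le_of_hasMaximalRegularity_one, h.hasMaximalRegularity_one_of_lintegral_le⟩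

end IsAnalyticGenerator

end MaximalRegularityOne

/-! ### Real-variable tools: averaging kernels and Lebesgue points -/

section MaximalRegularityTop

theorem lintegral_Ioi_two_mul_div_cube {r s : ℝ} (hr : 0 < r) (hs : 0 ≤ s) :
    ∫⁻ t in Ioi s, ENNReal.ofReal (2 * r / (r + t) ^ 3) = ENNReal.ofReal (r / (r + s) ^ 2) := by
  have hd : ∀ t ∈ Ici s, HasDerivAt (fun t => -(r / (r + t) ^ 2)) (2 * r / (r + t) ^ 3) t := by
    intro t ht
    have h0 : r + t ≠ 0 := by
      have : s ≤ t := ht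
      exact (by linarith : 0 < r + t).ne'
    have h1 := (((hasDerivAt_id t).const_add r).pow 2).fun_inv (pow_ne_zero 2 h0)
    refine ((h1.const_mul r).neg.congr_deriv ?_).congr_of_eventuallyEq ?_
    · simp
      field_simp
    · exact Eventually.of_forall fun t => by simp [div_eq_mul_inv]
  have hnn : ∀ t ∈ Ioi s, 0 ≤ 2 * r / (r + t) ^ 3 := fun t ht => by
    have : s < t := ht
    have : 0 < t := by linarith
    positivity
  have hlim : Tendsto (fun t => -(r / (r + t) ^ 2)) atTop (𝓝 0) := by
    rw [← neg_zero]
    refine (Tendsto.const_div_atTop ?_ r).neg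
    exact (tendsto_pow_atTop two_ne_zero).comp (tendsto_atTop_add_const_left _ r tendsto_id)
  rw [← ofReal_integral_eq_lintegral_ofReal (integrableOn_Ioi_deriv_of_nonneg' hd hnn hlim)
    ((ae_restrict_mem measurableSet_Ioi).mono hnn), integral_Ioi_of_hasDerivAt_of_nonneg' hd hnn hlim]
  simp

theorem lintegral_Ioi_div_sq {r : ℝ} (hr : 0 < r) :
    ∫⁻ t in Ioi (0 : ℝ), ENNReal.ofReal (r / (r + t) ^ 2) = 1 := by
  have hd : ∀ t ∈ Ici (0 : ℝ), HasDerivAt (fun t => -(r / (r + t))) (r / (r + t) ^ 2) t := by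
    intro t ht
    have h0 : r + t ≠ 0 := by
      have : 0 ≤ t := ht
      positivity
    have h1 := ((hasDerivAt_id t).const_add r).fun_inv h0
    refine ((h1.const_mul r).neg.congr_deriv ?_).congr_of_eventuallyEq ?_
    · simp
      field_simp
    · exact Eventually.of_forall fun t => by simp [div_eq_mul_inv]
  have hnn : ∀ t ∈ Ioi (0 : ℝ), 0 ≤ r / (r + t) ^ 2 := fun t _ => by positivity
  have hlim : Tendsto (fun t => -(r / (r + t))) atTop (𝓝 0) := by
    rw [← neg_zero]
    exact (Tendsto.const_div_atTop (tendsto_atTop_add_const_left _ r tendsto_id) r).neg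
  rw [← ofReal_integral_eq_lintegral_ofReal (integrableOn_Ioi_deriv_of_nonneg' hd hnn hlim)
    ((ae_restrict_mem measurableSet_Ioi).mono hnn), integral_Ioi_of_hasDerivAt_of_nonneg' hd hnn hlim]
  simp [hr.ne']

/-- The kernels `r / (r + s)²` are bounded by the one-sided maximal function. -/
theorem lintegral_div_sq_mul_le {φ : ℝ → ℝ≥0∞} (hφ : AEMeasurable φ (volume.restrict (Ioi 0)))
    {δ : ℝ≥0∞} (hδ : ∀ τ, 0 < τ → ∫⁻ s in Ioc 0 τ, φ s ≤ δ * ENNReal.ofReal τ) {r : ℝ}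
    (hr : 0 < r) : ∫⁻ s in Ioi 0, ENNReal.ofReal (r / (r + s) ^ 2) * φ s ≤ 2 * δ := by
  set μ := volume.restrict (Ioi (0 : ℝ))
  have hset : MeasurableSet {p : ℝ × ℝ | p.1 < p.2} := measurableSet_lt measurable_fst measurable_snd
  calc ∫⁻ s, ENNReal.ofReal (r / (r + s) ^ 2) * φ s ∂μ
      -- The decreasing kernel is a superposition of indicators of (0, t) with weight 2r/(r + t)³,
      -- so only averages of φ over intervals starting at 0 matter.
      = ∫⁻ s, ∫⁻ t, {p : ℝ × ℝ | p.1 < p.2}.indicator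
          (fun p => ENNReal.ofReal (2 * r / (r + p.2) ^ 3) * φ p.1) (s, t) ∂μ ∂μ := by
        refine setLIntegral_congr_fun measurableSet_Ioi fun s hs => ?_
        have h1 : ∀ t, {p : ℝ × ℝ | p.1 < p.2}.indicator
            (fun p => ENNReal.ofReal (2 * r / (r + p.2) ^ 3) * φ p.1) (s, t) =
            (Ioi s).indicator (fun t => ENNReal.ofReal (2 * r / (r + t) ^ 3) * φ s) t :=
          fun t => rfl
        simp only [h1]
        rw [lintegral_indicator measurableSet_Ioi, Measure.restrict_restrict measurableSet_Ioi,
          inter_eq_left.2 (Ioi_subset_Ioi (le_of_lt hs)), lintegral_mul_const _ (by fun_prop),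
          lintegral_Ioi_two_mul_div_cube hr (le_of_lt hs)]
    _ = ∫⁻ t, ∫⁻ s, {p : ℝ × ℝ | p.1 < p.2}.indicator
          (fun p => ENNReal.ofReal (2 * r / (r + p.2) ^ 3) * φ p.1) (s, t) ∂μ ∂μ := by
        refine lintegral_lintegral_swap ?_
        refine AEMeasurable.indicator ?_ hset
        exact AEMeasurable.mul (by fun_prop) hφ.comp_fst
    _ ≤ ∫⁻ t, ENNReal.ofReal (r / (r + t) ^ 2) * (2 * δ) ∂μ := by
        refine setLIntegral_mono' measurableSet_Ioi fun t ht => ?_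
        rw [mem_Ioi] at ht
        have h1 : ∀ s, {p : ℝ × ℝ | p.1 < p.2}.indicator
            (fun p => ENNReal.ofReal (2 * r / (r + p.2) ^ 3) * φ p.1) (s, t) =
            (Iio t).indicator (fun s => ENNReal.ofReal (2 * r / (r + t) ^ 3) * φ s) s :=
          fun s => rfl
        simp only [h1]
        rw [lintegral_indicator measurableSet_Iio, Measure.restrict_restrict measurableSet_Iio,
          lintegral_const_mul' _ _ ENNReal.ofReal_ne_top]
        calc _ ≤ ENNReal.ofReal (2 * r / (r + t) ^ 3) * (δ * ENNReal.ofReal t) := by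
              gcongr
              refine le_trans (lintegral_mono_set ?_) (hδ t ht)
              exact fun s hs => ⟨hs.2, le_of_lt hs.1⟩
          _ = δ * ENNReal.ofReal (2 * r / (r + t) ^ 3 * t) := by
              rw [ENNReal.ofReal_mul (by positivity)]
              ring
          _ ≤ δ * ENNReal.ofReal (r / (r + t) ^ 2 * 2) := by
              refine mul_le_mul' le_rfl (ENNReal.ofReal_le_ofReal ?_)
              rw [div_mul_eq_mul_div, div_mul_eq_mul_div, div_le_div_iff₀ (by positivity)
                (by positivity)]
              nlinarith [mul_pos hr hr, pow_pos (add_pos hr ht) 2, mul_pos hr (pow_pos (add_pos hr ht) 2)]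
          _ = _ := by
              rw [ENNReal.ofReal_mul (by positivity)]
              simp
              ring
    _ = 2 * δ := by
        rw [lintegral_mul_const _ (by fun_prop), lintegral_Ioi_div_sq hr, one_mul]

theorem frequently_nhdsGT_of_ae {P : ℝ → Prop} (h : ∀ᵐ t, 0 < t → P t) : ∃ᶠ t in 𝓝[>] 0, P t := by
  rw [frequently_iff]
  intro U hU
  obtain ⟨δ, hδ, hU⟩ := mem_nhdsGT_iff_exists_Ioo_subset.1 hU
  obtain ⟨t, ht, ht'⟩ := (Measure.dense_of_ae h).exists_mem_open isOpen_Ioo (nonempty_Ioo.2 hδ)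
  exact ⟨t, hU ht', ht ht'.1⟩

/-- One-sided Lebesgue points. -/
theorem ae_lebesgue_left {E : Type*} [NormedAddCommGroup E] {f : ℝ → E}
    (hf : LocallyIntegrable f volume) : ∀ᵐ t, ∀ η : ℝ, 0 < η → ∃ r₀, 0 < r₀ ∧ ∀ r, 0 < r → r ≤ r₀ →
      ∫⁻ s in Ioc 0 r, ‖f (t - s) - f t‖ₑ ≤ ENNReal.ofReal (η * r) := by
  filter_upwards [IsUnifLocDoublingMeasure.ae_tendsto_average_norm_sub volume hf 1] with t ht η hη
  have h1 := ht (ι := ℝ) (l := 𝓝[>] 0) (fun _ => t) id tendsto_id (by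
    filter_upwards [self_mem_nhdsWithin] with r hr
    simpa using le_of_lt hr)
  -- The half compensates for the length 2r of the two-sided interval.
  have h2 : ∀ᶠ r in 𝓝[>] (0 : ℝ), ⨍ y in Metric.closedBall t r, ‖f y - f t‖ < η / 2 :=
    h1.eventually_lt_const (by positivity)
  obtain ⟨r₀, hr₀, hU⟩ := mem_nhdsGT_iff_exists_Ioc_subset.1 h2
  refine ⟨r₀, hr₀, fun r hr hr' => ?_⟩
  have h3 : ⨍ y in Metric.closedBall t r, ‖f y - f t‖ < η / 2 := hU ⟨hr, hr'⟩
  have hvol : volume.real (Metric.closedBall t r) = 2 * r := by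
    rw [Measure.real, Real.volume_closedBall, ENNReal.toReal_ofReal (by positivity)]
  rw [setAverage_eq, hvol, smul_eq_mul, inv_mul_lt_iff₀ (by positivity)] at h3
  have hint : IntegrableOn (fun y => f y - f t) (Metric.closedBall t r) :=
    (hf.integrableOn_isCompact (isCompact_closedBall t r)).sub
      (integrableOn_const measure_closedBall_lt_top.ne)
  have h4 : ∫⁻ y in Metric.closedBall t r, ‖f y - f t‖ₑ ≤ ENNReal.ofReal (η * r) := by
    have := ofReal_integral_norm_eq_lintegral_enorm hint
    rw [← this]
    exact ENNReal.ofReal_le_ofReal (by linarith)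
  refine le_trans ?_ h4
  have h5 := (Measure.measurePreserving_sub_left volume t).setLIntegral_comp_preimage_emb
    (MeasurableEquiv.subLeft t).measurableEmbedding (fun y => ‖f y - f t‖ₑ) (Metric.closedBall t r)
  rw [← h5]
  refine lintegral_mono_set fun s hs => ?_
  simp only [mem_preimage, mem_closedBall_iff_norm, Real.norm_eq_abs]
  rw [abs_le]
  constructor <;> linarith [hs.1, hs.2]

end MaximalRegularityTop

/-! ### Necessity of the sup condition for L^∞-maximal regularity -/

section MaximalRegularityTop

variable {X : Type*} [NormedAddCommGroup X] [NormedSpace ℂ X]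

theorem HasDerivAt.comp_affine_apply {S : ℝ → X →L[ℂ] X} {S' : X →L[ℂ] X} {a b s : ℝ}
    (hS : HasDerivAt S S' (a * s + b)) (x : X) :
    HasDerivAt (fun s => S (a * s + b) x) ((a : ℂ) • S' x) s := by
  have h1 : HasDerivAt (fun s : ℝ => a * s + b) a s := by
    simpa using ((hasDerivAt_id s).const_mul a).add_const b
  have h2 := HasDerivAt.scomp (g₁ := fun r => S r x) s (hS.clm_apply_const x) h1
  rw [Complex.coe_smul]
  exact h2

/-- `‖x‖ ≤ C sup_{t>0} ‖t A T(t) x‖ + limsup_{t→∞} ‖T(t) x‖`, where `D t = A T(t)`. -/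
def DerivSupCondition (T D : ℝ → X →L[ℂ] X) : Prop :=
  ∃ C : ℝ≥0, ∀ x : X, ‖x‖ₑ ≤ C * (⨆ t ∈ Ioi (0 : ℝ), ‖(t : ℂ) • D t x‖ₑ) +
    limsup (fun t : ℝ => ‖T t x‖ₑ) atTop

namespace IsAnalyticGenerator

variable {A : X →ₗ.[ℂ] X} {T D : ℝ → X →L[ℂ] X} {M : ℝ}

theorem deriv_eq_oneAddInv (h : IsAnalyticGenerator A T D M) {t : ℝ} (ht : 0 < t) (x : X) :
    D t x = oneAddInv A 1 (D t x + D (t / 2) (D (t / 2) x)) := by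
  have h2 : 0 < t / 2 := by positivity
  have h1 := h.deriv_add h2 h2
  rw [add_halves] at h1
  rw [h1, mul_apply_eq_comp]
  exact h.apply_eq h2 _

theorem norm_smul_deriv_le (h : IsAnalyticGenerator A T D M) {t : ℝ} (ht : 0 < t) (x : X) :
    ‖(t : ℂ) • D t x‖ ≤ M * ‖x‖ := by
  rw [norm_smul, Complex.norm_real, Real.norm_of_nonneg ht.le]
  calc t * ‖D t x‖ ≤ t * (M / t * ‖x‖) := by
        gcongr
        exact (D t).le_of_opNorm_le (h.norm_deriv_le t ht) x
    _ = M * ‖x‖ := by field_simp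

/-- The test function `s ↦ (t₀ - s) A T(t₀ - s) x` on `(0, t₀)` and its mild solution. -/
theorem mildSolution_test [CompleteSpace X] (h : IsAnalyticGenerator A T D M) {t₀ e : ℝ}
    (ht₀ : 0 < t₀) (he : 0 < e) (x : X) {f : ℝ → X}
    (hf : f = (Ioo 0 t₀).indicator fun s => ((t₀ - s : ℝ) : ℂ) • D (t₀ - s) x) :
    mildSolution T f (t₀ + e) = oneAddInv A 1 (mildSolution T f (t₀ + e) +
      (-((t₀ / 2 : ℝ) : ℂ) • D (2 * t₀ + e) x + (1 / 4 : ℂ) • (T e x - T (2 * t₀ + e) x))) := by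
  have hm : mildSolution T f (t₀ + e) = ∫ s in (0 : ℝ)..t₀, (s : ℂ) • D (2 * s + e) x := by
    have h1 : mildSolution T f (t₀ + e) = ∫ s in Ioc 0 (t₀ + e),
        (Ioo 0 t₀).indicator (fun s => T (t₀ + e - s) (((t₀ - s : ℝ) : ℂ) • D (t₀ - s) x)) s := by
      rw [mildSolution, intervalIntegral.integral_of_le (by positivity)]
      congr 1
      ext s
      by_cases hs : s ∈ Ioo 0 t₀ <;> simp [hf, hs]
    have hset : Ioc 0 (t₀ + e) ∩ Ioo 0 t₀ = Ioo 0 t₀ :=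
      inter_eq_right.2 fun s hs => ⟨hs.1, by linarith [hs.2]⟩
    have h2 := intervalIntegral.integral_comp_sub_left
      (fun s : ℝ => (s : ℂ) • D (2 * s + e) x) t₀ (a := 0) (b := t₀)
    rw [sub_self, sub_zero] at h2
    rw [h1, setIntegral_indicator measurableSet_Ioo, hset, ← h2,
      intervalIntegral.integral_of_le ht₀.le, integral_Ioc_eq_integral_Ioo]
    refine setIntegral_congr_fun measurableSet_Ioo fun s hs => ?_
    have hs' : 0 < t₀ - s := sub_pos.2 hs.2
    simp only [map_smul]
    rw [← mul_apply_eq_comp, ← h.deriv_add (by linarith) hs']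
    ring_nf
  have hlin : ∀ s ∈ uIcc 0 t₀, 0 < 2 * s + e := fun s hs => by
    rw [uIcc_of_le ht₀.le] at hs
    linarith [hs.1]
  have hDc : ContinuousOn (fun s => D (2 * s + e)) (uIcc 0 t₀) :=
    h.continuousOn_deriv.comp (by fun_prop) hlin
  have hD2 : ContinuousOn (fun s => D ((2 * s + e) / 2)) (uIcc 0 t₀) :=
    h.continuousOn_deriv.comp (by fun_prop) fun s hs => half_pos (hlin s hs)
  have hofReal : ContinuousOn (fun s : ℝ => (s : ℂ)) (uIcc 0 t₀) :=
    Complex.continuous_ofReal.continuousOn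
  have hi1 : IntervalIntegrable (fun s : ℝ => (s : ℂ) • D (2 * s + e) x) volume 0 t₀ :=
    (hofReal.smul (hDc.clm_apply continuousOn_const)).intervalIntegrable
  have hcE : ContinuousOn
      (fun s : ℝ => (s : ℂ) • D ((2 * s + e) / 2) (D ((2 * s + e) / 2) x)) (uIcc 0 t₀) :=
    hofReal.smul (hD2.clm_apply (hD2.clm_apply continuousOn_const))
  have hi2 := hcE.intervalIntegrable (μ := volume)
  -- The integrand is s A² T(2s + e) x. Integration by parts gives the antiderivative -(s/2) A T(2s
  -- + e) x - (1/4) T(2s + e) x.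
  have hFTC : ∫ s in (0 : ℝ)..t₀, (s : ℂ) • D ((2 * s + e) / 2) (D ((2 * s + e) / 2) x) =
      -((t₀ / 2 : ℝ) : ℂ) • D (2 * t₀ + e) x + (1 / 4 : ℂ) • (T e x - T (2 * t₀ + e) x) := by
    have h1 : ∀ s ∈ uIcc 0 t₀, HasDerivAt
        (fun s : ℝ => (-(s / 2 : ℝ) : ℂ) • D (2 * s + e) x - (1 / 4 : ℂ) • T (2 * s + e) x)
        ((s : ℂ) • D ((2 * s + e) / 2) (D ((2 * s + e) / 2) x)) s := by
      intro s hs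
      have h3 := (h.hasDerivAt_deriv (hlin s hs)).comp_affine_apply x
      have h4 := (h.hasDerivAt _ (hlin s hs)).comp_affine_apply x
      have h5 : HasDerivAt (fun s : ℝ => (-(s / 2 : ℝ) : ℂ)) (-(1 / 2 : ℝ) : ℂ) s :=
        (((hasDerivAt_id s).div_const 2).ofReal_comp).neg
      refine ((h5.smul h3).sub (h4.const_smul (1 / 4 : ℂ))).congr_deriv ?_
      simp only [neg_apply, mul_apply_eq_comp]
      push_cast
      module
    rw [intervalIntegral.integral_eq_sub_of_hasDerivAt h1 hi2]
    simp only [mul_zero, zero_add, zero_div, Complex.ofReal_zero, neg_zero, zero_smul]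
    module
  rw [hm, ← hFTC, ← intervalIntegral.integral_add hi1 hi2,
    ← ContinuousLinearMap.intervalIntegral_comp_comm _ (hi1.add hi2)]
  refine intervalIntegral.integral_congr fun s hs => ?_
  rw [← smul_add, map_smul, ← h.deriv_eq_oneAddInv (hlin s hs)]

/-- The test function is bounded by N, so the a priori estimate bounds A u(t₀ + e) by K N for almost
every e > 0. As e → 0, where strong continuity at 0 is used, this bounds (x - T(2t₀) x)/4 - (t₀/2)
D(2t₀) x. -/
theorem norm_le_of_hasMaximalRegularity_top [CompleteSpace X]
    (h : IsAnalyticGenerator A T D M) (hMR : HasMaximalRegularity A ∞)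
    (hC0 : ∀ x : X, Tendsto (fun t : ℝ => T t x) (𝓝[>] 0) (𝓝 x)) :
    ∃ K : ℝ≥0, ∀ (x : X) (N : ℝ), (∀ t : ℝ, 0 < t → ‖(t : ℂ) • D t x‖ ≤ N) →
      ∀ t, 0 < t → ‖x‖ ≤ K * N + ‖T t x‖ := by
  have : Fact ((1 : ℝ≥0∞) ≤ ∞) := ⟨le_top⟩
  obtain ⟨K, hK⟩ := h.exists_eLpNorm_le_of_hasMaximalRegularity (p := ∞) hMR
  rw [h.hasMaximalRegularity_iff le_top] at hMR
  refine ⟨4 * K + 1, fun x N hN => ?_⟩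
  have hN0 : 0 ≤ N := (norm_nonneg _).trans (hN 1 one_pos)
  have key : ∀ t₀, 0 < t₀ → ‖x‖ ≤ (4 * K + 1) * N + ‖T (2 * t₀) x‖ := by
    intro t₀ ht₀
    set f : ℝ → X := (Ioo 0 t₀).indicator fun s => ((t₀ - s : ℝ) : ℂ) • D (t₀ - s) x with hf
    have hfN : ∀ s, ‖f s‖ ≤ N := by
      intro s
      by_cases hs : s ∈ Ioo 0 t₀
      · simp only [hf, indicator_of_mem hs]
        exact hN _ (sub_pos.2 hs.2)
      · simp only [hf, indicator_of_notMem hs, norm_zero]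
        exact hN0
    have hfm : MemLp f ∞ (volume.restrict (Ioi (0 : ℝ))) := by
      refine memLp_top_of_bound ?_ N (Eventually.of_forall hfN)
      refine AEStronglyMeasurable.mono_measure ?_ Measure.restrict_le_self
      rw [hf, aestronglyMeasurable_indicator_iff measurableSet_Ioo]
      refine ContinuousOn.aestronglyMeasurable ?_ measurableSet_Ioo
      refine ContinuousOn.smul (Continuous.continuousOn (by fun_prop))
        (ContinuousOn.clm_apply (h.continuousOn_deriv.comp (by fun_prop) fun s hs => ?_)
          continuousOn_const)
      exact mem_Ioi.2 (sub_pos.2 hs.2)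
    obtain ⟨w, hw, hfw⟩ := hMR f hfm
    have hwK : ∀ᵐ t ∂volume.restrict (Ioi (0 : ℝ)), ‖w t‖ ≤ K * N := by
      have h1 := hK f w hfm hw hfw
      have h2 : eLpNorm f ∞ (volume.restrict (Ioi (0 : ℝ))) ≤ ENNReal.ofReal N :=
        eLpNormEssSup_le_of_ae_bound (Eventually.of_forall hfN)
      have h3 : eLpNormEssSup w (volume.restrict (Ioi (0 : ℝ))) ≤ ENNReal.ofReal (K * N) := by
        rw [ENNReal.ofReal_mul K.coe_nonneg, ENNReal.ofReal_coe_nnreal]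
        exact h1.trans (by gcongr)
      filter_upwards [ae_le_eLpNormEssSup (f := w)] with t ht
      have h4 := ht.trans h3
      rw [← ofReal_norm] at h4
      exact (ENNReal.ofReal_le_ofReal_iff (by positivity)).1 h4
    set W : ℝ → X := fun e => -((t₀ / 2 : ℝ) : ℂ) • D (2 * t₀ + e) x +
      (1 / 4 : ℂ) • (T e x - T (2 * t₀ + e) x) with hW
    -- The estimate holds only for almost every e, which still leaves values of e arbitrarily close
    -- to 0.
    have hWK : ∃ᶠ e in 𝓝[>] 0, ‖W e‖ ≤ K * N := by
      refine frequently_nhdsGT_of_ae ?_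
      have h1 : ∀ᵐ t, t ∈ Ioi (0 : ℝ) → ‖w t‖ ≤ K * N ∧
          mildSolution T f t = oneAddInv A 1 (mildSolution T f t + w t) :=
        (ae_restrict_iff' measurableSet_Ioi).1 (hwK.and hfw)
      filter_upwards [(measurePreserving_add_left volume t₀).quasiMeasurePreserving.ae h1]
        with e he he0
      obtain ⟨h2, h3⟩ := he (add_pos ht₀ he0)
      have h4 := h.mildSolution_test ht₀ he0 x hf
      have h5 := add_left_cancel (h.oneAddInv_injective one_pos (h4.symm.trans h3))
      rw [← h5] at h2
      exact h2
    have hlim : Tendsto W (𝓝[>] 0)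
        (𝓝 (-((t₀ / 2 : ℝ) : ℂ) • D (2 * t₀) x + (1 / 4 : ℂ) • (x - T (2 * t₀) x))) := by
      have h2t : 0 < 2 * t₀ := by positivity
      have h1 : Tendsto (fun e : ℝ => 2 * t₀ + e) (𝓝[>] 0) (𝓝 (2 * t₀)) := by
        have : Continuous fun e : ℝ => 2 * t₀ + e := by fun_prop
        simpa using (this.tendsto 0).mono_left (nhdsWithin_le_nhds (s := Ioi 0))
      have hDt : Tendsto (fun e => D (2 * t₀ + e) x) (𝓝[>] 0) (𝓝 (D (2 * t₀) x)) :=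
        ((h.hasDerivAt_deriv h2t).clm_apply_const x).continuousAt.tendsto.comp h1
      have hTt : Tendsto (fun e => T (2 * t₀ + e) x) (𝓝[>] 0) (𝓝 (T (2 * t₀) x)) :=
        ((h.hasDerivAt _ h2t).clm_apply_const x).continuousAt.tendsto.comp h1
      exact (hDt.const_smul _).add (((hC0 x).sub hTt).const_smul _)
    have hle := le_of_tendsto_of_frequently hlim.norm hWK
    have hD := hN (2 * t₀) (by positivity)
    -- The three terms have norms at most 4 K N, N and ‖T(2t₀) x‖, which explains the constant 4 K +
    -- 1.
    have e1 : x = (4 : ℂ) • (-((t₀ / 2 : ℝ) : ℂ) • D (2 * t₀) x + (1 / 4 : ℂ) • (x - T (2 * t₀) x)) +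
        ((2 * t₀ : ℝ) : ℂ) • D (2 * t₀) x + T (2 * t₀) x := by
      push_cast
      module
    calc ‖x‖ ≤ 4 * (K * N) + N + ‖T (2 * t₀) x‖ := by
          nth_rw 1 [e1]
          refine (norm_add_le _ _).trans (add_le_add_left ((norm_add_le _ _).trans
            (add_le_add ?_ hD)) _)
          rw [norm_smul]
          simp only [Complex.norm_ofNat]
          gcongr
      _ = _ := by ring
  intro t ht
  have := key (t / 2) (by positivity)
  rw [mul_div_cancel₀ _ two_ne_zero] at this
  exact_mod_cast this

theorem derivSupCondition_of_hasMaximalRegularity_top [CompleteSpace X]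
    (h : IsAnalyticGenerator A T D M) (hMR : HasMaximalRegularity A ∞)
    (hC0 : ∀ x : X, Tendsto (fun t : ℝ => T t x) (𝓝[>] 0) (𝓝 x)) : DerivSupCondition T D := by
  obtain ⟨K, hK⟩ := h.norm_le_of_hasMaximalRegularity_top hMR hC0
  refine ⟨K, fun x => ?_⟩
  set S := ⨆ t ∈ Ioi (0 : ℝ), ‖(t : ℂ) • D t x‖ₑ
  have hle : ∀ t : ℝ, 0 < t → ‖(t : ℂ) • D t x‖ₑ ≤ S := fun t ht =>
    le_iSup₂_of_le (f := fun (t : ℝ) (_ : t ∈ Ioi (0 : ℝ)) => ‖(t : ℂ) • D t x‖ₑ) t ht le_rfl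
  have hS : S ≠ ∞ := by
    refine ne_top_of_le_ne_top (ENNReal.ofReal_ne_top (r := M * ‖x‖)) (iSup₂_le fun t ht => ?_)
    rw [← ofReal_norm]
    exact ENNReal.ofReal_le_ofReal (h.norm_smul_deriv_le ht x)
  have h1 : ∀ t, 0 < t → ‖x‖ₑ ≤ K * S + ‖T t x‖ₑ := by
    intro t ht
    have h2 := hK x S.toReal (fun t ht => by
      have := ENNReal.toReal_mono hS (hle t ht)
      rwa [toReal_enorm] at this) t ht
    have h3 := ENNReal.ofReal_le_ofReal h2
    rwa [ENNReal.ofReal_add (by positivity) (norm_nonneg _), ENNReal.ofReal_mul K.coe_nonneg,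
      ENNReal.ofReal_coe_nnreal, ENNReal.ofReal_toReal hS, ofReal_norm, ofReal_norm] at h3
  rw [← tsub_le_iff_left]
  refine le_limsup_of_frequently_le (Eventually.frequently ?_)
  filter_upwards [Ioi_mem_atTop 0] with t ht
  rw [tsub_le_iff_left]
  exact h1 t ht

end IsAnalyticGenerator

end MaximalRegularityTop

/-! ### Sufficiency of the sup condition for L^∞-maximal regularity -/

section MaximalRegularityTop

variable {X : Type*} [NormedAddCommGroup X] [NormedSpace ℂ X]

namespace IsAnalyticGenerator

variable {A : X →ₗ.[ℂ] X} {T D : ℝ → X →L[ℂ] X} {M : ℝ}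

/-- Both products are A² T(a + b). The balanced splitting gives the optimal decay (a + b)⁻² in the
norm bound. -/
theorem deriv_mul_deriv (h : IsAnalyticGenerator A T D M) {a b : ℝ} (ha : 0 < a) (hb : 0 < b) :
    D a * D b = D ((a + b) / 2) * D ((a + b) / 2) := by
  have hm : 0 < (a + b) / 2 := by positivity
  rcases lt_trichotomy a b with hab | rfl | hab
  · have h1 := h.deriv_add (show 0 < (b - a) / 2 by linarith) hm
    have h2 := h.deriv_add' ha (show 0 < (b - a) / 2 by linarith)
    rw [show (b - a) / 2 + (a + b) / 2 = b by ring] at h1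
    rw [show a + (b - a) / 2 = (a + b) / 2 by ring] at h2
    rw [h1, ← mul_assoc, ← h2]
  · rw [add_self_div_two]
  · have h1 := h.deriv_add' hm (show 0 < (a - b) / 2 by linarith)
    have h2 := h.deriv_add (show 0 < (a - b) / 2 by linarith) hb
    rw [show (a + b) / 2 + (a - b) / 2 = a by ring] at h1
    rw [show (a - b) / 2 + b = (a + b) / 2 by ring] at h2
    rw [h1, mul_assoc, ← h2]

theorem norm_deriv_mul_deriv_le (h : IsAnalyticGenerator A T D M) {a b : ℝ} (ha : 0 < a)
    (hb : 0 < b) : ‖D a * D b‖ ≤ 4 * M ^ 2 / (a + b) ^ 2 := by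
  have hm : 0 < (a + b) / 2 := by positivity
  rw [h.deriv_mul_deriv ha hb]
  refine (norm_mul_le _ _).trans ?_
  calc _ ≤ M / ((a + b) / 2) * (M / ((a + b) / 2)) := by
        have h1 := h.norm_deriv_le _ hm
        have := h.pos
        gcongr
    _ = _ := by
        field_simp
        norm_num

/-- On vectors D(e) z the limsup term disappears, because T(t) D(e) = D(t + e) has norm at most M/(t
+ e). -/
theorem norm_deriv_le_of_derivSupCondition (h : IsAnalyticGenerator A T D M)
    (hE : DerivSupCondition T D) : ∃ C : ℝ≥0, ∀ (e : ℝ) (z : X) (b : ℝ≥0∞), 0 < e →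
      (∀ r : ℝ, 0 < r → ‖(r : ℂ) • D r (D e z)‖ₑ ≤ b) → ‖D e z‖ₑ ≤ C * b := by
  obtain ⟨C, hC⟩ := hE
  refine ⟨C, fun e z b he hb => (hC (D e z)).trans ?_⟩
  have h1 : Tendsto (fun t : ℝ => T t (D e z)) atTop (𝓝 0) := by
    have h2 : Tendsto (fun t : ℝ => M / (t + e) * ‖z‖) atTop (𝓝 0) := by
      have := (tendsto_atTop_add_const_right atTop e tendsto_id).const_div_atTop M
      simpa using this.mul_const ‖z‖
    refine squeeze_zero_norm' ?_ h2
    filter_upwards [Ioi_mem_atTop 0] with t ht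
    rw [← mul_apply_eq_comp, ← h.deriv_add ht he]
    exact (D (t + e)).le_of_opNorm_le (h.norm_deriv_le _ (add_pos ht he)) z
  have h3 := h1.enorm.limsup_eq
  rw [h3, enorm_zero, add_zero]
  gcongr
  exact iSup₂_le hb

/-- If `z = ∫₀^l T(s) g(s) ds` and the averages `τ⁻¹ ∫₀^τ ‖g‖` are bounded by `δ`, then
`A T(e) z` is bounded by a multiple of `δ`, uniformly in `e`. -/
theorem enorm_deriv_integral_le [CompleteSpace X] (h : IsAnalyticGenerator A T D M) {C : ℝ≥0}
    (hC : ∀ (e : ℝ) (z : X) (b : ℝ≥0∞), 0 < e →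
      (∀ r : ℝ, 0 < r → ‖(r : ℂ) • D r (D e z)‖ₑ ≤ b) → ‖D e z‖ₑ ≤ C * b)
    {g : ℝ → X} {l : ℝ} (hg : IntegrableOn (fun s => T s (g s)) (Ioc 0 l))
    (hgm : AEStronglyMeasurable g (volume.restrict (Ioc 0 l))) {δ : ℝ≥0∞}
    (hδ : ∀ τ, 0 < τ → τ ≤ l → ∫⁻ s in Ioc 0 τ, ‖g s‖ₑ ≤ δ * ENNReal.ofReal τ) {e : ℝ}
    (he : 0 < e) :
    ‖D e (∫ s in Ioc 0 l, T s (g s))‖ₑ ≤ C * (ENNReal.ofReal (4 * M ^ 2) * (2 * δ)) := by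
  refine hC _ _ _ he fun r hr => ?_
  have h1 : (r : ℂ) • D r (D e (∫ s in Ioc 0 l, T s (g s))) =
      ∫ s in Ioc 0 l, (r : ℂ) • (D r * D e) (T s (g s)) := by
    rw [← ContinuousLinearMap.integral_comp_comm _ hg, ← ContinuousLinearMap.integral_comp_comm _
      ((D e).integrable_comp hg), ← integral_smul]
    rfl
  rw [h1]
  refine (enorm_integral_le_lintegral_enorm _).trans ?_
  set φ : ℝ → ℝ≥0∞ := (Ioc 0 l).indicator fun s => ‖g s‖ₑ
  have hφm : AEMeasurable φ (volume.restrict (Ioi 0)) := by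
    refine AEMeasurable.mono_measure ?_ Measure.restrict_le_self
    exact (aemeasurable_indicator_iff measurableSet_Ioc).2 hgm.enorm
  have hφ : ∀ τ, 0 < τ → ∫⁻ s in Ioc 0 τ, φ s ≤ δ * ENNReal.ofReal τ := by
    intro τ hτ
    rw [lintegral_indicator measurableSet_Ioc, Measure.restrict_restrict measurableSet_Ioc,
      Ioc_inter_Ioc, sup_idem]
    rcases le_or_gt τ l with hle | hlt
    · rw [inf_eq_right.2 hle]
      exact hδ τ hτ hle
    · rw [inf_eq_left.2 hlt.le]
      rcases le_or_gt l 0 with hl | hl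
      · simp [Ioc_eq_empty (not_lt.2 hl)]
      · exact (hδ l hl le_rfl).trans (by gcongr)
  calc ∫⁻ s in Ioc 0 l, ‖(r : ℂ) • (D r * D e) (T s (g s))‖ₑ
      ≤ ∫⁻ s in Ioc 0 l, ENNReal.ofReal (4 * M ^ 2) *
          (ENNReal.ofReal (r / (r + s) ^ 2) * ‖g s‖ₑ) := by
        refine setLIntegral_mono' measurableSet_Ioc fun s hs => ?_
        rw [← ofReal_norm, ← ofReal_norm, ← ENNReal.ofReal_mul (by positivity),
          ← ENNReal.ofReal_mul (by positivity)]
        refine ENNReal.ofReal_le_ofReal ?_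
        have h2 : (D r * D e) (T s (g s)) = (D r * D (e + s)) (g s) := by
          rw [h.deriv_add' he hs.1]
          rfl
        rw [h2, norm_smul, Complex.norm_real, Real.norm_of_nonneg hr.le]
        have h3 := h.norm_deriv_mul_deriv_le hr (add_pos he hs.1)
        have hs0 := hs.1
        calc r * ‖(D r * D (e + s)) (g s)‖ ≤ r * (4 * M ^ 2 / (r + (e + s)) ^ 2 * ‖g s‖) := by
              gcongr
              exact (D r * D (e + s)).le_of_opNorm_le h3 _
          _ ≤ r * (4 * M ^ 2 / (r + s) ^ 2 * ‖g s‖) := by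
              -- Dropping e from the denominator is what makes the final bound uniform in e.
              gcongr
              linarith
          _ = _ := by ring
    _ = ENNReal.ofReal (4 * M ^ 2) * ∫⁻ s in Ioc 0 l, ENNReal.ofReal (r / (r + s) ^ 2) * ‖g s‖ₑ :=
        lintegral_const_mul' _ _ ENNReal.ofReal_ne_top
    _ ≤ ENNReal.ofReal (4 * M ^ 2) * ∫⁻ s in Ioi 0, ENNReal.ofReal (r / (r + s) ^ 2) * φ s := by
        refine mul_le_mul' le_rfl ?_
        rw [← lintegral_indicator measurableSet_Ioc, ← lintegral_indicator measurableSet_Ioi]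
        refine lintegral_mono fun s => ?_
        by_cases hs : s ∈ Ioc 0 l
        · rw [indicator_of_mem hs, indicator_of_mem (mem_Ioi.2 hs.1)]
          simp only [φ, indicator_of_mem hs]
          exact le_rfl
        · rw [indicator_of_notMem hs]
          exact zero_le
    _ ≤ _ := by
        gcongr
        exact lintegral_div_sq_mul_le hφm hφ hr

/-- This says A ∫₀ᵗ T(s) x ds = x - T(t) x. The integral starts at 0, where A T(s) x need not be
integrable, so the formula for vectors in the range of J is used and J is commuted past T. -/
theorem integral_apply_eq_oneAddInv [CompleteSpace X] (h : IsAnalyticGenerator A T D M) {t : ℝ}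
    (ht : 0 < t) (x : X) : ∫ s in (0 : ℝ)..t, T s x =
      oneAddInv A 1 ((∫ s in (0 : ℝ)..t, T s x) + (x - T t x)) := by
  have hi : ∀ y : X, IntervalIntegrable (fun s => T s y) volume 0 t := fun y => by
    have := (h.intervalIntegrable_mild ht.le (f := fun _ => y)
      intervalIntegrable_const).comp_sub_left t
    simp only [sub_zero, sub_self, sub_sub_cancel] at this
    exact this.symm
  have h1 := h.integral_apply_one_sub ht x
  simp only [map_sub] at h1
  rw [intervalIntegral.integral_sub (hi x) (hi _)] at h1
  have h2 : ∫ s in (0 : ℝ)..t, T s (oneAddInv A 1 x) = oneAddInv A 1 (∫ s in (0 : ℝ)..t, T s x) := by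
    rw [← ContinuousLinearMap.intervalIntegral_comp_comm _ (hi x),
      intervalIntegral.integral_of_le ht.le, intervalIntegral.integral_of_le ht.le]
    exact setIntegral_congr_fun measurableSet_Ioc fun s hs =>
      DFunLike.congr_fun (h.comm_oneAddInv one_pos hs.1) x
  have h3 : T t (oneAddInv A 1 x) = oneAddInv A 1 (T t x) :=
    DFunLike.congr_fun (h.comm_oneAddInv one_pos ht) x
  rw [h2, h3, sub_eq_iff_eq_add] at h1
  rw [map_add, map_sub]
  nth_rw 1 [h1]
  abel

/-- The convergence of `A T(e) v` as `e → 0` for `v = ∫₀^t T(s) g(s) ds`, when `0` is a Lebesgue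
point of `g` with `g(0) = 0`. -/
theorem cauchySeq_deriv_integral [CompleteSpace X] (h : IsAnalyticGenerator A T D M) {C : ℝ≥0}
    (hC : ∀ (e : ℝ) (z : X) (b : ℝ≥0∞), 0 < e →
      (∀ r : ℝ, 0 < r → ‖(r : ℂ) • D r (D e z)‖ₑ ≤ b) → ‖D e z‖ₑ ≤ C * b)
    {g : ℝ → X} {t : ℝ} (ht : 0 < t) (hg : IntegrableOn g (Ioc 0 t))
    (hleb : ∀ η : ℝ, 0 < η → ∃ r₀, 0 < r₀ ∧ ∀ r, 0 < r → r ≤ r₀ →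
      ∫⁻ s in Ioc 0 r, ‖g s‖ₑ ≤ ENNReal.ofReal (η * r))
    {e : ℕ → ℝ} (he : ∀ n, 0 < e n) (he0 : Tendsto e atTop (𝓝 0)) :
    CauchySeq fun n => D (e n) (∫ s in Ioc 0 t, T s (g s)) := by
  have hTg : IntegrableOn (fun s => T s (g s)) (Ioc 0 t) := by
    refine (hg.norm.const_mul M).mono' (AEStronglyMeasurable.clm_apply_complex ?_ hg.1) ?_
    · exact (h.continuousOn.mono fun s hs => hs.1).aestronglyMeasurable measurableSet_Ioc
    · filter_upwards [ae_restrict_mem measurableSet_Ioc] with s hs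
      exact (T s).le_of_opNorm_le (h.norm_le _ hs.1) _
  rw [Metric.cauchySeq_iff]
  intro κ hκ
  -- B exceeds the constant in `enorm_deriv_integral_le`, so an average of ‖g‖ below κ/(3B) makes
  -- the part of the integral near 0 contribute at most κ/3.
  set B : ℝ := C * (4 * M ^ 2 * 2) + 1 with hB
  have hB0 : 0 < B := by positivity
  obtain ⟨r₀, hr₀, hr⟩ := hleb (κ / (3 * B)) (by positivity)
  set l := min r₀ (t / 2)
  have hl : 0 < l := by positivity
  have hlt : l < t := (min_le_right _ _).trans_lt (half_lt_self ht)
  set v₁ := ∫ s in Ioc 0 l, T s (g s) with hv₁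
  -- Removing a factor T(l/2) from the part away from 0 leaves D(e) T(l/2) = D(e + l/2), which
  -- converges as e → 0.
  set z := ∫ s in Ioc l t, T (s - l / 2) (g s) with hz
  have hsplit : ∫ s in Ioc 0 t, T s (g s) = v₁ + T (l / 2) z := by
    rw [← Ioc_union_Ioc_eq_Ioc hl.le hlt.le, setIntegral_union (Ioc_disjoint_Ioc_of_le le_rfl)
      measurableSet_Ioc (hTg.mono_set (Ioc_subset_Ioc_right hlt.le))
      (hTg.mono_set (Ioc_subset_Ioc_left hl.le)), hz, ← ContinuousLinearMap.integral_comp_comm]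
    · congr 1
      refine setIntegral_congr_fun measurableSet_Ioc fun s hs => ?_
      rw [← mul_apply_eq_comp, ← h.add _ _ (half_pos hl) (by linarith [hs.1])]
      ring_nf
    · have hg' := hg.mono_set (Ioc_subset_Ioc_left (b := t) hl.le)
      refine (hg'.norm.const_mul M).mono' (AEStronglyMeasurable.clm_apply_complex ?_ hg'.1) ?_
      · refine (h.continuousOn.comp (by fun_prop) fun s hs => ?_).aestronglyMeasurable
          measurableSet_Ioc
        exact mem_Ioi.2 (by linarith [hs.1])
      · filter_upwards [ae_restrict_mem measurableSet_Ioc] with s hs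
        exact (T _).le_of_opNorm_le (h.norm_le _ (by linarith [hs.1])) _
  have hsmall : ∀ n, ‖D (e n) v₁‖ ≤ κ / 3 := by
    intro n
    have h1 := h.enorm_deriv_integral_le hC (hTg.mono_set (Ioc_subset_Ioc_right hlt.le))
      (hg.mono_set (Ioc_subset_Ioc_right hlt.le)).1 (δ := ENNReal.ofReal (κ / (3 * B)))
      (fun τ hτ hτl => by
        rw [← ENNReal.ofReal_mul (by positivity)]
        exact hr τ hτ (hτl.trans (min_le_left _ _))) (he n)
    have h2 : (C : ℝ≥0∞) * (ENNReal.ofReal (4 * M ^ 2) * (2 * ENNReal.ofReal (κ / (3 * B)))) =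
        ENNReal.ofReal (C * (4 * M ^ 2 * (2 * (κ / (3 * B))))) := by
      rw [ENNReal.ofReal_mul C.coe_nonneg, ENNReal.ofReal_mul (p := 4 * M ^ 2) (by positivity),
        ENNReal.ofReal_mul (p := 2) (by norm_num), ENNReal.ofReal_coe_nnreal, ENNReal.ofReal_ofNat]
    rw [h2, ← ofReal_norm, ENNReal.ofReal_le_ofReal_iff (by positivity)] at h1
    refine h1.trans ?_
    have h3 : C * (4 * M ^ 2 * (2 * (κ / (3 * B)))) = (B - 1) / B * (κ / 3) := by
      rw [hB]
      field_simp
      ring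
    rw [h3]
    have h4 : (B - 1) / B ≤ 1 := by
      rw [div_le_one hB0]
      linarith
    exact mul_le_of_le_one_left (by positivity) h4
  have hconv : CauchySeq fun n => D (e n) (T (l / 2) z) := by
    have h1 : Tendsto (fun n => e n + l / 2) atTop (𝓝 (l / 2)) := by
      simpa using he0.add_const (l / 2)
    have h2 := ((h.hasDerivAt_deriv (half_pos hl)).clm_apply_const z).continuousAt.tendsto.comp h1
    refine (h2.congr fun n => ?_).cauchySeq
    rw [← mul_apply_eq_comp, ← h.deriv_add' (he n) (half_pos hl)]
    rfl
  obtain ⟨N, hN⟩ := Metric.cauchySeq_iff.1 hconv (κ / 3) (by positivity)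
  refine ⟨N, fun m hm n hn => ?_⟩
  have h1 := hN m hm n hn
  rw [dist_eq_norm] at h1 ⊢
  rw [hsplit, map_add, map_add]
  calc ‖D (e m) v₁ + D (e m) (T (l / 2) z) - (D (e n) v₁ + D (e n) (T (l / 2) z))‖
      = ‖D (e m) v₁ - D (e n) v₁ + (D (e m) (T (l / 2) z) - D (e n) (T (l / 2) z))‖ := by
        congr 1
        abel
    _ ≤ ‖D (e m) v₁‖ + ‖D (e n) v₁‖ + ‖D (e m) (T (l / 2) z) - D (e n) (T (l / 2) z)‖ :=
        (norm_add_le _ _).trans (add_le_add_left (norm_sub_le _ _) _)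
    _ < κ / 3 + κ / 3 + κ / 3 := by
        have := hsmall m
        have := hsmall n
        linarith
    _ = κ := by ring

/-- The identity T(e) v = J(T(e) v) + J(D(e) v) forces T(e_n) v to converge to J v + J y, although
T(e_n) v → v is not known beforehand. Applying J and comparing with J T(e_n) v = T(e_n) J v → J v
gives the claim by injectivity. -/
theorem eq_oneAddInv_of_tendsto (h : IsAnalyticGenerator A T D M) {e : ℕ → ℝ} (he : ∀ n, 0 < e n)
    (he0 : Tendsto e atTop (𝓝 0)) {v y : X} (hy : Tendsto (fun n => D (e n) v) atTop (𝓝 y)) :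
    v = oneAddInv A 1 (v + y) := by
  set J := oneAddInv A 1
  have he' : Tendsto e atTop (𝓝[>] 0) := tendsto_nhdsWithin_iff.2 ⟨he0, Eventually.of_forall he⟩
  have h1 : Tendsto (fun n => J (T (e n) v)) atTop (𝓝 (J v)) := by
    refine ((h.tendsto_oneAddInv one_pos v).comp he').congr fun n => ?_
    exact DFunLike.congr_fun (h.comm_oneAddInv one_pos (he n)) v
  have h2 : Tendsto (fun n => T (e n) v) atTop (𝓝 (J v + J y)) := by
    refine (h1.add ((J.continuous.tendsto y).comp hy)).congr fun n => ?_
    rw [Function.comp_apply, ← map_add]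
    exact (h.apply_eq (he n) v).symm
  rw [map_add]
  exact h.oneAddInv_injective one_pos (tendsto_nhds_unique h1 ((J.continuous.tendsto _).comp h2))

/-- At a Lebesgue point t, u(t) = v + S with v = ∫ T(s)(f(t - s) - f(t)) ds and S = ∫ T(s) f(t) ds.
A S is explicit, and A v is the limit of D(e_n) v, bounded by a multiple of sup ‖f‖. -/
theorem hasMaximalRegularity_top_of_derivSupCondition [CompleteSpace X]
    (h : IsAnalyticGenerator A T D M) (hE : DerivSupCondition T D) :
    HasMaximalRegularity A ∞ := by
  obtain ⟨C, hC⟩ := h.norm_deriv_le_of_derivSupCondition hE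
  rw [h.hasMaximalRegularity_iff le_top]
  intro f₀ hf₀
  set μ := volume.restrict (Ioi (0 : ℝ)) with hμ
  set f : ℝ → X := (Ioi (0 : ℝ)).indicator f₀ with hf
  have hff₀ : ∀ᵐ t ∂μ, f t = f₀ t := by
    filter_upwards [ae_restrict_mem measurableSet_Ioi] with t ht
    exact indicator_of_mem ht f₀
  have hfm : MemLp f ∞ volume := (memLp_indicator_iff_restrict measurableSet_Ioi).2 hf₀
  obtain ⟨B, hB0, hB⟩ : ∃ B : ℝ, 0 ≤ B ∧ ∀ᵐ t, ‖f t‖ ≤ B := by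
    refine ⟨(eLpNorm f ∞ volume).toReal, ENNReal.toReal_nonneg, ?_⟩
    filter_upwards [ae_le_eLpNormEssSup (f := f)] with t ht
    have := ENNReal.toReal_mono hfm.2.ne ht
    rwa [toReal_enorm] at this
  have hloc : LocallyIntegrable f volume := hfm.locallyIntegrable le_top
  have hfi : ∀ t, 0 ≤ t → IntervalIntegrable f volume 0 t := fun t _ =>
    (hloc.integrableOn_isCompact isCompact_uIcc).intervalIntegrable
  set e : ℕ → ℝ := fun n => 1 / ((n : ℝ) + 1)
  have he : ∀ n, 0 < e n := fun n => by positivity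
  have he0 : Tendsto e atTop (𝓝 0) := tendsto_one_div_add_atTop_nhds_zero_nat
  -- These functions are measurable and converge to A u, which gives measurability of the limit. The
  -- term D(e_n) S = T(e_n)(f(t) - T(t) f(t)) may fail to converge without continuity of T at 0, so
  -- it is exchanged for A S itself.
  set q : ℕ → ℝ → X := fun n t => D (e n) (mildSolution T f t) - T (e n) (f t - T t (f t)) +
    (f t - T t (f t)) with hq
  have hqm : ∀ n, AEStronglyMeasurable (q n) μ := by
    intro n
    have h1 : AEStronglyMeasurable (mildSolution T f) μ :=
      ((h.continuousOn_mildSolution hfi).mono Ioi_subset_Ici_self).aestronglyMeasurable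
        measurableSet_Ioi
    have h2 : AEStronglyMeasurable f μ := hfm.1.mono_measure Measure.restrict_le_self
    have h3 : AEStronglyMeasurable (fun t => T t (f t)) μ :=
      AEStronglyMeasurable.clm_apply_complex
        (h.continuousOn.aestronglyMeasurable measurableSet_Ioi) h2
    exact (((D (e n)).continuous.comp_aestronglyMeasurable h1).sub
      ((T (e n)).continuous.comp_aestronglyMeasurable (h2.sub h3))).add (h2.sub h3)
  set K : ℝ := C * (4 * M ^ 2 * (2 * (2 * B))) + (B + M * B) with hK
  have hM0 := h.pos
  have key : ∀ᵐ t ∂μ, ∃ w, Tendsto (fun n => q n t) atTop (𝓝 w) ∧ ‖w‖ ≤ K ∧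
      mildSolution T f t = oneAddInv A 1 (mildSolution T f t + w) := by
    filter_upwards [ae_restrict_of_ae (ae_lebesgue_left hloc), ae_restrict_of_ae hB,
      ae_restrict_mem measurableSet_Ioi] with t hleb hBt ht0
    rw [mem_Ioi] at ht0
    set g : ℝ → X := fun s => f (t - s) - f t with hg
    have hfts : IntegrableOn (fun s => f (t - s)) (Ioc 0 t) := by
      have := (hfi t ht0.le).comp_sub_left t
      rw [sub_zero, sub_self] at this
      rw [← intervalIntegrable_iff_integrableOn_Ioc_of_le ht0.le]
      exact this.symm
    have hgi : IntegrableOn g (Ioc 0 t) := hfts.sub (integrableOn_const measure_Ioc_lt_top.ne)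
    have hTI : ∀ {k : ℝ → X}, IntegrableOn k (Ioc 0 t) →
        IntegrableOn (fun s => T s (k s)) (Ioc 0 t) := by
      intro k hk
      refine (hk.norm.const_mul M).mono' (AEStronglyMeasurable.clm_apply_complex ?_ hk.1) ?_
      · exact (h.continuousOn.mono fun s hs => hs.1).aestronglyMeasurable measurableSet_Ioc
      · filter_upwards [ae_restrict_mem measurableSet_Ioc] with s hs
        exact (T s).le_of_opNorm_le (h.norm_le _ hs.1) _
    set v := ∫ s in Ioc 0 t, T s (g s) with hv
    set S := ∫ s in (0 : ℝ)..t, T s (f t) with hS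
    have hmild : mildSolution T f t = v + S := by
      have h1 := intervalIntegral.integral_comp_sub_left (fun s => T s (f (t - s))) t
        (a := 0) (b := t)
      simp only [sub_sub_cancel, sub_self, sub_zero] at h1
      rw [mildSolution, h1, hv, hS, intervalIntegral.integral_of_le ht0.le,
        intervalIntegral.integral_of_le ht0.le, ← integral_add (hTI hgi)
        (hTI (integrableOn_const measure_Ioc_lt_top.ne))]
      refine setIntegral_congr_fun measurableSet_Ioc fun s _ => ?_
      simp only [hg]
      rw [← map_add, sub_add_cancel]
    obtain ⟨y, hy⟩ := cauchySeq_tendsto_of_complete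
      (h.cauchySeq_deriv_integral hC ht0 hgi hleb he he0)
    have hvy := h.eq_oneAddInv_of_tendsto he he0 hy
    have hSe := h.integral_apply_eq_oneAddInv ht0 (f t)
    rw [← hS] at hSe
    have hDS : ∀ n, D (e n) S = T (e n) (f t - T t (f t)) := by
      intro n
      obtain ⟨hS1, hS2⟩ := h.mem_domain_iff.2 hSe
      rw [← hS2]
      exact (h.apply_map (e n) (he n) ⟨S, hS1⟩).symm
    refine ⟨y + (f t - T t (f t)), ?_, ?_, ?_⟩
    · refine (hy.add_const (f t - T t (f t))).congr fun n => ?_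
      simp only [hq]
      rw [hmild, map_add, hDS, add_sub_cancel_right]
    · have hyn : ‖y‖ ≤ C * (4 * M ^ 2 * (2 * (2 * B))) := by
        refine le_of_tendsto hy.norm (Eventually.of_forall fun n => ?_)
        have h1 := h.enorm_deriv_integral_le hC (hTI hgi) hgi.1 (δ := ENNReal.ofReal (2 * B))
          (fun τ hτ _ => by
            -- A bound on g itself bounds all its averages, so the averaged estimate applies with δ
            -- = 2B.
            have h2 : ∀ᵐ s ∂volume.restrict (Ioc 0 τ), ‖g s‖ₑ ≤ ENNReal.ofReal (2 * B) := by
              refine ae_restrict_of_ae ?_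
              filter_upwards [(Measure.measurePreserving_sub_left volume t).quasiMeasurePreserving.ae
                hB] with s hs
              rw [← ofReal_norm]
              refine ENNReal.ofReal_le_ofReal ((norm_sub_le _ _).trans ?_)
              linarith
            refine (lintegral_mono_ae h2).trans ?_
            simp) (he n)
        have h2 : (C : ℝ≥0∞) * (ENNReal.ofReal (4 * M ^ 2) * (2 * ENNReal.ofReal (2 * B))) =
            ENNReal.ofReal (C * (4 * M ^ 2 * (2 * (2 * B)))) := by
          rw [ENNReal.ofReal_mul C.coe_nonneg, ENNReal.ofReal_mul (p := 4 * M ^ 2) (by positivity),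
            ENNReal.ofReal_mul (p := 2) (q := 2 * B) (by norm_num), ENNReal.ofReal_coe_nnreal,
            ENNReal.ofReal_ofNat]
        rwa [h2, ← ofReal_norm, ENNReal.ofReal_le_ofReal_iff (by positivity)] at h1
      have h3 : ‖T t (f t)‖ ≤ M * B := ((T t).le_of_opNorm_le (h.norm_le _ ht0) _).trans (by gcongr)
      exact (norm_add_le _ _).trans (add_le_add hyn ((norm_sub_le _ _).trans (add_le_add hBt h3)))
    · rw [hmild]
      have h1 := congrArg₂ (· + ·) hvy hSe
      simp only [← map_add] at h1
      refine h1.trans (congrArg _ ?_)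
      rw [← hv]
      abel
  obtain ⟨w, hwm, hw⟩ := exists_stronglyMeasurable_limit_of_tendsto_ae hqm
    (key.mono fun t ⟨w, hw, _⟩ => ⟨w, hw⟩)
  have hfinal : ∀ᵐ t ∂μ, ‖w t‖ ≤ K ∧
      mildSolution T f t = oneAddInv A 1 (mildSolution T f t + w t) := by
    filter_upwards [hw, key] with t h1 ⟨w', h2, h3⟩
    rwa [tendsto_nhds_unique h1 h2]
  refine ⟨w, memLp_top_of_bound hwm.aestronglyMeasurable K (hfinal.mono fun t ht => ht.1), ?_⟩
  filter_upwards [hfinal, ae_restrict_mem measurableSet_Ioi] with t ht ht0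
  rw [← mildSolution_congr T hff₀ (le_of_lt ht0)]
  exact ht.2

end IsAnalyticGenerator

end MaximalRegularityTop

/-! ### Contour shifts in strips, and the logistic function -/

section Strip

/-- Contour shift in a closed strip for a function with limits at both ends. -/
theorem tendsto_intervalIntegral_sub_of_strip {E : Type*} [NormedAddCommGroup E] [NormedSpace ℂ E]
    [CompleteSpace E] {G : ℂ → E} {a b : ℝ} (hab : a ≤ b)
    (hG : DifferentiableOn ℂ G (Complex.im ⁻¹' Icc a b)) {L L' : E}
    (hL : Tendsto G (comap Complex.re atBot ⊓ 𝓟 (Complex.im ⁻¹' Icc a b)) (𝓝 L))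
    (hL' : Tendsto G (comap Complex.re atTop ⊓ 𝓟 (Complex.im ⁻¹' Icc a b)) (𝓝 L')) :
    Tendsto (fun N : ℝ => ∫ s in -N..N, (G (s + a * Complex.I) - G (s + b * Complex.I))) atTop
      (𝓝 ((Complex.I * (b - a)) • (L - L'))) := by
  have hmem : ∀ (s : ℝ) {y : ℝ}, y ∈ Icc a b → (s + y * Complex.I : ℂ) ∈ Complex.im ⁻¹' Icc a b := by
    intro s y hy
    simpa using hy
  have hcont : ∀ {y : ℝ}, y ∈ Icc a b → Continuous fun s : ℝ => G (s + y * Complex.I) := by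
    intro y hy
    exact hG.continuousOn.comp_continuous (by fun_prop) fun s => hmem s hy
  -- Cauchy's theorem on a rectangle. The vertical sides do not vanish as N → ∞: each tends to b - a
  -- times the limit of G at that end.
  have hrect : ∀ N : ℝ, 0 ≤ N → ∫ s in -N..N, (G (s + a * Complex.I) - G (s + b * Complex.I)) =
      Complex.I • ((∫ y in a..b, G ((-N : ℝ) + y * Complex.I)) -
        ∫ y in a..b, G (N + y * Complex.I)) := by
    intro N hN
    have hsub : (uIcc (-N : ℝ) N ×ℂ uIcc a b) ⊆ Complex.im ⁻¹' Icc a b := by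
      rintro z ⟨-, hz⟩
      rwa [uIcc_of_le hab] at hz
    have h := Complex.integral_boundary_rect_eq_zero_of_differentiableOn G
      ((-N : ℝ) + a * Complex.I) ((N : ℝ) + b * Complex.I) (by
        refine hG.mono ?_
        simpa using hsub)
    simp only [Complex.add_re, Complex.add_im, Complex.ofReal_re, Complex.ofReal_im,
      Complex.mul_re, Complex.mul_im, Complex.I_re, Complex.I_im, mul_zero, mul_one, sub_zero,
      add_zero, zero_add] at h
    rw [intervalIntegral.integral_sub ((hcont (left_mem_Icc.2 hab)).intervalIntegrable _ _)
      ((hcont (right_mem_Icc.2 hab)).intervalIntegrable _ _), smul_sub]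
    rw [sub_eq_zero, ← eq_sub_iff_add_eq] at h
    exact h
  have hside : ∀ (l : Filter ℝ) (u : ℝ → ℝ) (L : E), Tendsto u atTop l →
      Tendsto G (comap Complex.re l ⊓ 𝓟 (Complex.im ⁻¹' Icc a b)) (𝓝 L) →
      Tendsto (fun N : ℝ => ∫ y in a..b, G (u N + y * Complex.I)) atTop
        (𝓝 (((b - a : ℝ) : ℂ) • L)) := by
    intro l u L hu hGL
    have h1 : (((b - a : ℝ) : ℂ) • L) = ∫ _ in a..b, L := by
      rw [intervalIntegral.integral_const, Complex.coe_smul]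
    rw [h1, tendsto_iff_norm_sub_tendsto_zero, Metric.tendsto_nhds]
    intro ε hε
    have hε' : 0 < ε / (b - a + 1) := div_pos hε (by linarith)
    have h2 := Metric.tendsto_nhds.1 hGL _ hε'
    rw [eventually_inf_principal, eventually_comap] at h2
    filter_upwards [hu.eventually h2] with N hN
    have hc : Continuous fun y : ℝ => (u N + y * Complex.I : ℂ) := by fun_prop
    have hci : IntervalIntegrable (fun y : ℝ => G (u N + y * Complex.I)) volume a b := by
      refine ContinuousOn.intervalIntegrable ?_
      rw [uIcc_of_le hab]
      exact hG.continuousOn.comp hc.continuousOn fun y hy => hmem _ hy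
    rw [← intervalIntegral.integral_sub hci intervalIntegrable_const, dist_zero_right, norm_norm]
    have h3 := intervalIntegral.norm_integral_le_of_norm_le_const (a := a) (b := b)
      (f := fun y : ℝ => G (u N + y * Complex.I) - L) (C := ε / (b - a + 1)) (by
        intro y hy
        rw [uIoc_of_le hab] at hy
        rw [← dist_eq_norm]
        exact (hN _ (by simp) (hmem _ ⟨hy.1.le, hy.2⟩)).le)
    refine h3.trans_lt ?_
    rw [abs_of_nonneg (sub_nonneg.2 hab), div_mul_eq_mul_div, div_lt_iff₀ (by linarith)]
    exact mul_lt_mul_of_pos_left (by linarith) hε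
  have h1 := hside atBot (fun N => -N) L tendsto_neg_atTop_atBot hL
  have h2 := hside atTop (fun N => N) L' tendsto_id hL'
  have h3 := (h1.sub h2).const_smul Complex.I
  rw [← smul_sub, smul_smul, Complex.ofReal_sub] at h3
  refine h3.congr' ?_
  filter_upwards [Ici_mem_atTop 0] with N hN
  exact (hrect N hN).symm

/-- A holomorphic function on the strip `|Im w| < ω` with exponential decay. -/
structure StripDecay (ω C δ : ℝ) (g : ℂ → ℂ) : Prop where
  pos : 0 < δ
  differentiableOn : DifferentiableOn ℂ g {w | |w.im| < ω}
  norm_le : ∀ w : ℂ, |w.im| < ω → ‖g w‖ ≤ C * Real.exp (-(δ * |w.re|))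

theorem integral_exp_neg_mul_abs {δ : ℝ} (hδ : 0 < δ) :
    ∫ s : ℝ, Real.exp (-(δ * |s|)) = 2 / δ := by
  rw [integral_comp_abs (f := fun s => Real.exp (-(δ * s)))]
  simp only [← neg_mul]
  rw [integral_exp_mul_Ioi (neg_neg_iff_pos.2 hδ)]
  simp [div_eq_mul_inv]

theorem integrable_exp_neg_mul_abs {δ : ℝ} (hδ : 0 < δ) :
    Integrable fun s : ℝ => Real.exp (-(δ * |s|)) :=
  -- A non-integrable function has Bochner integral 0 by convention, so a nonzero value proves
  -- integrability.
  Integrable.of_integral_ne_zero (by rw [integral_exp_neg_mul_abs hδ]; positivity)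

namespace StripDecay

variable {ω C δ : ℝ} {g : ℂ → ℂ}

theorem tendsto_zero (hg : StripDecay ω C δ g) {l : Filter ℝ} (hl : Tendsto (fun x : ℝ => |x|) l atTop)
    {s : Set ℝ} (hs : ∀ y ∈ s, |y| < ω) :
    Tendsto g (comap Complex.re l ⊓ 𝓟 (Complex.im ⁻¹' s)) (𝓝 0) := by
  have h1 : Tendsto (fun x : ℝ => C * Real.exp (-(δ * |x|))) l (𝓝 (C * 0)) :=
    ((Real.tendsto_exp_neg_atTop_nhds_zero.comp (hl.const_mul_atTop hg.pos))).const_mul C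
  rw [mul_zero] at h1
  refine squeeze_zero_norm' ?_ ((h1.comp tendsto_comap).mono_left inf_le_left)
  filter_upwards [mem_inf_of_right (mem_principal_self _)] with w hw
  exact hg.norm_le w (hs _ hw)

theorem continuous_line (hg : StripDecay ω C δ g) {y : ℝ} (hy : |y| < ω) :
    Continuous fun s : ℝ => g (s + y * Complex.I) :=
  hg.differentiableOn.continuousOn.comp_continuous (by fun_prop) fun s => by simpa using hy

theorem norm_line_le (hg : StripDecay ω C δ g) {y : ℝ} (hy : |y| < ω) (s : ℝ) :
    ‖g (s + y * Complex.I)‖ ≤ C * Real.exp (-(δ * |s|)) := by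
  simpa using hg.norm_le (s + y * Complex.I) (by simpa using hy)

theorem integrable_line (hg : StripDecay ω C δ g) {y : ℝ} (hy : |y| < ω) :
    Integrable fun s : ℝ => g (s + y * Complex.I) :=
  ((integrable_exp_neg_mul_abs hg.pos).const_mul C).mono'
    (hg.continuous_line hy).aestronglyMeasurable (Eventually.of_forall (hg.norm_line_le hy))

/-- The integral over horizontal lines does not depend on the line. -/
theorem integral_line_eq (hg : StripDecay ω C δ g) {a b : ℝ} (ha : |a| < ω) (hb : |b| < ω) :
    ∫ s : ℝ, g (s + a * Complex.I) = ∫ s : ℝ, g (s + b * Complex.I) := by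
  wlog hab : a ≤ b generalizing a b
  · exact (this hb ha (le_of_not_ge hab)).symm
  have hs : ∀ y ∈ Icc a b, |y| < ω := fun y hy => by
    rw [abs_lt] at *
    exact ⟨ha.1.trans_le hy.1, hy.2.trans_lt hb.2⟩
  have h1 := tendsto_intervalIntegral_sub_of_strip hab
    (hg.differentiableOn.mono fun w hw => hs _ hw) (hg.tendsto_zero tendsto_abs_atBot_atTop hs)
    (hg.tendsto_zero tendsto_abs_atTop_atTop hs)
  have h2 := intervalIntegral_tendsto_integral
    ((hg.integrable_line ha).sub (hg.integrable_line hb)) tendsto_neg_atTop_atBot tendsto_id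
  have h3 := tendsto_nhds_unique h2 h1
  rw [sub_zero, smul_zero, integral_sub' (hg.integrable_line ha) (hg.integrable_line hb)] at h3
  exact sub_eq_zero.1 h3

theorem mul_bounded (hg : StripDecay ω C δ g) {b : ℂ → ℂ}
    (hb : DifferentiableOn ℂ b {w | |w.im| < ω}) {B : ℝ} (hB : ∀ w : ℂ, |w.im| < ω → ‖b w‖ ≤ B) :
    StripDecay ω (B * C) δ fun w => b w * g w where
  pos := hg.pos
  differentiableOn := hb.mul hg.differentiableOn
  norm_le w hw := by
    rw [norm_mul, mul_assoc]
    exact mul_le_mul (hB w hw) (hg.norm_le w hw) (norm_nonneg _)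
      ((norm_nonneg _).trans (hB w hw))

theorem nonneg (hg : StripDecay ω C δ g) (hω : 0 < ω) : 0 ≤ C := by
  have := (norm_nonneg _).trans (hg.norm_le 0 (by simpa using hω))
  simpa using this

/-- The factor e^{δ|τ|} is not uniform in τ; this form serves only for convergence of integrals at
fixed τ, while uniform bounds come from `exists_norm_logCalc_mul_le`. -/
theorem comp_add (hg : StripDecay ω C δ g) (hω : 0 < ω) (τ : ℝ) :
    StripDecay ω (C * Real.exp (δ * |τ|)) δ fun w => g (w + τ) where
  pos := hg.pos
  differentiableOn := hg.differentiableOn.comp (by fun_prop) fun w hw => by simpa using hw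
  norm_le w hw := by
    refine (hg.norm_le (w + τ) (by simpa using hw)).trans ?_
    have := hg.nonneg hω
    rw [mul_assoc, ← Real.exp_add]
    gcongr
    have h1 := abs_sub_abs_le_abs_sub w.re (-τ)
    rw [sub_neg_eq_add, abs_neg] at h1
    simp only [Complex.add_re, Complex.ofReal_re]
    nlinarith [hg.pos]

end StripDecay

/-- The function `(1 + e^w)⁻¹`. -/
def logistic (w : ℂ) : ℂ := (1 + Complex.exp w)⁻¹

theorem one_le_norm_one_add_exp {w : ℂ} (hw : |w.im| < Real.pi / 2) :
    1 ≤ ‖1 + Complex.exp w‖ ∧ Real.exp w.re ≤ ‖1 + Complex.exp w‖ := by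
  have h1 : 0 ≤ Real.cos w.im := Real.cos_nonneg_of_mem_Icc
    ⟨by linarith [(abs_lt.1 hw).1], by linarith [(abs_lt.1 hw).2]⟩
  constructor
  · refine le_trans ?_ (Complex.re_le_norm _)
    rw [Complex.add_re, Complex.one_re, Complex.exp_re]
    have := Real.exp_pos w.re
    nlinarith [mul_nonneg this.le h1]
  · rw [← sq_le_sq₀ (Real.exp_pos _).le (norm_nonneg _), ← Complex.normSq_eq_norm_sq,
      Complex.normSq_apply]
    simp only [Complex.add_re, Complex.one_re, Complex.exp_re, Complex.add_im, Complex.one_im,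
      Complex.exp_im, zero_add]
    nlinarith [mul_nonneg (Real.exp_pos w.re).le h1, Real.sin_sq_add_cos_sq w.im,
      sq_nonneg (Real.exp w.re)]

theorem one_add_exp_ne_zero {w : ℂ} (hw : |w.im| < Real.pi / 2) : 1 + Complex.exp w ≠ 0 :=
  norm_pos_iff.1 (one_pos.trans_le (one_le_norm_one_add_exp hw).1)

theorem one_sub_logistic {w : ℂ} (hw : 1 + Complex.exp w ≠ 0) :
    1 - logistic w = Complex.exp w * logistic w := by
  rw [logistic]
  field_simp
  ring

theorem norm_logistic_le {w : ℂ} (hw : |w.im| < Real.pi / 2) :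
    ‖logistic w‖ ≤ 1 ∧ ‖logistic w‖ ≤ Real.exp (-w.re) := by
  obtain ⟨h1, h2⟩ := one_le_norm_one_add_exp hw
  rw [logistic, norm_inv, Real.exp_neg]
  exact ⟨inv_le_one_of_one_le₀ h1, inv_anti₀ (Real.exp_pos _) h2⟩

theorem norm_one_sub_logistic_le {w : ℂ} (hw : |w.im| < Real.pi / 2) :
    ‖1 - logistic w‖ ≤ 1 ∧ ‖1 - logistic w‖ ≤ Real.exp w.re := by
  obtain ⟨h1, h2⟩ := norm_logistic_le hw
  rw [one_sub_logistic (one_add_exp_ne_zero hw), norm_mul, Complex.norm_exp]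
  refine ⟨?_, mul_le_of_le_one_right (Real.exp_pos _).le h1⟩
  calc _ ≤ Real.exp w.re * Real.exp (-w.re) := by gcongr
    _ = 1 := by rw [← Real.exp_add, add_neg_cancel, Real.exp_zero]

theorem differentiableOn_logistic : DifferentiableOn ℂ logistic {w | |w.im| < Real.pi / 2} := by
  intro w hw
  unfold logistic
  have := one_add_exp_ne_zero hw
  exact DifferentiableAt.differentiableWithinAt (by fun_prop (disch := assumption))

/-- In z = e^w this is z^(k+1) (1 + z)^(-k-2), which decays like a power at both ends. -/
theorem stripDecay_logistic_mul (k : ℕ) : StripDecay (Real.pi / 2) 1 1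
    fun w => (1 - logistic w) ^ (k + 1) * logistic w where
  pos := one_pos
  differentiableOn := ((differentiableOn_logistic.const_sub 1).pow _).mul differentiableOn_logistic
  norm_le w hw := by
    obtain ⟨h1, h2⟩ := norm_logistic_le hw
    obtain ⟨h3, h4⟩ := norm_one_sub_logistic_le hw
    rw [one_mul, one_mul, norm_mul, norm_pow, pow_succ]
    have h5 : ‖1 - logistic w‖ ^ k ≤ 1 := pow_le_one₀ (norm_nonneg _) h3
    calc ‖1 - logistic w‖ ^ k * ‖1 - logistic w‖ * ‖logistic w‖
        ≤ 1 * ‖1 - logistic w‖ * ‖logistic w‖ := by gcongr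
      _ = ‖1 - logistic w‖ * ‖logistic w‖ := by rw [one_mul]
      _ ≤ Real.exp (-|w.re|) := by
        rcases le_total 0 w.re with h | h
        · rw [abs_of_nonneg h]
          exact (mul_le_of_le_one_left (norm_nonneg _) h3).trans h2
        · rw [abs_of_nonpos h, neg_neg]
          exact (mul_le_of_le_one_right (norm_nonneg _) h1).trans h4

theorem StripDecay.mono {ω ω' C δ : ℝ} {g : ℂ → ℂ} (hg : StripDecay ω C δ g) (h : ω' ≤ ω) :
    StripDecay ω' C δ g :=
  ⟨hg.pos, hg.differentiableOn.mono fun _ hw => lt_of_lt_of_le hw h,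
    fun w hw => hg.norm_le w (hw.trans_le h)⟩

theorem tendsto_logistic_atTop : Tendsto logistic (comap Complex.re atTop) (𝓝 0) := by
  unfold logistic
  refine tendsto_inv₀_cobounded.comp ?_
  refine tendsto_norm_atTop_iff_cobounded.1 ?_
  have h := tendsto_norm_atTop_iff_cobounded.2 Complex.tendsto_exp_comap_re_atTop
  refine tendsto_atTop_mono (fun w => ?_) (tendsto_atTop_add_const_right _ (-1) h)
  have := norm_sub_norm_le (Complex.exp w) (-1)
  rw [norm_neg, norm_one, sub_neg_eq_add, add_comm (Complex.exp w)] at this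
  linarith

theorem tendsto_logistic_atBot : Tendsto logistic (comap Complex.re atBot) (𝓝 1) := by
  have h := (Complex.tendsto_exp_comap_re_atBot.const_add 1).inv₀ (by simp)
  rw [add_zero, inv_one] at h
  exact h

end Strip

/-! ### Resolvents and the contour integral in logarithmic coordinates -/

section LogCalculus

variable {X : Type*} [NormedAddCommGroup X] [NormedSpace ℂ X]

/-- The complement of the closed sector of angle `φ` belongs to the resolvent set of `A`, with
`‖z R(z, A)‖ ≤ K`. -/
structure SectorBound (A : X →ₗ.[ℂ] X) (φ K : ℝ) : Prop where
  pos : 0 < φ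
  lt : φ < Real.pi / 2
  inResolventSet : ∀ z : ℂ, z ≠ 0 → φ < |Complex.arg z| → InResolventSet A z
  norm_le : ∀ z : ℂ, z ≠ 0 → φ < |Complex.arg z| → ‖zResolvent A z‖ ≤ K

/-- The operators `z R(z, A)` in the coordinate `w` with `z = e^w`. -/
def logResolvent (A : X →ₗ.[ℂ] X) (w : ℂ) : X →L[ℂ] X := zResolvent A (Complex.exp w)

/-- The contour integral `(2πi)⁻¹ ∫ g(log z) R(z, A) dz` in logarithmic coordinates. -/
def logCalc (A : X →ₗ.[ℂ] X) (ν : ℝ) (g : ℂ → ℂ) : X →L[ℂ] X :=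
  (2 * Real.pi * Complex.I : ℂ)⁻¹ • ∫ s : ℝ,
    (g (s + (-ν : ℝ) * Complex.I) • logResolvent A (s + (-ν : ℝ) * Complex.I) -
      g (s + (ν : ℝ) * Complex.I) • logResolvent A (s + (ν : ℝ) * Complex.I))

/-- The exponential maps the strip φ < Im w < 2π - φ to the complement of the closed sector, across
the negative axis. There the two boundary rays of the contour can be joined inside the resolvent
set. -/
theorem lt_abs_arg_exp {φ : ℝ} (hφ : 0 < φ) {w : ℂ} (h1 : φ < w.im) (h2 : w.im < 2 * Real.pi - φ) :
    φ < |Complex.arg (Complex.exp w)| := by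
  rcases le_or_gt w.im Real.pi with h | h
  · rw [← Complex.log_im, Complex.log_exp (by linarith [Real.pi_pos]) h]
    exact h1.trans_le (le_abs_self _)
  · have h3 : Complex.exp w = Complex.exp (w - 2 * Real.pi * Complex.I) := by
      rw [Complex.exp_periodic.sub_eq]
    have h4 : (w - 2 * Real.pi * Complex.I).im = w.im - 2 * Real.pi := by simp
    rw [h3, ← Complex.log_im, Complex.log_exp (by rw [h4]; linarith) (by rw [h4]; linarith), h4,
      abs_of_neg (by linarith)]
    linarith

theorem lt_abs_arg_exp_of_abs {φ : ℝ} {w : ℂ} (h1 : φ < |w.im|)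
    (h2 : |w.im| < Real.pi) : φ < |Complex.arg (Complex.exp w)| := by
  rw [← Complex.log_im, Complex.log_exp (abs_lt.1 h2).1 (abs_lt.1 h2).2.le]
  exact h1

namespace SectorBound

variable {A : X →ₗ.[ℂ] X} {φ K : ℝ}

theorem nonneg (h : SectorBound A φ K) : 0 ≤ K :=
  (norm_nonneg _).trans (h.norm_le (-1) (by simp) (by
    rw [Complex.arg_neg_one, abs_of_pos Real.pi_pos]; linarith [h.lt, Real.pi_pos]))

theorem norm_logResolvent_line_le (h : SectorBound A φ K) {y : ℝ} (hy : φ < |y|)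
    (hy' : |y| < Real.pi) (s : ℝ) : ‖logResolvent A (s + y * Complex.I)‖ ≤ K :=
  h.norm_le _ (Complex.exp_ne_zero _) (lt_abs_arg_exp_of_abs (by simpa using hy) (by simpa using hy'))

/-- The resolvent identity writes a difference of values as (e^v - e^w) times a bounded operator.
The bound K gives continuity, and continuity in turn gives the limit of the difference quotient. -/
theorem differentiableAt_logResolvent (h : SectorBound A φ K) {w : ℂ} (h1 : φ < w.im)
    (h2 : w.im < 2 * Real.pi - φ) : DifferentiableAt ℂ (logResolvent A) w := by
  set W := logResolvent A
  set z := Complex.exp w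
  have hz : z ≠ 0 := Complex.exp_ne_zero w
  have hopen : IsOpen (Complex.im ⁻¹' Ioo φ (2 * Real.pi - φ)) :=
    isOpen_Ioo.preimage Complex.continuous_im
  have hmem : Complex.im ⁻¹' Ioo φ (2 * Real.pi - φ) ∈ 𝓝 w := hopen.mem_nhds ⟨h1, h2⟩
  have hid : ∀ v ∈ Complex.im ⁻¹' Ioo φ (2 * Real.pi - φ),
      W v - W w = (Complex.exp v - z) • (z⁻¹ • (W w - W w * W v)) := by
    intro v hv
    have hr := sub_smul_zResolvent_mul
      (h.inResolventSet z hz (lt_abs_arg_exp h.pos h1 h2))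
      (h.inResolventSet _ (Complex.exp_ne_zero v) (lt_abs_arg_exp h.pos hv.1 hv.2))
    change (Complex.exp v - z) • (W w * W v) = Complex.exp v • W w - z • W v at hr
    refine smul_right_injective _ hz ?_
    simp only [smul_sub, smul_smul]
    rw [show z * ((Complex.exp v - z) * z⁻¹) = Complex.exp v - z by field_simp, hr]
    module
  have hbdd : ∀ v ∈ Complex.im ⁻¹' Ioo φ (2 * Real.pi - φ), ‖W v‖ ≤ K := fun v hv =>
    h.norm_le _ (Complex.exp_ne_zero v) (lt_abs_arg_exp h.pos hv.1 hv.2)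
  have hexp : Tendsto (fun v => Complex.exp v - z) (𝓝 w) (𝓝 0) := by
    have := (Complex.continuous_exp.tendsto w).sub_const z
    rwa [sub_self] at this
  have hc : Tendsto W (𝓝 w) (𝓝 (W w)) := by
    rw [tendsto_iff_norm_sub_tendsto_zero]
    have hlim : Tendsto (fun v => ‖Complex.exp v - z‖ * (‖z⁻¹‖ * (K + K * K))) (𝓝 w) (𝓝 0) := by
      simpa using hexp.norm.mul_const (‖z⁻¹‖ * (K + K * K))
    refine squeeze_zero' (Eventually.of_forall fun v => norm_nonneg _) ?_ hlim
    filter_upwards [hmem] with v hv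
    rw [hid v hv, norm_smul, norm_smul]
    have h3 := hbdd v hv
    have h4 := hbdd w ⟨h1, h2⟩
    have := h.nonneg
    gcongr
    refine (norm_sub_le _ _).trans (add_le_add h4 ((norm_mul_le _ _).trans ?_))
    gcongr
  have hd : HasDerivAt W (z • z⁻¹ • (W w - W w * W w)) w := by
    rw [hasDerivAt_iff_tendsto_slope]
    have hs := (hasDerivAt_iff_tendsto_slope.1 (Complex.hasDerivAt_exp w))
    have hc' : Tendsto (fun v => z⁻¹ • (W w - W w * W v)) (𝓝[≠] w)
        (𝓝 (z⁻¹ • (W w - W w * W w))) :=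
      (((hc.const_mul (W w)).const_sub (W w)).const_smul z⁻¹).mono_left nhdsWithin_le_nhds
    refine (hs.smul hc').congr' ?_
    filter_upwards [nhdsWithin_le_nhds hmem] with v hv
    rw [slope_def_module, slope_def_module, hid v hv, smul_assoc]
  exact hd.differentiableAt

theorem logResolvent_add_two_pi (s y : ℝ) : logResolvent A (s + (2 * Real.pi - y : ℝ) * Complex.I) =
    logResolvent A (s + (-y : ℝ) * Complex.I) := by
  have : (s + (2 * Real.pi - y : ℝ) * Complex.I : ℂ) =
      (s + (-y : ℝ) * Complex.I) + 2 * Real.pi * Complex.I := by push_cast; ring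
  rw [logResolvent, this, Complex.exp_periodic, logResolvent]

theorem continuous_logResolvent_line (h : SectorBound A φ K) {y : ℝ} (hy : φ < |y|)
    (hy' : |y| < Real.pi) : Continuous fun s : ℝ => logResolvent A (s + y * Complex.I) := by
  have hpos : ∀ {y : ℝ}, φ < y → y < 2 * Real.pi - φ →
      Continuous fun s : ℝ => logResolvent A (s + y * Complex.I) := by
    intro y hy hy'
    rw [continuous_iff_continuousAt]
    intro s
    exact ContinuousAt.comp (f := fun s : ℝ => (s + y * Complex.I : ℂ))
      (h.differentiableAt_logResolvent (by simpa using hy) (by simpa using hy')).continuousAt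
      (by fun_prop)
  have := h.lt
  rcases lt_abs.1 hy with h1 | h1
  · exact hpos h1 (by linarith [(abs_lt.1 hy').2])
  · refine (hpos (y := 2 * Real.pi - -y) (by linarith [(abs_lt.1 hy').1]) (by linarith)).congr
      fun s => ?_
    rw [logResolvent_add_two_pi, neg_neg]

/-- The resolvent identity divided by 1 + tz: the coefficients 1/(1 + tz) and tz/(1 + tz) become l(w
+ τ) and 1 - l(w + τ). -/
theorem logResolvent_mul_oneAddInv (h : SectorBound A φ K) {w : ℂ}
    (hw : φ < |Complex.arg (Complex.exp w)|) (τ : ℝ) (hj : 1 + Complex.exp (w + τ) ≠ 0) :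
    logResolvent A w * oneAddInv A (Real.exp τ) = logistic (w + τ) • logResolvent A w +
      (1 - logistic (w + τ)) • oneAddInv A (Real.exp τ) := by
  have hτ : InResolventSet A (-((Real.exp τ : ℝ) : ℂ)⁻¹) := by
    refine h.inResolventSet _ (by simp) ?_
    have := h.lt
    rw [← Complex.ofReal_inv, ← Complex.ofReal_neg, Complex.arg_ofReal_of_neg (by
      rw [neg_lt_zero]; positivity), abs_of_pos Real.pi_pos]
    linarith [Real.pi_pos]
  have h1 := one_add_smul_zResolvent_mul_oneAddInv (Real.exp_pos τ)
    (h.inResolventSet _ (Complex.exp_ne_zero w) hw) hτ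
  have h2 : (Real.exp τ : ℂ) * Complex.exp w = Complex.exp (w + τ) := by
    rw [Complex.ofReal_exp, ← Complex.exp_add, add_comm]
  rw [h2] at h1
  have h3 := congrArg (fun S => logistic (w + τ) • S) h1
  simp only [smul_smul, smul_add] at h3
  rw [logistic, inv_mul_cancel₀ hj, one_smul, ← logistic, mul_comm (logistic _),
    ← one_sub_logistic hj] at h3
  exact h3

theorem oneAddInv_comm_logResolvent (h : SectorBound A φ K) {w : ℂ}
    (hw : φ < |Complex.arg (Complex.exp w)|) (τ : ℝ) :
    oneAddInv A (Real.exp τ) * logResolvent A w = logResolvent A w * oneAddInv A (Real.exp τ) := by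
  have hτ : InResolventSet A (-((Real.exp τ : ℝ) : ℂ)⁻¹) := by
    refine h.inResolventSet _ (by simp) ?_
    have := h.lt
    rw [← Complex.ofReal_inv, ← Complex.ofReal_neg, Complex.arg_ofReal_of_neg (by
      rw [neg_lt_zero]; positivity), abs_of_pos Real.pi_pos]
    linarith [Real.pi_pos]
  exact zResolvent_comm hτ (h.inResolventSet _ (Complex.exp_ne_zero w) hw)

variable {ν ω C δ : ℝ} {g : ℂ → ℂ}

theorem integrable_smul_logResolvent (h : SectorBound A φ K) (hg : StripDecay ω C δ g) {y : ℝ}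
    (hy : φ < |y|) (hy' : |y| < ω) (hω : ω ≤ Real.pi) :
    Integrable fun s : ℝ => g (s + y * Complex.I) • logResolvent A (s + y * Complex.I) := by
  refine ((hg.integrable_line hy').norm.mul_const K).mono' ?_ (Eventually.of_forall fun s => ?_)
  · exact ((hg.continuous_line hy').smul
      (h.continuous_logResolvent_line hy (hy'.trans_le hω))).aestronglyMeasurable
  · rw [norm_smul]
    have := h.norm_logResolvent_line_le hy (hy'.trans_le hω) s
    gcongr

theorem norm_logCalc_le (h : SectorBound A φ K) (hν : φ < ν) (hν' : ν < Real.pi) {b : ℝ → ℝ}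
    (hb : Integrable b) (h1 : ∀ s : ℝ, ‖g (s + ν * Complex.I)‖ ≤ b s)
    (h2 : ∀ s : ℝ, ‖g (s + (-ν : ℝ) * Complex.I)‖ ≤ b s) :
    ‖logCalc A ν g‖ ≤ K * ∫ s, b s := by
  have hν0 : |ν| = ν := abs_of_pos (h.pos.trans hν)
  have hb0 : 0 ≤ ∫ s, b s := integral_nonneg fun s => (norm_nonneg _).trans (h1 s)
  have hK := h.nonneg
  have h3 : ‖∫ s : ℝ, (g (s + (-ν : ℝ) * Complex.I) • logResolvent A (s + (-ν : ℝ) * Complex.I) -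
      g (s + (ν : ℝ) * Complex.I) • logResolvent A (s + (ν : ℝ) * Complex.I))‖ ≤
        ∫ s, 2 * K * b s := by
    refine norm_integral_le_of_norm_le (hb.const_mul _) (Eventually.of_forall fun s => ?_)
    refine (norm_sub_le _ _).trans ?_
    rw [norm_smul, norm_smul]
    have h4 := h.norm_logResolvent_line_le (y := ν) (by rwa [hν0]) (by rwa [hν0]) s
    have h5 := h.norm_logResolvent_line_le (y := -ν) (by rwa [abs_neg, hν0]) (by rwa [abs_neg, hν0]) s
    have hbs := (norm_nonneg _).trans (h1 s)
    calc _ ≤ b s * K + b s * K := add_le_add (mul_le_mul (h2 s) h5 (norm_nonneg _) hbs)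
          (mul_le_mul (h1 s) h4 (norm_nonneg _) hbs)
      _ = _ := by ring
  rw [integral_const_mul] at h3
  rw [logCalc, norm_smul, norm_inv, norm_mul, norm_mul, Complex.norm_I, mul_one,
    Complex.norm_real, Real.norm_of_nonneg Real.pi_pos.le, Complex.norm_ofNat,
    inv_mul_le_iff₀ (by positivity)]
  refine h3.trans ?_
  nlinarith [Real.pi_gt_three, mul_nonneg hK hb0]

end SectorBound

end LogCalculus

/-! ### Products of the functional calculus with resolvents -/

section LogCalculus

theorem intervalIntegral_smul_const_complex {E : Type*} [NormedAddCommGroup E] [NormedSpace ℂ E]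
    [CompleteSpace E] (f : ℝ → ℂ) (c : E) (a b : ℝ) :
    (∫ s in a..b, f s) • c = ∫ s in a..b, f s • c :=
  (intervalIntegral.integral_smul_const f c).symm

theorem intervalIntegral_neg_sub_add {E : Type*} [NormedAddCommGroup E] [NormedSpace ℝ E]
    {f₁ f₂ f₃ : ℝ → E} {a b : ℝ} (h₁ : IntervalIntegrable f₁ volume a b)
    (h₂ : IntervalIntegrable f₂ volume a b) (h₃ : IntervalIntegrable f₃ volume a b) :
    -(∫ s in a..b, f₁ s) - (∫ s in a..b, f₂ s) + ∫ s in a..b, f₃ s =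
      ∫ s in a..b, (-f₁ s - f₂ s + f₃ s) := by
  have h := (intervalIntegral.integral_add (h₁.neg.sub h₂) h₃).trans (congrArg (· + _)
    ((intervalIntegral.integral_sub h₁.neg h₂).trans
      (congrArg (· - _) intervalIntegral.integral_neg)))
  exact h.symm

theorem differentiableOn_logistic_add {ω : ℝ} (hω : ω ≤ Real.pi / 2) (τ : ℝ) :
    DifferentiableOn ℂ (fun w => logistic (w + τ)) {w | |w.im| < ω} :=
  differentiableOn_logistic.comp (by fun_prop) fun w hw => by
    simpa using lt_of_lt_of_le hw hω

theorem norm_logistic_add_le {ω : ℝ} (hω : ω ≤ Real.pi / 2) (τ : ℝ) {w : ℂ} (hw : |w.im| < ω) :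
    ‖logistic (w + τ)‖ ≤ 1 ∧ ‖1 - logistic (w + τ)‖ ≤ 1 := by
  have : |(w + τ).im| < Real.pi / 2 := by simpa using hw.trans_le hω
  exact ⟨(norm_logistic_le this).1, (norm_one_sub_logistic_le this).1⟩

theorem StripDecay.logistic_mul {ω C δ : ℝ} {g : ℂ → ℂ} (hg : StripDecay ω C δ g)
    (hω : ω ≤ Real.pi / 2) (τ : ℝ) : StripDecay ω C δ fun w => logistic (w + τ) * g w := by
  simpa using hg.mul_bounded (differentiableOn_logistic_add hω τ) (B := 1)
    fun w hw => (norm_logistic_add_le hω τ hw).1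

theorem StripDecay.one_sub_logistic_mul {ω C δ : ℝ} {g : ℂ → ℂ} (hg : StripDecay ω C δ g)
    (hω : ω ≤ Real.pi / 2) (τ : ℝ) : StripDecay ω C δ fun w => (1 - logistic (w + τ)) * g w := by
  simpa using hg.mul_bounded ((differentiableOn_logistic_add hω τ).const_sub 1) (B := 1)
    fun w hw => (norm_logistic_add_le hω τ hw).2

theorem one_add_exp_ne_zero_of_re_ne {w : ℂ} (hw : w.re ≠ 0) : 1 + Complex.exp w ≠ 0 := by
  intro h
  have h1 : Complex.exp w = -1 := (neg_eq_of_add_eq_zero_right h).symm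
  have h2 := congrArg norm h1
  rw [Complex.norm_exp, norm_neg, norm_one, Real.exp_eq_one_iff] at h2
  exact hw h2

theorem tendsto_add_comap_re {l : Filter ℝ} (τ : ℝ) (hl : Tendsto (fun x => x + τ) l l) :
    Tendsto (fun w : ℂ => w + τ) (comap Complex.re l) (comap Complex.re l) := by
  rw [tendsto_comap_iff]
  refine (hl.comp tendsto_comap).congr fun w => by simp

variable {X : Type*} [NormedAddCommGroup X] [NormedSpace ℂ X]

namespace SectorBound

variable {A : X →ₗ.[ℂ] X} {φ K ν ω C δ : ℝ} {g : ℂ → ℂ}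

theorem integrable_logCalc (h : SectorBound A φ K) (hg : StripDecay ω C δ g) (hν : φ < ν)
    (hν' : ν < ω) (hω : ω ≤ Real.pi / 2) : Integrable fun s : ℝ =>
    (g (s + (-ν : ℝ) * Complex.I) • logResolvent A (s + (-ν : ℝ) * Complex.I) -
      g (s + (ν : ℝ) * Complex.I) • logResolvent A (s + (ν : ℝ) * Complex.I)) := by
  have hν0 : |ν| = ν := abs_of_pos (h.pos.trans hν)
  have hpi := Real.pi_pos
  exact (h.integrable_smul_logResolvent hg (by rwa [abs_neg, hν0]) (by rwa [abs_neg, hν0])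
    (by linarith)).sub (h.integrable_smul_logResolvent hg (by rwa [hν0]) (by rwa [hν0])
    (by linarith))

theorem logCalc_sub (h : SectorBound A φ K) (hg : StripDecay ω C δ g) {C' δ' : ℝ} {g' : ℂ → ℂ}
    (hg' : StripDecay ω C' δ' g') (hν : φ < ν) (hν' : ν < ω) (hω : ω ≤ Real.pi / 2) :
    logCalc A ν (fun w => g w - g' w) = logCalc A ν g - logCalc A ν g' := by
  rw [logCalc, logCalc, logCalc, ← smul_sub, ← integral_sub (h.integrable_logCalc hg hν hν' hω)
    (h.integrable_logCalc hg' hν hν' hω)]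
  congr 1
  refine integral_congr_ae (Eventually.of_forall fun s => ?_)
  module

theorem lt_abs_arg_line (h : SectorBound A φ K) (hν : φ < ν) (hν' : ν < ω) (hω : ω ≤ Real.pi / 2)
    (s : ℝ) : φ < |Complex.arg (Complex.exp (s + ν * Complex.I))| ∧
      φ < |Complex.arg (Complex.exp (s + (-ν : ℝ) * Complex.I))| := by
  have hν0 : |ν| = ν := abs_of_pos (h.pos.trans hν)
  have hpi := Real.pi_pos
  exact ⟨lt_abs_arg_exp_of_abs (by simpa [hν0]) (by simp [hν0]; linarith),
    lt_abs_arg_exp_of_abs (by simpa [hν0]) (by simp [hν0]; linarith)⟩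

theorem oneAddInv_comm_logCalc (h : SectorBound A φ K) (hg : StripDecay ω C δ g) (hν : φ < ν)
    (hν' : ν < ω) (hω : ω ≤ Real.pi / 2) (τ : ℝ) :
    oneAddInv A (Real.exp τ) * logCalc A ν g = logCalc A ν g * oneAddInv A (Real.exp τ) := by
  have hi := h.integrable_logCalc hg hν hν' hω
  rw [logCalc, smul_mul_assoc, mul_smul_comm, ← integral_mul_const_of_integrable hi,
    ← integral_const_mul_of_integrable hi]
  congr 1
  refine integral_congr_ae (Eventually.of_forall fun s => ?_)
  simp only [sub_mul, mul_sub, smul_mul_assoc, mul_smul_comm]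
  rw [h.oneAddInv_comm_logResolvent (h.lt_abs_arg_line hν hν' hω s).1,
    h.oneAddInv_comm_logResolvent (h.lt_abs_arg_line hν hν' hω s).2]

variable [CompleteSpace X]

/-- The resolvent identity yields the wanted integrand plus a scalar function times the fixed
operator (1 + tA)⁻¹. The two line integrals of that scalar function agree by Cauchy's theorem and
cancel. -/
theorem logCalc_mul_oneAddInv (h : SectorBound A φ K) (hg : StripDecay ω C δ g) (hν : φ < ν)
    (hν' : ν < ω) (hω : ω ≤ Real.pi / 2) (τ : ℝ) :
    logCalc A ν g * oneAddInv A (Real.exp τ) = logCalc A ν (fun w => logistic (w + τ) * g w) := by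
  have hν0 : |ν| = ν := abs_of_pos (h.pos.trans hν)
  have h1 : |ν| < ω := by rwa [hν0]
  have h2 : |-ν| < ω := by rwa [abs_neg]
  have hj := hg.one_sub_logistic_mul hω τ
  rw [logCalc, logCalc, smul_mul_assoc, ← integral_mul_const_of_integrable
    (h.integrable_logCalc hg hν hν' hω)]
  congr 1
  have hzero : ∫ s : ℝ, ((1 - logistic (s + (-ν : ℝ) * Complex.I + τ)) * g (s + (-ν : ℝ) * Complex.I)
      - (1 - logistic (s + ν * Complex.I + τ)) * g (s + ν * Complex.I)) •
        oneAddInv A (Real.exp τ) = 0 := by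
    rw [integral_smul_const, integral_sub (hj.integrable_line h2) (hj.integrable_line h1),
      hj.integral_line_eq h2 h1, sub_self, zero_smul]
  have hint : Integrable fun s : ℝ => ((1 - logistic (s + (-ν : ℝ) * Complex.I + τ)) *
      g (s + (-ν : ℝ) * Complex.I) - (1 - logistic (s + ν * Complex.I + τ)) *
        g (s + ν * Complex.I)) • oneAddInv A (Real.exp τ) :=
    ((hj.integrable_line h2).sub (hj.integrable_line h1)).smul_const _
  rw [← add_zero (∫ s : ℝ, (logistic (s + (-ν : ℝ) * Complex.I + τ) * g (s + (-ν : ℝ) * Complex.I)) •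
    logResolvent A (s + (-ν : ℝ) * Complex.I) - _), ← hzero, ← integral_add
    (h.integrable_logCalc (hg.logistic_mul hω τ) hν hν' hω) hint]
  refine integral_congr_ae (Eventually.of_forall fun s => ?_)
  have hne : ∀ y : ℝ, |y| < ω → 1 + Complex.exp (s + y * Complex.I + τ) ≠ 0 := fun y hy =>
    one_add_exp_ne_zero (by simpa using hy.trans_le hω)
  have h3 := h.logResolvent_mul_oneAddInv (h.lt_abs_arg_line hν hν' hω s).1 τ (hne _ h1)
  have h4 := h.logResolvent_mul_oneAddInv (h.lt_abs_arg_line hν hν' hω s).2 τ (hne _ h2)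
  simp only [sub_mul, smul_mul_assoc]
  rw [h3, h4]
  module

theorem oneAddInv_mul_logCalc (h : SectorBound A φ K) (hg : StripDecay ω C δ g) (hν : φ < ν)
    (hν' : ν < ω) (hω : ω ≤ Real.pi / 2) (τ : ℝ) :
    oneAddInv A (Real.exp τ) * logCalc A ν g = logCalc A ν (fun w => logistic (w + τ) * g w) := by
  rw [h.oneAddInv_comm_logCalc hg hν hν' hω, h.logCalc_mul_oneAddInv hg hν hν' hω]

theorem one_sub_oneAddInv_mul_logCalc (h : SectorBound A φ K) (hg : StripDecay ω C δ g)
    (hν : φ < ν) (hν' : ν < ω) (hω : ω ≤ Real.pi / 2) (τ : ℝ) :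
    (1 - oneAddInv A (Real.exp τ)) * logCalc A ν g =
      logCalc A ν (fun w => (1 - logistic (w + τ)) * g w) := by
  rw [sub_mul, one_mul, h.oneAddInv_mul_logCalc hg hν hν' hω,
    ← h.logCalc_sub hg (hg.logistic_mul hω τ) hν hν' hω]
  simp only [sub_mul, one_mul]

/-- Multiplication by `(tA)^k (1 + tA)^{-(k + 1)}`, `t = e^τ`. -/
theorem pow_mul_logCalc (h : SectorBound A φ K) (hg : StripDecay ω C δ g)
    (hν : φ < ν) (hν' : ν < ω) (hω : ω ≤ Real.pi / 2) (τ : ℝ) (k : ℕ) :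
    (1 - oneAddInv A (Real.exp τ)) ^ k * oneAddInv A (Real.exp τ) * logCalc A ν g =
      logCalc A ν (fun w => (1 - logistic (w + τ)) ^ k * logistic (w + τ) * g w) ∧
    StripDecay ω C δ (fun w => (1 - logistic (w + τ)) ^ k * logistic (w + τ) * g w) := by
  induction k with
  | zero =>
    simp only [pow_zero, one_mul]
    exact ⟨h.oneAddInv_mul_logCalc hg hν hν' hω τ, hg.logistic_mul hω τ⟩
  | succ k ih =>
    simp only [pow_succ', mul_assoc] at ih ⊢
    rw [ih.1, h.one_sub_oneAddInv_mul_logCalc ih.2 hν hν' hω]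
    exact ⟨rfl, ih.2.one_sub_logistic_mul hω τ⟩

/-- The operators `tA (1 + tA)⁻²`, `t = e^τ`, in terms of the functional calculus. -/
theorem logCalc_logistic (h : SectorBound A φ K) (hν : φ < ν) (hν' : ν < Real.pi / 2) (τ : ℝ) :
    logCalc A ν (fun w => (1 - logistic (w + τ)) * logistic (w + τ)) =
      (1 - oneAddInv A (Real.exp τ)) * oneAddInv A (Real.exp τ) := by
  set J := oneAddInv A (Real.exp τ)
  set P := (1 - J) * J with hP
  set p : ℂ → ℂ := fun w => (1 - logistic (w + τ)) * logistic (w + τ) with hp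
  have hpi := Real.pi_pos
  have hν0 := h.pos.trans hν
  have hνabs : |ν| = ν := abs_of_pos hν0
  have hpd : StripDecay (Real.pi / 2) (1 * Real.exp (1 * |τ|)) 1 p := by
    have := (stripDecay_logistic_mul 0).comp_add (by positivity) τ
    simpa using this
  -- Solving this for p(w) times the resolvent splits the contour integrand into three terms that
  -- are not integrable separately but have limits at both ends; they are therefore integrated over
  -- [-N, N].
  have hid : ∀ w : ℂ, φ < |Complex.arg (Complex.exp w)| → 1 + Complex.exp (w + τ) ≠ 0 →
      logResolvent A w * P = p w • logResolvent A w + (1 - logistic (w + τ)) • P - p w • J := by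
    intro w hw hne
    have h1 := h.logResolvent_mul_oneAddInv hw τ hne
    rw [hP, sub_mul, one_mul, mul_sub, ← mul_assoc, h1, add_mul, smul_mul_assoc, smul_mul_assoc, h1]
    simp only [hp]
    module
  -- limits at both ends
  have hre : ∀ l : Filter ℝ, (∀ᶠ x in l, x ≠ -τ) →
      ∀ᶠ w : ℂ in comap Complex.re l, 1 + Complex.exp (w + τ) ≠ 0 := by
    intro l hl
    filter_upwards [tendsto_comap.eventually hl] with w hw
    refine one_add_exp_ne_zero_of_re_ne ?_
    simp only [Complex.add_re, Complex.ofReal_re]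
    intro h0
    exact hw (eq_neg_of_add_eq_zero_left h0)
  have hS : ∀ w ∈ Complex.im ⁻¹' Icc ν (2 * Real.pi - ν), φ < |Complex.arg (Complex.exp w)| :=
    fun w hw => lt_abs_arg_exp h.pos (hν.trans_le hw.1) (by
      have := hw.2
      linarith)
  have hlimG : ∀ (l : Filter ℝ) (a : ℂ), (∀ᶠ x in l, x ≠ -τ) →
      Tendsto (fun w : ℂ => logistic (w + τ)) (comap Complex.re l) (𝓝 a) → (1 - a) * a = 0 →
      Tendsto (fun w => logResolvent A w * P)
        (comap Complex.re l ⊓ 𝓟 (Complex.im ⁻¹' Icc ν (2 * Real.pi - ν))) (𝓝 ((1 - a) • P)) := by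
    intro l a hl ha ha0
    have ha' := ha.mono_left
      (inf_le_left (b := 𝓟 (Complex.im ⁻¹' Icc ν (2 * Real.pi - ν))))
    have hp0 : Tendsto p (comap Complex.re l ⊓ 𝓟 (Complex.im ⁻¹' Icc ν (2 * Real.pi - ν)))
        (𝓝 0) := by
      have := (ha'.const_sub 1).mul ha'
      rwa [ha0] at this
    have h1 : Tendsto (fun w => p w • logResolvent A w)
        (comap Complex.re l ⊓ 𝓟 (Complex.im ⁻¹' Icc ν (2 * Real.pi - ν))) (𝓝 0) := by
      have h2 : Tendsto (fun w => ‖p w‖ * K)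
          (comap Complex.re l ⊓ 𝓟 (Complex.im ⁻¹' Icc ν (2 * Real.pi - ν))) (𝓝 0) := by
        simpa using hp0.norm.mul_const K
      refine squeeze_zero_norm' ?_ h2
      filter_upwards [mem_inf_of_right (mem_principal_self _)] with w hw
      rw [norm_smul]
      gcongr
      exact h.norm_le _ (Complex.exp_ne_zero w) (hS w hw)
    have h3 := (h1.add ((ha'.const_sub 1).smul_const P)).sub (hp0.smul_const J)
    rw [zero_add, zero_smul, sub_zero] at h3
    refine h3.congr' ?_
    filter_upwards [mem_inf_of_right (mem_principal_self _),
      (hre l hl).filter_mono inf_le_left] with w hw hne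
    exact (hid w (hS w hw) hne).symm
  have htop : Tendsto (fun w : ℂ => logistic (w + τ)) (comap Complex.re atTop) (𝓝 0) :=
    tendsto_logistic_atTop.comp
      (tendsto_add_comap_re τ (tendsto_atTop_add_const_right _ τ tendsto_id))
  have hbot : Tendsto (fun w : ℂ => logistic (w + τ)) (comap Complex.re atBot) (𝓝 1) :=
    tendsto_logistic_atBot.comp
      (tendsto_add_comap_re τ (tendsto_atBot_add_const_right _ τ tendsto_id))
  -- The resolvent term is shifted through the strip ν ≤ Im w ≤ 2π - ν and contributes (2π - 2ν) i
  -- P; the scalar term 1 - l on |Im w| ≤ ν contributes 2ν i P. Together they give 2πi P.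
  have hG := tendsto_intervalIntegral_sub_of_strip (G := fun w => logResolvent A w * P)
    (a := ν) (b := 2 * Real.pi - ν) (by linarith)
    (fun w hw => ((h.differentiableAt_logResolvent (hν.trans_le hw.1) (by
      have := hw.2
      linarith)).mul_const P).differentiableWithinAt)
    (hlimG atBot 1 (eventually_ne_atBot _) hbot (by simp))
    (hlimG atTop 0 (eventually_ne_atTop _) htop (by simp))
  have hstrip : ∀ w ∈ Complex.im ⁻¹' Icc (-ν) ν, |w.im| < Real.pi / 2 := fun w hw =>
    (abs_le.2 hw).trans_lt hν'
  have hj : Tendsto (fun N : ℝ => ∫ s in -N..N, ((1 - logistic (s + (-ν : ℝ) * Complex.I + τ)) -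
      (1 - logistic (s + ν * Complex.I + τ)))) atTop
      (𝓝 ((Complex.I * (ν - (-ν : ℝ))) * ((1 - 1) - (1 - 0)))) :=
    tendsto_intervalIntegral_sub_of_strip (G := fun w => 1 - logistic (w + τ))
    (a := -ν) (b := ν) (by linarith)
    (((differentiableOn_logistic_add le_rfl τ).const_sub 1).mono hstrip)
    ((hbot.const_sub 1).mono_left inf_le_left) ((htop.const_sub 1).mono_left inf_le_left)
  have hpl : Tendsto (fun N : ℝ => ∫ s in -N..N, (p (s + (-ν : ℝ) * Complex.I) -
      p (s + ν * Complex.I))) atTop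
      (𝓝 ((Complex.I * (ν - (-ν : ℝ))) * ((1 - 1) * 1 - (1 - 0) * 0))) :=
    tendsto_intervalIntegral_sub_of_strip (G := p)
    (a := -ν) (b := ν) (by linarith) (hpd.differentiableOn.mono hstrip)
    (((hbot.const_sub 1).mul hbot).mono_left inf_le_left)
    (((htop.const_sub 1).mul htop).mono_left inf_le_left)
  have hI := intervalIntegral_tendsto_integral (h.integrable_logCalc hpd hν hν' le_rfl)
    tendsto_neg_atTop_atBot tendsto_id
  have hsum := ((hG.neg.sub (hj.smul_const P))).add (hpl.smul_const J)
  have hlim := tendsto_nhds_unique hI (hsum.congr fun N => ?_)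
  · rw [logCalc, hlim]
    rw [inv_smul_eq_iff₀ (by simp [Real.pi_ne_zero])]
    push_cast
    simp only [sub_self, sub_zero, zero_smul, zero_mul, mul_zero, add_zero, zero_sub,
      one_smul, smul_neg]
    module
  · have hc1 : ∀ y : ℝ, φ < |y| → |y| < Real.pi →
        Continuous fun s : ℝ => logResolvent A (s + y * Complex.I) * P :=
      fun y h1 h2 => (h.continuous_logResolvent_line h1 h2).mul_const P
    have hc2 : ∀ y : ℝ, |y| < Real.pi / 2 → Continuous fun s : ℝ =>
        1 - logistic (s + y * Complex.I + τ) := fun y hy =>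
      ((differentiableOn_logistic_add le_rfl τ).const_sub 1).continuousOn.comp_continuous
        (by fun_prop) fun s => by simpa using hy
    have e1 : |ν| < Real.pi / 2 := by rwa [hνabs]
    have e2 : |-ν| < Real.pi / 2 := by rwa [abs_neg]
    have e3 : φ < |ν| := by rwa [hνabs]
    have e4 : φ < |-ν| := by rwa [abs_neg]
    have i1 : IntervalIntegrable (fun s : ℝ => logResolvent A (s + ν * Complex.I) * P -
        logResolvent A (s + (2 * Real.pi - ν : ℝ) * Complex.I) * P) volume (-N) N := by
      simp only [logResolvent_add_two_pi]
      exact ((hc1 _ e3 (by linarith)).sub (hc1 _ e4 (by linarith))).intervalIntegrable _ _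
    have i2 : IntervalIntegrable (fun s : ℝ => ((1 - logistic (s + (-ν : ℝ) * Complex.I + τ)) -
        (1 - logistic (s + ν * Complex.I + τ))) • P) volume (-N) N :=
      (((hc2 _ e2).sub (hc2 _ e1)).smul continuous_const).intervalIntegrable _ _
    have i3 : IntervalIntegrable (fun s : ℝ => (p (s + (-ν : ℝ) * Complex.I) -
        p (s + ν * Complex.I)) • J) volume (-N) N :=
      (((hpd.continuous_line e2).sub (hpd.continuous_line e1)).smul
        continuous_const).intervalIntegrable _ _
    refine (congrArg₂ (· + ·) (congrArg₂ (· - ·) rfl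
      (intervalIntegral_smul_const_complex (E := X →L[ℂ] X) _ P (-N) N))
      (intervalIntegral_smul_const_complex (E := X →L[ℂ] X) _ J (-N) N)).trans ?_
    refine (intervalIntegral_neg_sub_add i1 i2 i3).trans ?_
    refine intervalIntegral.integral_congr fun s _ => ?_
    have hne : ∀ y : ℝ, |y| < Real.pi / 2 → 1 + Complex.exp (s + y * Complex.I + τ) ≠ 0 :=
      fun y hy => one_add_exp_ne_zero (by simpa using hy)
    have h3 := hid _ (h.lt_abs_arg_line hν hν' le_rfl s).1 (hne _ e1)
    have h4 := hid _ (h.lt_abs_arg_line hν hν' le_rfl s).2 (hne _ e2)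
    simp only [logResolvent_add_two_pi]
    rw [h3, h4]
    module

end SectorBound

end LogCalculus

/-! ### Reproducing formulas and kernel domination -/

section Reproducing

variable {X : Type*} [NormedAddCommGroup X] [NormedSpace ℂ X]

/-- `‖F(τ) x‖` is bounded by the convolution of `‖G(σ) x‖` with an exponentially decaying kernel,
uniformly in `x`. -/
def KernelDominated (F G : ℝ → X →L[ℂ] X) : Prop :=
  ∃ (C : ℝ≥0) (ε : ℝ), 0 < ε ∧ ∀ (τ : ℝ) (x : X),
    ‖F τ x‖ₑ ≤ C * ∫⁻ σ, ENNReal.ofReal (Real.exp (-(ε * |τ - σ|))) * ‖G σ x‖ₑ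

theorem StripDecay.norm_shift_le {ω C δ : ℝ} {g : ℂ → ℂ} (hg : StripDecay ω C δ g) (s τ : ℝ) {y : ℝ}
    (hy : |y| < ω) : ‖g (s + y * Complex.I + τ)‖ ≤ C * Real.exp (-(δ * |s + τ|)) := by
  simpa using hg.norm_le (s + y * Complex.I + τ) (by simpa using hy)

theorem StripDecay.continuous_shift {ω C δ : ℝ} {g : ℂ → ℂ} (hg : StripDecay ω C δ g) {y : ℝ}
    (hy : |y| < ω) : Continuous fun p : ℝ × ℝ => g (p.2 + y * Complex.I + p.1) :=
  hg.differentiableOn.continuousOn.comp_continuous (by fun_prop) fun p => by simpa using hy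

theorem integrable_prod_exp {δ δ' : ℝ} (hδ : 0 < δ) (hδ' : 0 < δ') :
    Integrable (fun p : ℝ × ℝ => Real.exp (-(δ * |p.2|)) * Real.exp (-(δ' * |p.2 + p.1|)))
      (volume.prod volume) := by
  rw [integrable_prod_iff' (by fun_prop)]
  refine ⟨Eventually.of_forall fun s => ?_, ?_⟩
  · exact ((integrable_exp_neg_mul_abs hδ').comp_add_left s).const_mul (Real.exp (-(δ * |s|)))
  · have : (fun s : ℝ => ∫ τ, ‖Real.exp (-(δ * |s|)) * Real.exp (-(δ' * |s + τ|))‖) =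
        fun s => Real.exp (-(δ * |s|)) * (2 / δ') := by
      funext s
      simp only [norm_mul, Real.norm_eq_abs, Real.abs_exp]
      rw [integral_const_mul, integral_add_left_eq_self (fun t => Real.exp (-(δ' * |t|))) s,
        integral_exp_neg_mul_abs hδ']
    rw [this]
    exact (integrable_exp_neg_mul_abs hδ).mul_const _

theorem logCalc_const_mul (A : X →ₗ.[ℂ] X) (ν : ℝ) (c : ℂ) (g : ℂ → ℂ) :
    logCalc A ν (fun w => c * g w) = c • logCalc A ν g := by
  rw [logCalc, logCalc, smul_comm c]
  congr 1
  refine (integral_congr_ae (Eventually.of_forall fun s => ?_)).trans (integral_smul c _)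
  simp only [smul_sub, smul_smul]

namespace SectorBound

variable {A : X →ₗ.[ℂ] X} {φ K ν ω C δ : ℝ} {g : ℂ → ℂ}

/-- Fubini: decay in both s and s + τ gives an integrable majorant on the plane, so a scalar
identity integrated over the parameter becomes an operator identity. -/
theorem integral_logCalc [CompleteSpace X] (h : SectorBound A φ K) (hν : φ < ν) (hν' : ν < Real.pi / 2) {F : ℝ → ℂ → ℂ}
    {G : ℂ → ℂ} {C δ δ' : ℝ} (hδ : 0 < δ) (hδ' : 0 < δ')
    (hF : ∀ y : ℝ, |y| ≤ ν → Continuous fun p : ℝ × ℝ => F p.1 (p.2 + y * Complex.I))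
    (hb : ∀ τ s y : ℝ, |y| ≤ ν → ‖F τ (s + y * Complex.I)‖ ≤
      C * (Real.exp (-(δ * |s|)) * Real.exp (-(δ' * |s + τ|))))
    (hG : ∀ s y : ℝ, |y| ≤ ν → ∫ τ, F τ (s + y * Complex.I) = G (s + y * Complex.I)) :
    Integrable (fun τ => logCalc A ν (F τ)) ∧ ∫ τ, logCalc A ν (F τ) = logCalc A ν G := by
  have hpi := Real.pi_pos
  have hνabs : |ν| = ν := abs_of_pos (h.pos.trans hν)
  have e1 : |ν| ≤ ν := hνabs.le
  have e2 : |-ν| ≤ ν := by rwa [abs_neg]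
  have hk := (integrable_prod_exp hδ hδ').const_mul C
  have hint : ∀ y : ℝ, |y| = ν → Integrable (fun p : ℝ × ℝ => F p.1 (p.2 + y * Complex.I) •
      logResolvent A (p.2 + y * Complex.I)) (volume.prod volume) := by
    intro y hy
    refine (hk.mul_const K).mono' ?_ (Eventually.of_forall fun p => ?_)
    · exact ((hF y hy.le).smul ((h.continuous_logResolvent_line (y := y) (by rwa [hy])
        (by linarith)).comp continuous_snd)).aestronglyMeasurable
    · rw [norm_smul]
      exact mul_le_mul (hb _ _ y hy.le) (h.norm_logResolvent_line_le (by rwa [hy]) (by linarith) _)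
        (norm_nonneg _) ((norm_nonneg _).trans (hb p.1 p.2 y hy.le))
  have hI := (hint (-ν) (by rwa [abs_neg])).sub (hint ν hνabs)
  constructor
  · exact hI.integral_prod_left.smul (2 * Real.pi * Complex.I : ℂ)⁻¹
  · simp only [logCalc]
    rw [integral_smul]
    congr 1
    refine (integral_integral_swap hI).trans ?_
    refine integral_congr_ae (Eventually.of_forall fun s => ?_)
    have hline : ∀ y : ℝ, |y| ≤ ν → Integrable fun τ => F τ (s + y * Complex.I) := by
      intro y hy
      have h1 := ((integrable_exp_neg_mul_abs hδ').comp_add_left s).const_mul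
        (C * Real.exp (-(δ * |s|)))
      refine h1.mono' ?_ (Eventually.of_forall fun τ => ?_)
      · exact ((hF y hy).comp (by fun_prop : Continuous fun τ : ℝ => (τ, s))).aestronglyMeasurable
      · rw [mul_assoc]
        exact hb τ s y hy
    beta_reduce
    rw [integral_sub ((hline _ e2).smul_const _) ((hline _ e1).smul_const _), integral_smul_const,
      integral_smul_const, hG _ _ e1, hG _ _ e2]

theorem exists_norm_logCalc_mul_le (h : SectorBound A φ K) (hν : φ < ν) (hν' : ν < ω)
    (hω : ω ≤ Real.pi / 2) {g₁ g₂ : ℂ → ℂ} {C₁ C₂ δ₁ δ₂ : ℝ} (h₁ : StripDecay ω C₁ δ₁ g₁)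
    (h₂ : StripDecay ω C₂ δ₂ g₂) : ∃ (B : ℝ≥0) (ε : ℝ), 0 < ε ∧ ∀ τ σ : ℝ,
      ‖logCalc A ν (fun w => g₁ (w + τ) * g₂ (w + σ))‖ ≤ B * Real.exp (-(ε * |τ - σ|)) := by
  have hω0 : 0 < ω := (h.pos.trans hν).trans hν'
  have hνabs : |ν| = ν := abs_of_pos (h.pos.trans hν)
  have hC₁ := h₁.nonneg hω0
  have hC₂ := h₂.nonneg hω0
  have hpi := Real.pi_pos
  -- Half of the decay yields e^{-ε|τ-σ|} through |τ - σ| ≤ |s + τ| + |s + σ|; the other half keeps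
  -- the integral over s finite.
  set ε := min δ₁ δ₂ / 2 with hεd
  have hε : 0 < ε := half_pos (lt_min h₁.pos h₂.pos)
  have hε1 : 2 * ε ≤ δ₁ := by rw [hεd]; linarith [min_le_left δ₁ δ₂]
  have hε2 : 2 * ε ≤ δ₂ := by rw [hεd]; linarith [min_le_right δ₁ δ₂]
  have hK := h.nonneg
  refine ⟨⟨K * (C₁ * C₂ * (2 / ε)), by positivity⟩, ε, hε, fun τ σ => ?_⟩
  have hbound : ∀ s y : ℝ, |y| < ω → ‖g₁ (s + y * Complex.I + τ) * g₂ (s + y * Complex.I + σ)‖ ≤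
      C₁ * C₂ * Real.exp (-(ε * |τ - σ|)) * Real.exp (-(ε * |s + σ|)) := by
    intro s y hy
    have b1 := h₁.norm_le (s + y * Complex.I + τ) (by simpa using hy)
    have b2 := h₂.norm_le (s + y * Complex.I + σ) (by simpa using hy)
    simp only [Complex.add_re, Complex.ofReal_re, Complex.mul_re, Complex.I_re, mul_zero,
      Complex.ofReal_im, Complex.I_im, mul_one, sub_self, add_zero] at b1 b2
    rw [norm_mul]
    refine (mul_le_mul b1 b2 (norm_nonneg _) ((norm_nonneg _).trans b1)).trans ?_
    have tri : |τ - σ| ≤ |s + τ| + |s + σ| := by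
      have := abs_sub (s + τ) (s + σ)
      rwa [add_sub_add_left_eq_sub] at this
    calc _ = C₁ * C₂ * (Real.exp (-(δ₁ * |s + τ|)) * Real.exp (-(δ₂ * |s + σ|))) := by ring
      _ ≤ C₁ * C₂ * (Real.exp (-(ε * |τ - σ|)) * Real.exp (-(ε * |s + σ|))) := by
        rw [← Real.exp_add, ← Real.exp_add]
        refine mul_le_mul_of_nonneg_left (Real.exp_le_exp.2 ?_) (by positivity)
        nlinarith [abs_nonneg (s + τ), abs_nonneg (s + σ), mul_le_mul_of_nonneg_left tri hε.le,
          mul_le_mul_of_nonneg_right hε1 (abs_nonneg (s + τ)),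
          mul_le_mul_of_nonneg_right hε2 (abs_nonneg (s + σ)),
          mul_nonneg hε.le (abs_nonneg (s + τ))]
      _ = _ := by ring
  have hbi : Integrable fun s : ℝ => C₁ * C₂ * Real.exp (-(ε * |τ - σ|)) *
      Real.exp (-(ε * |s + σ|)) := ((integrable_exp_neg_mul_abs hε).comp_add_right σ).const_mul _
  refine (h.norm_logCalc_le hν (by linarith) hbi (fun s => hbound s ν (by rwa [hνabs]))
    (fun s => hbound s (-ν) (by rwa [abs_neg, hνabs]))).trans_eq ?_
  rw [integral_const_mul, integral_add_right_eq_self (fun t => Real.exp (-(ε * |t|))) σ,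
    integral_exp_neg_mul_abs hε]
  change _ = K * (C₁ * C₂ * (2 / ε)) * _
  ring

end SectorBound

theorem hasDerivAt_logistic {w : ℂ} (hw : 1 + Complex.exp w ≠ 0) :
    HasDerivAt logistic (-((1 - logistic w) * logistic w)) w := by
  have h := ((Complex.hasDerivAt_exp w).const_add 1).inv hw
  refine h.congr_deriv ?_
  rw [one_sub_logistic hw, logistic]
  field_simp

/-- Since l' = -(1 - l) l, an antiderivative is 2l³ - 3l², which runs from -1 to 0 as l runs from 1
to 0; this is the source of the factor 6. -/
theorem integral_logistic_sq {w : ℂ} (hw : |w.im| < Real.pi / 2) :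
    ∫ σ : ℝ, 6 * ((1 - logistic (w + σ)) * logistic (w + σ)) ^ 2 = 1 := by
  have hline : ∀ σ : ℝ, |(w + σ).im| < Real.pi / 2 := fun σ => by simpa using hw
  have hd : ∀ σ : ℝ, HasDerivAt (fun σ : ℝ => 2 * logistic (w + σ) ^ 3 - 3 * logistic (w + σ) ^ 2)
      (6 * ((1 - logistic (w + σ)) * logistic (w + σ)) ^ 2) σ := by
    intro σ
    have h1 : HasDerivAt (fun σ : ℝ => logistic (w + σ))
        (-((1 - logistic (w + σ)) * logistic (w + σ))) σ := by
      have h2 := hasDerivAt_logistic (one_add_exp_ne_zero (hline σ))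
      have h3 : HasDerivAt (fun σ : ℝ => w + (σ : ℂ)) 1 σ :=
        (Complex.ofRealCLM.hasDerivAt (x := σ)).const_add w
      exact (h2.comp σ h3).congr_deriv (mul_one _)
    have h4 := ((h1.pow 3).const_mul 2).sub ((h1.pow 2).const_mul 3)
    refine h4.congr_deriv ?_
    push_cast
    ring
  have htend : ∀ l : Filter ℝ, Tendsto (fun x => w.re + x) l l →
      Tendsto (fun σ : ℝ => w + (σ : ℂ)) l (comap Complex.re l) := by
    intro l hl
    rw [tendsto_comap_iff]
    exact hl.congr fun x => by simp
  have htop := tendsto_logistic_atTop.comp (htend atTop (tendsto_atTop_add_const_left _ _ tendsto_id))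
  have hbot := tendsto_logistic_atBot.comp (htend atBot (tendsto_atBot_add_const_left _ _ tendsto_id))
  have hp := stripDecay_logistic_mul 0
  have hcont : Continuous fun σ : ℝ => logistic (w + σ) :=
    differentiableOn_logistic.continuousOn.comp_continuous (by fun_prop) hline
  have hi : Integrable fun σ : ℝ => 6 * ((1 - logistic (w + σ)) * logistic (w + σ)) ^ 2 := by
    refine (((integrable_exp_neg_mul_abs one_pos).comp_add_left w.re).const_mul 6).mono'
      (by fun_prop) (Eventually.of_forall fun σ => ?_)
    have h1 := hp.norm_le (w + σ) (hline σ)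
    simp only [zero_add, pow_one, one_mul, Complex.add_re, Complex.ofReal_re] at h1
    rw [norm_mul, norm_pow, Complex.norm_ofNat, one_mul]
    have h2 : Real.exp (-|w.re + σ|) ≤ 1 := Real.exp_le_one_iff.2 (by simp)
    refine mul_le_mul_of_nonneg_left ?_ (by norm_num)
    refine le_trans ?_ h1
    exact pow_le_of_le_one (norm_nonneg _) (h1.trans h2) (by norm_num)
  rw [integral_of_hasDerivAt_of_tendsto hd hi (((hbot.pow 3).const_mul 2).sub
    ((hbot.pow 2).const_mul 3)) (((htop.pow 3).const_mul 2).sub ((htop.pow 2).const_mul 3))]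
  norm_num

theorem stripDecay_logistic : StripDecay (Real.pi / 2) 1 1
    fun w => (1 - logistic w) * logistic w := by
  simpa using stripDecay_logistic_mul 0

/-- The operators `tA (1 + tA)⁻²`, `t = e^τ`. -/
def logSquare (A : X →ₗ.[ℂ] X) (τ : ℝ) : X →L[ℂ] X :=
  (1 - oneAddInv A (Real.exp τ)) * oneAddInv A (Real.exp τ)

namespace SectorBound

variable {A : X →ₗ.[ℂ] X} {φ K ν ω C δ : ℝ} {g : ℂ → ℂ} [CompleteSpace X]

/-- Insert 1 = 6 ∫ p(w + σ)² dσ with p = (1 - l) l under the contour integral of g(w + τ) and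
exchange the integrals. -/
theorem kernelDominated_logCalc (h : SectorBound A φ K) (hg : StripDecay ω C δ g) (hν : φ < ν)
    (hν' : ν < ω) (hω : ω ≤ Real.pi / 2) :
    KernelDominated (fun τ => logCalc A ν fun w => g (w + τ)) (logSquare A) := by
  have hω0 : 0 < ω := (h.pos.trans hν).trans hν'
  obtain ⟨p, hpdef⟩ : ∃ p : ℂ → ℂ, ∀ w, p w = (1 - logistic w) * logistic w := ⟨_, fun _ => rfl⟩
  have hp : StripDecay ω 1 1 p := by
    rw [show p = _ from funext hpdef]
    exact stripDecay_logistic.mono hω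
  obtain ⟨B, ε, hε, hB⟩ := h.exists_norm_logCalc_mul_le hν hν' hω hg hp
  refine ⟨6 * B, ε, hε, fun τ x => ?_⟩
  have hgp : ∀ σ : ℝ, StripDecay ω (1 * (C * Real.exp (δ * |τ|))) δ fun w => p (w + σ) * g (w + τ) :=
    fun σ => (hg.comp_add hω0 τ).mul_bounded
      (hp.comp_add hω0 σ).differentiableOn fun w hw => by
        refine (hp.norm_le _ (by simpa using hw)).trans ?_
        rw [one_mul, Real.exp_le_one_iff]
        simp
  obtain ⟨hi, he⟩ := h.integral_logCalc hν (hν'.trans_le hω)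
    (F := fun σ w => 6 * (p (w + σ) * (p (w + σ) * g (w + τ)))) (G := fun w => g (w + τ))
    (C := 6 * (C * Real.exp (δ * |τ|))) (δ := δ) (δ' := 1) hg.pos one_pos
    (fun y hy => by
      have hy' := hy.trans_lt hν'
      have c1 := hp.continuous_shift hy'
      have c2 : Continuous fun q : ℝ × ℝ => g (q.2 + y * Complex.I + τ) :=
        (hg.continuous_shift hy').comp (by fun_prop : Continuous fun q : ℝ × ℝ => (τ, q.2))
      exact continuous_const.mul (c1.mul (c1.mul c2)))
    (fun σ s y hy => by
      have hy' := hy.trans_lt hν'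
      have b1 := hp.norm_shift_le s σ hy'
      have b2 := (hg.comp_add hω0 τ).norm_line_le hy' s
      have b3 : ‖p (s + y * Complex.I + σ)‖ ≤ 1 := b1.trans (by
        rw [one_mul, Real.exp_le_one_iff]
        simp)
      rw [norm_mul, norm_mul (p _), norm_mul (p _) (g _), Complex.norm_ofNat]
      calc _ ≤ 6 * (1 * Real.exp (-(1 * |s + σ|)) * (1 * (C * Real.exp (δ * |τ|) *
            Real.exp (-(δ * |s|))))) := mul_le_mul_of_nonneg_left (mul_le_mul b1 (mul_le_mul b3 b2
              (norm_nonneg _) zero_le_one) (by positivity) ((norm_nonneg _).trans b1)) (by norm_num)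
        _ = _ := by ring)
    (fun s y hy => by
      have hy' := hy.trans_lt hν'
      have h1 := integral_logistic_sq (w := s + y * Complex.I) (by simpa using hy'.trans_le hω)
      have h2 : ∀ σ : ℝ, 6 * (p (s + y * Complex.I + σ) * (p (s + y * Complex.I + σ) *
          g (s + y * Complex.I + τ))) = 6 * ((1 - logistic (s + y * Complex.I + σ)) *
            logistic (s + y * Complex.I + σ)) ^ 2 * g (s + y * Complex.I + τ) := fun σ => by
        simp only [hpdef]
        ring
      simp only [h2]
      rw [integral_mul_const, h1, one_mul])
  -- One factor p leaves the calculus as `logSquare A σ` and is commuted to act first on x; the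
  -- other stays with g and supplies the decay in |τ - σ|.
  have hop : ∀ σ : ℝ, logCalc A ν (fun w => 6 * (p (w + σ) * (p (w + σ) * g (w + τ)))) =
      (6 : ℂ) • (logCalc A ν (fun w => g (w + τ) * p (w + σ)) * logSquare A σ) := by
    intro σ
    rw [logCalc_const_mul]
    congr 1
    have h1 := (h.pow_mul_logCalc (hgp σ) hν hν' hω σ 1).1
    simp only [pow_one, ← hpdef] at h1
    have h2 : Commute (oneAddInv A (Real.exp σ)) (logCalc A ν fun w => p (w + σ) * g (w + τ)) :=
      h.oneAddInv_comm_logCalc (hgp σ) hν hν' hω σ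
    have h3 := (((Commute.one_left _).sub_left h2).mul_left h2).eq
    rw [h3] at h1
    simp only [mul_comm (g _)]
    exact h1.symm
  simp only [hop] at hi he
  calc ‖logCalc A ν (fun w => g (w + τ)) x‖ₑ
      = ‖∫ σ : ℝ, ((6 : ℂ) • (logCalc A ν (fun w => g (w + τ) * p (w + σ)) * logSquare A σ)) x‖ₑ := by
        rw [← he, ContinuousLinearMap.integral_apply hi]
    _ ≤ ∫⁻ σ : ℝ, ‖((6 : ℂ) • (logCalc A ν (fun w => g (w + τ) * p (w + σ)) * logSquare A σ)) x‖ₑ :=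
        enorm_integral_le_lintegral_enorm _
    _ ≤ ∫⁻ σ, ((6 * B : ℝ≥0) : ℝ≥0∞) *
          (ENNReal.ofReal (Real.exp (-(ε * |τ - σ|))) * ‖logSquare A σ x‖ₑ) := by
        refine lintegral_mono fun σ => ?_
        rw [← ofReal_norm, ← ofReal_norm, ← ENNReal.ofReal_coe_nnreal,
          ← ENNReal.ofReal_mul (Real.exp_pos _).le, ← ENNReal.ofReal_mul NNReal.zero_le_coe]
        refine ENNReal.ofReal_le_ofReal ?_
        rw [smul_apply, norm_smul, mul_apply_eq_comp, Complex.norm_ofNat, NNReal.coe_mul,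
          NNReal.coe_ofNat, mul_assoc, ← mul_assoc (B : ℝ)]
        exact mul_le_mul_of_nonneg_left ((logCalc A ν _).le_of_opNorm_le (hB τ σ) _) (by norm_num)
    _ = _ := lintegral_const_mul' _ _ ENNReal.coe_ne_top

/-- The integral of (η g)(w + τ) over τ is a constant c: real translations do not change it and
Cauchy's theorem removes Im w. Division by c expresses P(σ) as an integral of the operators (η(· +
τ) p(· + σ))(A) applied to g(· + τ)(A). -/
theorem kernelDominated_logSquare (h : SectorBound A φ K) (hg : StripDecay ω C δ g) (hν : φ < ν)
    (hν' : ν < ω) (hω : ω ≤ Real.pi / 2) {k : ℕ}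
    (hk : ∫ s : ℝ, (1 - logistic s) ^ (k + 1) * logistic s * g s ≠ 0) :
    KernelDominated (logSquare A) (fun τ => logCalc A ν fun w => g (w + τ)) := by
  have hω0 : 0 < ω := (h.pos.trans hν).trans hν'
  obtain ⟨p, hpdef⟩ : ∃ p : ℂ → ℂ, ∀ w, p w = (1 - logistic w) * logistic w := ⟨_, fun _ => rfl⟩
  obtain ⟨η, hηdef⟩ : ∃ η : ℂ → ℂ, ∀ w, η w = (1 - logistic w) ^ (k + 1) * logistic w :=
    ⟨_, fun _ => rfl⟩
  have hp : StripDecay ω 1 1 p := by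
    rw [show p = _ from funext hpdef]
    exact stripDecay_logistic.mono hω
  have hη : StripDecay ω 1 1 η := by
    rw [show η = _ from funext hηdef]
    exact (stripDecay_logistic_mul k).mono hω
  simp only [← hηdef] at hk
  set c := ∫ s : ℝ, η s * g s with hc
  have hη1 : ∀ w : ℂ, |w.im| < ω → ‖η w‖ ≤ 1 := fun w hw => (hη.norm_le w hw).trans (by
    rw [one_mul, Real.exp_le_one_iff]
    simp)
  have hηg : StripDecay ω (1 * C) δ fun w => η w * g w := hg.mul_bounded hη.differentiableOn hη1
  obtain ⟨B, ε, hε, hB⟩ := h.exists_norm_logCalc_mul_le hν hν' hω hη hp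
  refine ⟨‖c‖₊⁻¹ * B, ε, hε, fun σ x => ?_⟩
  have hpg : ∀ τ : ℝ, StripDecay ω (1 * (C * Real.exp (δ * |τ|))) δ fun w => p (w + σ) * g (w + τ) :=
    fun τ => (hg.comp_add hω0 τ).mul_bounded
      (hp.comp_add hω0 σ).differentiableOn fun w hw => by
        refine (hp.norm_le _ (by simpa using hw)).trans ?_
        rw [one_mul, Real.exp_le_one_iff]
        simp
  obtain ⟨hi, he⟩ := h.integral_logCalc hν (hν'.trans_le hω)
    (F := fun τ w => η (w + τ) * (p (w + σ) * g (w + τ))) (G := fun w => c * p (w + σ))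
    (C := Real.exp |σ| * C) (δ := 1) (δ' := δ) one_pos hg.pos
    (fun y hy => by
      have hy' := hy.trans_lt hν'
      have c1 := hη.continuous_shift hy'
      have c2 := hg.continuous_shift hy'
      have c3 : Continuous fun q : ℝ × ℝ => p (q.2 + y * Complex.I + σ) :=
        (hp.continuous_shift hy').comp (by fun_prop : Continuous fun q : ℝ × ℝ => (σ, q.2))
      exact c1.mul (c3.mul c2))
    (fun τ s y hy => by
      have hy' := hy.trans_lt hν'
      have b1 := hg.norm_shift_le s τ hy'
      have b2 := (hp.comp_add hω0 σ).norm_line_le hy' s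
      have b3 := hη1 (s + y * Complex.I + τ) (by simpa using hy')
      rw [norm_mul (η _), norm_mul (p _) (g _)]
      calc _ ≤ 1 * (1 * Real.exp (1 * |σ|) * Real.exp (-(1 * |s|)) *
            (C * Real.exp (-(δ * |s + τ|)))) := mul_le_mul b3 (mul_le_mul b2 b1 (norm_nonneg _)
              ((norm_nonneg _).trans b2)) (by positivity) zero_le_one
        _ = _ := by rw [one_mul, one_mul, one_mul]; ring)
    (fun s y hy => by
      have hy' := hy.trans_lt hν'
      have h1 := hηg.integral_line_eq (a := y) (b := 0) hy' (by simpa using hω0)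
      simp only [Complex.ofReal_zero, zero_mul, add_zero] at h1
      have h2 : ∀ τ : ℝ, η (s + y * Complex.I + τ) * (p (s + y * Complex.I + σ) *
          g (s + y * Complex.I + τ)) = η ((s + τ : ℝ) + y * Complex.I) *
            g ((s + τ : ℝ) + y * Complex.I) * p (s + y * Complex.I + σ) := fun τ => by
        rw [show (s + y * Complex.I + τ : ℂ) = (s + τ : ℝ) + y * Complex.I by push_cast; ring]
        ring
      simp only [h2]
      rw [integral_mul_const, integral_add_left_eq_self (fun t : ℝ => η (t + y * Complex.I) *
        g (t + y * Complex.I)) s, h1])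
  -- Multiplicativity is available because η and p are polynomials in l: both sides equal the
  -- resolvent expression for η times P(σ) times the calculus of g.
  have hop : ∀ τ : ℝ, logCalc A ν (fun w => η (w + τ) * (p (w + σ) * g (w + τ))) =
      logCalc A ν (fun w => η (w + τ) * p (w + σ)) * logCalc A ν (fun w => g (w + τ)) := by
    intro τ
    have h1 := (h.pow_mul_logCalc (hpg τ) hν hν' hω τ (k + 1)).1
    have h2 := (h.pow_mul_logCalc (hp.comp_add hω0 σ) hν hν' hω τ (k + 1)).1
    have h3 := (h.pow_mul_logCalc (hg.comp_add hω0 τ) hν hν' hω σ 1).1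
    have h4 := h.logCalc_logistic hν (hν'.trans_le hω) σ
    simp only [pow_one, ← hpdef] at h3 h4
    simp only [← hηdef] at h1 h2
    rw [← h1, ← h2, h4, ← h3]
    simp only [mul_assoc]
  have hPσ : logSquare A σ = c⁻¹ • ∫ τ : ℝ, logCalc A ν (fun w => η (w + τ) * p (w + σ)) *
      logCalc A ν (fun w => g (w + τ)) := by
    simp only [hop] at he
    rw [he, logCalc_const_mul, smul_smul, inv_mul_cancel₀ hk, one_smul]
    simp only [hpdef]
    exact (h.logCalc_logistic hν (hν'.trans_le hω) σ).symm
  simp only [hop] at hi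
  calc ‖logSquare A σ x‖ₑ
      = ‖c⁻¹‖ₑ * ‖∫ τ : ℝ, (logCalc A ν (fun w => η (w + τ) * p (w + σ)) *
          logCalc A ν (fun w => g (w + τ))) x‖ₑ := by
        rw [hPσ, smul_apply, enorm_smul, ContinuousLinearMap.integral_apply hi]
    _ ≤ ‖c⁻¹‖ₑ * ∫⁻ τ : ℝ, B * (ENNReal.ofReal (Real.exp (-(ε * |σ - τ|))) *
          ‖logCalc A ν (fun w => g (w + τ)) x‖ₑ) := by
        refine mul_le_mul' le_rfl ((enorm_integral_le_lintegral_enorm _).trans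
          (lintegral_mono fun τ => ?_))
        rw [← ofReal_norm, ← ofReal_norm, ← ENNReal.ofReal_coe_nnreal,
          ← ENNReal.ofReal_mul (Real.exp_pos _).le, ← ENNReal.ofReal_mul NNReal.zero_le_coe]
        refine ENNReal.ofReal_le_ofReal ?_
        rw [mul_apply_eq_comp, ← mul_assoc, abs_sub_comm]
        exact (logCalc A ν _).le_of_opNorm_le (hB τ σ) _
    _ = _ := by
        rw [lintegral_const_mul' _ _ ENNReal.coe_ne_top, ← mul_assoc, ENNReal.coe_mul, ← nnnorm_inv]
        rfl

end SectorBound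

end Reproducing

/-! ### Nonvanishing of a moment of a nonzero function -/

section Moments

theorem one_sub_inv_one_add_exp_mem (s : ℝ) : 1 - (1 + Real.exp s)⁻¹ ∈ Ioo (0 : ℝ) 1 := by
  have h1 := Real.exp_pos s
  have h2 : (1 + Real.exp s)⁻¹ < 1 := inv_lt_one_of_one_lt₀ (by linarith)
  have h3 : 0 < (1 + Real.exp s)⁻¹ := by positivity
  exact ⟨by linarith, by linarith⟩

/-- A function that is orthogonal to all powers of `e^s / (1 + e^s)` vanishes. -/
theorem eq_zero_of_forall_integral_pow_mul {f : ℝ → ℝ} (hc : Continuous f) (hi : Integrable f)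
    {M : ℝ} (hM : ∀ s, |f s| ≤ M * ((1 - (1 + Real.exp s)⁻¹) * (1 + Real.exp s)⁻¹))
    (h0 : ∀ k : ℕ, ∫ s, (1 - (1 + Real.exp s)⁻¹) ^ k * f s = 0) (s : ℝ) : f s = 0 := by
  set v : ℝ → ℝ := fun s => 1 - (1 + Real.exp s)⁻¹ with hv
  have hvmem : ∀ s, v s ∈ Ioo (0 : ℝ) 1 := one_sub_inv_one_add_exp_mem
  have hvc : Continuous v := by
    refine continuous_const.sub (Continuous.inv₀ (by fun_prop) fun s => ?_)
    positivity
  have hM0 : 0 ≤ M := by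
    have h1 := (abs_nonneg _).trans (hM 0)
    have h2 : 0 < (1 - (1 + Real.exp 0)⁻¹) * (1 + Real.exp 0)⁻¹ := by norm_num
    exact nonneg_of_mul_nonneg_left h1 h2
  have hpoly : ∀ q : Polynomial ℝ, Integrable (fun s => q.eval (v s) * f s) ∧
      ∫ s, q.eval (v s) * f s = 0 := by
    have hk : ∀ k : ℕ, Integrable fun s => v s ^ k * f s := by
      intro k
      refine hi.norm.mono' (by fun_prop) (Eventually.of_forall fun s => ?_)
      rw [norm_mul, norm_pow, Real.norm_of_nonneg (hvmem s).1.le]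
      exact mul_le_of_le_one_left (norm_nonneg _) (pow_le_one₀ (hvmem s).1.le (hvmem s).2.le)
    intro q
    simp only [Polynomial.eval_eq_sum_range, Finset.sum_mul, mul_assoc]
    refine ⟨integrable_finsetSum _ fun k _ => (hk k).const_mul _, ?_⟩
    rw [integral_finsetSum _ fun k _ => (hk k).const_mul _]
    refine Finset.sum_eq_zero fun k _ => ?_
    rw [integral_const_mul, h0 k, mul_zero]
  -- the function in the coordinate `x = v s`
  set F : ℝ → ℝ := (Ioo (0 : ℝ) 1).indicator fun x => f (Real.log (x / (1 - x))) with hF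
  have hFv : ∀ s, F (v s) = f s := by
    intro s
    rw [hF, indicator_of_mem (hvmem s)]
    congr 1
    have h1 : v s / (1 - v s) = Real.exp s := by
      simp only [hv]
      have := Real.exp_pos s
      field_simp
      ring
    rw [h1, Real.log_exp]
  have hvinv : ∀ x ∈ Ioo (0 : ℝ) 1, v (Real.log (x / (1 - x))) = x := by
    intro x hx
    have h1 : 0 < 1 - x := sub_pos.2 hx.2
    simp only [hv]
    rw [Real.exp_log (div_pos hx.1 h1)]
    field_simp
    ring
  -- The decay of f makes its extension by 0 continuous at the endpoints, so Weierstrass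
  -- approximation applies on [0, 1].
  have hFle : ∀ x ∈ Icc (0 : ℝ) 1, |F x| ≤ M * (x * (1 - x)) := by
    intro x hx
    by_cases hx' : x ∈ Ioo (0 : ℝ) 1
    · rw [hF, indicator_of_mem hx']
      have h1 := hM (Real.log (x / (1 - x)))
      have h2 := hvinv x hx'
      have h3 : (1 + Real.exp (Real.log (x / (1 - x))))⁻¹ = 1 - x := by
        simp only [hv] at h2
        linarith
      rw [h3, sub_sub_cancel] at h1
      exact h1
    · rw [hF, indicator_of_notMem hx', abs_zero]
      exact mul_nonneg hM0 (mul_nonneg hx.1 (sub_nonneg.2 hx.2))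
  have hFc : ContinuousOn F (Icc 0 1) := by
    intro x hx
    by_cases hx' : x ∈ Ioo (0 : ℝ) 1
    · have h1 : ContinuousAt (fun x => f (Real.log (x / (1 - x)))) x := by
        have h2 : 1 - x ≠ 0 := (sub_pos.2 hx'.2).ne'
        refine hc.continuousAt.comp (ContinuousAt.log ?_ (div_ne_zero hx'.1.ne' h2))
        exact continuousAt_id.div (by fun_prop) h2
      refine (h1.congr ?_).continuousWithinAt
      filter_upwards [isOpen_Ioo.mem_nhds hx'] with y hy
      rw [hF, indicator_of_mem hy]
    · have hx0 : x * (1 - x) = 0 := by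
        rw [mem_Ioo, not_and_or, not_lt, not_lt] at hx'
        rcases hx' with h | h
        · rw [le_antisymm h hx.1, zero_mul]
        · rw [le_antisymm hx.2 h, sub_self, mul_zero]
      rw [ContinuousWithinAt, show F x = 0 by rw [hF, indicator_of_notMem hx']]
      have h1 : Tendsto (fun y : ℝ => M * (y * (1 - y))) (𝓝[Icc 0 1] x) (𝓝 0) := by
        have h2 : Continuous fun y : ℝ => M * (y * (1 - y)) := by fun_prop
        have h3 := (h2.tendsto x).mono_left (nhdsWithin_le_nhds (s := Icc 0 1))
        rwa [hx0, mul_zero] at h3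
      exact squeeze_zero_norm' (eventually_mem_nhdsWithin.mono hFle) h1
  have hsq : Integrable fun s => f s * f s := by
    refine (hi.norm.const_mul M).mono' (by fun_prop) (Eventually.of_forall fun s => ?_)
    rw [norm_mul]
    refine mul_le_mul_of_nonneg_right ?_ (norm_nonneg _)
    rw [Real.norm_eq_abs]
    refine (hM s).trans (mul_le_of_le_one_right hM0 ?_)
    have h1 := (hvmem s)
    simp only [hv, mem_Ioo] at h1
    nlinarith [h1.1, h1.2]
  -- Subtracting from one factor f a polynomial in v costs nothing, since f is orthogonal to it; the
  -- remaining factor is uniformly small.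
  have hle : ∫ s, f s * f s ≤ 0 := by
    refine le_of_forall_pos_le_add fun ε hε => ?_
    set I := ∫ s, |f s| with hId
    have hI : 0 ≤ I := integral_nonneg fun s => abs_nonneg _
    obtain ⟨q, hq⟩ := exists_polynomial_near_of_continuousOn 0 1 F hFc
      (ε / (I + 1)) (by positivity)
    obtain ⟨hq1, hq2⟩ := hpoly q
    have h1 : ∫ s, f s * f s = ∫ s, (f s * f s - q.eval (v s) * f s) := by
      rw [integral_sub hsq hq1, hq2, sub_zero]
    rw [h1]
    calc _ ≤ ∫ s, ε / (I + 1) * |f s| := by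
          refine integral_mono (hsq.sub hq1) (hi.abs.const_mul _) fun s => ?_
          have h2 := hq (v s) ⟨(hvmem s).1.le, (hvmem s).2.le⟩
          rw [hFv, abs_sub_comm] at h2
          refine (le_abs_self _).trans ?_
          rw [← sub_mul, abs_mul]
          exact mul_le_mul_of_nonneg_right h2.le (abs_nonneg _)
      _ = ε * (I / (I + 1)) := by
          rw [integral_const_mul, ← hId]
          ring
      _ ≤ 0 + ε := by
          rw [zero_add]
          refine mul_le_of_le_one_right hε.le ?_
          rw [div_le_one (by linarith)]
          linarith
  have hzero : (fun s => f s * f s) = 0 := by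
    have h1 := (integral_eq_zero_iff_of_nonneg (fun s => mul_self_nonneg (f s)) hsq).1
      (le_antisymm hle (integral_nonneg fun s => mul_self_nonneg (f s)))
    exact (Continuous.ae_eq_iff_eq volume (by fun_prop) continuous_const).1 h1
  exact mul_self_eq_zero.1 (congrFun hzero s)

theorem StripDecay.eq_zero_of_forall_real {ω C δ : ℝ} {g : ℂ → ℂ} (hg : StripDecay ω C δ g)
    (hω : 0 < ω) (h0 : ∀ s : ℝ, g s = 0) {w : ℂ} (hw : |w.im| < ω) : g w = 0 := by
  have hset : {w : ℂ | |w.im| < ω} = Complex.im ⁻¹' Ioo (-ω) ω := by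
    ext w
    simp [abs_lt]
  have hopen : IsOpen {w : ℂ | |w.im| < ω} := by
    rw [hset]
    exact isOpen_Ioo.preimage Complex.continuous_im
  have hconn : IsPreconnected {w : ℂ | |w.im| < ω} := by
    rw [hset]
    exact ((convex_Ioo _ _).linear_preimage Complex.imLm).isPreconnected
  refine (hg.differentiableOn.analyticOnNhd hopen).eqOn_zero_of_preconnected_of_frequently_eq_zero
    hconn (z₀ := 0) (by simpa using hω) ?_ hw
  have h1 : Tendsto (fun s : ℝ => (s : ℂ)) (𝓝[≠] 0) (𝓝[≠] 0) := by
    refine tendsto_nhdsWithin_iff.2 ⟨?_, ?_⟩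
    · exact (Complex.continuous_ofReal.tendsto' 0 0 Complex.ofReal_zero).mono_left
        nhdsWithin_le_nhds
    · filter_upwards [self_mem_nhdsWithin] with s hs
      simpa using hs
  exact h1.frequently (Eventually.of_forall h0).frequently

/-- Nonvanishing of one of the moments of a nonzero function. -/
theorem StripDecay.exists_integral_ne_zero {ω C δ : ℝ} {g : ℂ → ℂ} (hg : StripDecay ω C δ g)
    (hω : 0 < ω) {w : ℂ} (hw : |w.im| < ω) (hgw : g w ≠ 0) :
    ∃ k : ℕ, ∫ s : ℝ, (1 - logistic s) ^ (k + 1) * logistic s * g s ≠ 0 := by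
  by_contra! hcon
  refine hgw (hg.eq_zero_of_forall_real hω (fun s => ?_) hw)
  have hlog : ∀ s : ℝ, logistic s = (((1 + Real.exp s)⁻¹ : ℝ) : ℂ) := fun s => by
    rw [logistic]
    push_cast
    rfl
  have hgc : Continuous fun s : ℝ => g s := by simpa using hg.continuous_line (y := 0) (by simpa)
  have hgi : Integrable fun s : ℝ => g s := by simpa using hg.integrable_line (y := 0) (by simpa)
  have hgb : ∀ s : ℝ, ‖g s‖ ≤ C := fun s => by
    have h1 := hg.norm_le s (by simpa)
    refine h1.trans (mul_le_of_le_one_right (hg.nonneg hω) ?_)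
    rw [Real.exp_le_one_iff]
    have := hg.pos
    simp only [Left.neg_nonpos_iff]
    positivity
  set u : ℝ → ℝ := fun s => (1 + Real.exp s)⁻¹ with hu
  have hu' : ∀ s, 0 < u s ∧ u s < 1 := fun s => by
    have := one_sub_inv_one_add_exp_mem s
    exact ⟨by linarith [this.2], by linarith [this.1]⟩
  have huc : Continuous u := Continuous.inv₀ (by fun_prop) fun s => by positivity
  have hint : ∀ k : ℕ, Integrable fun s : ℝ => (((1 - u s) ^ (k + 1) * u s : ℝ) : ℂ) * g s := by
    intro k
    have hc : Continuous fun s : ℝ => (((1 - u s) ^ (k + 1) * u s : ℝ) : ℂ) * g s :=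
      (Complex.continuous_ofReal.comp (((continuous_const.sub huc).pow _).mul huc)).mul hgc
    refine hgi.norm.mono' hc.aestronglyMeasurable (Eventually.of_forall fun s => ?_)
    rw [norm_mul, Complex.norm_real, Real.norm_of_nonneg (mul_nonneg (pow_nonneg
      (by linarith [(hu' s).2]) _) (hu' s).1.le)]
    refine mul_le_of_le_one_left (norm_nonneg _) (mul_le_one₀ (pow_le_one₀
      (by linarith [(hu' s).2]) (by linarith [(hu' s).1])) (hu' s).1.le (hu' s).2.le)
  -- The real and imaginary parts are treated alike. The weight (1 - u) u, taken from (1 - l)^(k+1)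
  -- l, provides the decay required of the test function.
  have hpart : ∀ L : ℂ →L[ℝ] ℝ, ‖L‖ ≤ 1 → L (g s) = 0 := by
    intro L hL
    have hLz : ∀ z, |L z| ≤ ‖z‖ := fun z => by simpa using L.le_of_opNorm_le hL z
    have hLc : Continuous fun s : ℝ => (1 - u s) * u s * L (g s) :=
      ((continuous_const.sub huc).mul huc).mul (L.continuous.comp hgc)
    have h1 := eq_zero_of_forall_integral_pow_mul (f := fun s => (1 - u s) * u s * L (g s))
      (M := C) hLc (((hgi.norm).mono' hLc.aestronglyMeasurable (Eventually.of_forall fun s => by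
        rw [norm_mul, Real.norm_of_nonneg (mul_nonneg (by linarith [(hu' s).2]) (hu' s).1.le)]
        refine le_trans ?_ (hLz (g s))
        refine mul_le_of_le_one_left (norm_nonneg _) ?_
        nlinarith [(hu' s).1, (hu' s).2]))) (fun s => by
        rw [abs_mul, abs_of_nonneg (mul_nonneg (by linarith [(hu' s).2]) (hu' s).1.le), mul_comm]
        exact mul_le_mul_of_nonneg_right ((hLz _).trans (hgb s))
          (mul_nonneg (by linarith [(hu' s).2]) (hu' s).1.le)) (fun k => by
        have h2 := congrArg L (hcon k)
        simp only [hlog] at h2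
        rw [map_zero] at h2
        refine Eq.trans ?_ h2
        have h3 : ∀ s : ℝ, (1 - (((1 + Real.exp s)⁻¹ : ℝ) : ℂ)) ^ (k + 1) *
            (((1 + Real.exp s)⁻¹ : ℝ) : ℂ) * g s = (((1 - u s) ^ (k + 1) * u s : ℝ) : ℂ) * g s := by
          intro s
          push_cast [hu]
          rfl
        simp only [h3]
        rw [← ContinuousLinearMap.integral_comp_comm L (hint k)]
        refine integral_congr_ae (Eventually.of_forall fun s => ?_)
        beta_reduce
        rw [← Complex.real_smul, map_smul, smul_eq_mul, pow_succ]
        ring) s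
    have h4 : (1 - u s) * u s ≠ 0 := mul_ne_zero (by linarith [(hu' s).2]) (hu' s).1.ne'
    exact (mul_eq_zero.1 h1).resolve_left h4
  exact Complex.ext (hpart Complex.reCLM Complex.reCLM_norm.le)
    (hpart Complex.imCLM Complex.imCLM_norm.le)

end Moments

/-! ### Comparison of norms with those of t A T(t) -/

section Domination

theorem lintegral_Ioi_eq_lintegral_exp (f : ℝ → ℝ≥0∞) :
    ∫⁻ t in Ioi 0, f t = ∫⁻ s, ENNReal.ofReal (Real.exp s) * f (Real.exp s) := by
  have h := lintegral_image_eq_lintegral_abs_deriv_mul MeasurableSet.univ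
    (fun x _ => (Real.hasDerivAt_exp x).hasDerivWithinAt) Real.exp_injective.injOn f
  rw [image_univ, Real.range_exp] at h
  simpa using h

theorem integral_Ioi_eq_integral_exp {E : Type*} [NormedAddCommGroup E] [NormedSpace ℝ E]
    (f : ℝ → E) : ∫ t in Ioi 0, f t = ∫ s, Real.exp s • f (Real.exp s) := by
  have h := integral_image_eq_integral_abs_deriv_smul MeasurableSet.univ
    (fun x _ => (Real.hasDerivAt_exp x).hasDerivWithinAt) Real.exp_injective.injOn f
  rw [image_univ, Real.range_exp] at h
  simpa using h

variable {X : Type*} [NormedAddCommGroup X] [NormedSpace ℂ X]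

/-- The `L¹` and the sup norm of `F(·) x` over `ℝ` are bounded by those of `G(·) x`, uniformly
in `x`. -/
def NormDominated (F G : ℝ → X →L[ℂ] X) : Prop :=
  ∃ C : ℝ≥0, ∀ x : X, ∫⁻ τ, ‖F τ x‖ₑ ≤ C * ∫⁻ τ, ‖G τ x‖ₑ ∧
    ⨆ τ, ‖F τ x‖ₑ ≤ C * ⨆ τ, ‖G τ x‖ₑ

theorem NormDominated.trans {F G H : ℝ → X →L[ℂ] X} (h₁ : NormDominated F G)
    (h₂ : NormDominated G H) : NormDominated F H := by
  obtain ⟨C₁, h₁⟩ := h₁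
  obtain ⟨C₂, h₂⟩ := h₂
  refine ⟨C₁ * C₂, fun x => ⟨?_, ?_⟩⟩
  · refine (h₁ x).1.trans ?_
    rw [ENNReal.coe_mul, mul_assoc]
    exact mul_le_mul' le_rfl (h₂ x).1
  · refine (h₁ x).2.trans ?_
    rw [ENNReal.coe_mul, mul_assoc]
    exact mul_le_mul' le_rfl (h₂ x).2

theorem NormDominated.of_forall_le {F G : ℝ → X →L[ℂ] X} (C : ℝ≥0)
    (h : ∀ τ x, ‖F τ x‖ₑ ≤ C * ‖G τ x‖ₑ) : NormDominated F G := by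
  refine ⟨C, fun x => ⟨?_, ?_⟩⟩
  · rw [← lintegral_const_mul' _ _ ENNReal.coe_ne_top]
    exact lintegral_mono fun τ => h τ x
  · refine iSup_le fun τ => (h τ x).trans (mul_le_mul' le_rfl ?_)
    exact le_iSup (fun τ => ‖G τ x‖ₑ) τ

theorem lintegral_exp_neg_mul_abs {ε : ℝ} (hε : 0 < ε) :
    ∫⁻ s : ℝ, ENNReal.ofReal (Real.exp (-(ε * |s|))) = ENNReal.ofReal (2 / ε) := by
  rw [← integral_exp_neg_mul_abs hε, ofReal_integral_eq_lintegral_ofReal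
    (integrable_exp_neg_mul_abs hε) (Eventually.of_forall fun s => (Real.exp_pos _).le)]

/-- Young's inequality for p = 1 and p = ∞; the kernel has mass 2/ε. -/
theorem KernelDominated.normDominated {F G : ℝ → X →L[ℂ] X} (h : KernelDominated F G)
    (hG : ∀ x, AEMeasurable fun τ => ‖G τ x‖ₑ) : NormDominated F G := by
  obtain ⟨C, ε, hε, h⟩ := h
  have hk : ∀ σ : ℝ, ∫⁻ τ : ℝ, ENNReal.ofReal (Real.exp (-(ε * |τ - σ|))) =
      ENNReal.ofReal (2 / ε) := fun σ => by
    rw [lintegral_sub_right_eq_self (fun s => ENNReal.ofReal (Real.exp (-(ε * |s|)))) σ,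
      lintegral_exp_neg_mul_abs hε]
  refine ⟨C * (2 / ε).toNNReal, fun x => ⟨?_, ?_⟩⟩
  · calc ∫⁻ τ, ‖F τ x‖ₑ
        ≤ ∫⁻ τ, C * ∫⁻ σ, ENNReal.ofReal (Real.exp (-(ε * |τ - σ|))) * ‖G σ x‖ₑ :=
          lintegral_mono fun τ => h τ x
      _ = C * ∫⁻ τ, ∫⁻ σ, ENNReal.ofReal (Real.exp (-(ε * |τ - σ|))) * ‖G σ x‖ₑ :=
          lintegral_const_mul' _ _ ENNReal.coe_ne_top
      _ = C * ∫⁻ σ, ∫⁻ τ, ENNReal.ofReal (Real.exp (-(ε * |τ - σ|))) * ‖G σ x‖ₑ := by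
          rw [lintegral_lintegral_swap]
          refine AEMeasurable.mul
            (f := fun p : ℝ × ℝ => ENNReal.ofReal (Real.exp (-(ε * |p.1 - p.2|))))
            (g := fun p : ℝ × ℝ => ‖G p.2 x‖ₑ) (by fun_prop) ?_
          exact (hG x).comp_quasiMeasurePreserving Measure.quasiMeasurePreserving_snd
      _ = C * ∫⁻ σ, ENNReal.ofReal (2 / ε) * ‖G σ x‖ₑ := by
          congr 1
          refine lintegral_congr fun σ => ?_
          rw [lintegral_mul_const _ (by fun_prop), hk σ]
      _ = _ := by
          rw [lintegral_const_mul' _ _ ENNReal.ofReal_ne_top, ← mul_assoc, ENNReal.coe_mul]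
          rfl
  · refine iSup_le fun τ => (h τ x).trans ?_
    rw [ENNReal.coe_mul, mul_assoc]
    refine mul_le_mul' le_rfl ?_
    calc _ ≤ ∫⁻ σ, ENNReal.ofReal (Real.exp (-(ε * |τ - σ|))) * ⨆ τ, ‖G τ x‖ₑ :=
          lintegral_mono fun σ => mul_le_mul' le_rfl (le_iSup (fun τ => ‖G τ x‖ₑ) σ)
      _ = _ := by
          rw [lintegral_mul_const _ (by fun_prop)]
          simp only [abs_sub_comm τ]
          rw [hk τ]
          rfl

/-- The operators `t A T(t)`, `t = e^τ`. -/
def scaledDeriv (D : ℝ → X →L[ℂ] X) (τ : ℝ) : X →L[ℂ] X := (Real.exp τ : ℂ) • D (Real.exp τ)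

theorem lintegral_deriv_eq (D : ℝ → X →L[ℂ] X) (x : X) :
    ∫⁻ t in Ioi (0 : ℝ), ‖D t x‖ₑ = ∫⁻ τ, ‖scaledDeriv D τ x‖ₑ := by
  rw [lintegral_Ioi_eq_lintegral_exp]
  refine lintegral_congr fun s => ?_
  rw [scaledDeriv, smul_apply, enorm_smul]
  congr 1
  rw [← ofReal_norm, Complex.norm_real, Real.norm_of_nonneg (Real.exp_pos s).le]

theorem iSup_Ioi_eq_iSup_exp (f : ℝ → ℝ≥0∞) : ⨆ t ∈ Ioi (0 : ℝ), f t = ⨆ s, f (Real.exp s) := by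
  rw [← Real.range_exp, iSup_range]

namespace IsAnalyticGenerator

variable {A : X →ₗ.[ℂ] X} {T D : ℝ → X →L[ℂ] X} {M : ℝ}

theorem continuous_scaledDeriv (h : IsAnalyticGenerator A T D M) : Continuous (scaledDeriv D) :=
  (Complex.continuous_ofReal.comp Real.continuous_exp).smul
    (h.continuousOn_deriv.comp_continuous Real.continuous_exp fun s => Real.exp_pos s)

/-- Pointwise in t: t A T(t) = B² tA(1 + tA)⁻² with B = (1 + tA) T(t/2), and ‖B‖ ≤ M + t · 2M/t =
3M. -/
theorem normDominated_scaledDeriv_logSquare (h : IsAnalyticGenerator A T D M) :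
    NormDominated (scaledDeriv D) (logSquare A) := by
  have hM := h.pos
  refine NormDominated.of_forall_le (3 * M * (3 * M)).toNNReal fun τ x => ?_
  set t := Real.exp τ with htd
  have ht : 0 < t := Real.exp_pos τ
  have ht2 : 0 < t / 2 := half_pos ht
  set J := oneAddInv A t with hJ
  set B := T (t / 2) + (t : ℂ) • D (t / 2) with hB
  have hBJ : B * J = T (t / 2) := by
    rw [hB, add_mul, smul_mul_assoc, h.comm_oneAddInv ht ht2, h.comm_oneAddInv_deriv ht ht2,
      ← mul_smul_comm, ← mul_add, h.add_deriv_mul_oneAddInv ht ht2]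
  have hB1J : B * (1 - J) = (t : ℂ) • D (t / 2) := by
    rw [mul_sub, mul_one, hBJ, hB, add_sub_cancel_left]
  have hBBP : B * B * logSquare A τ = scaledDeriv D τ := by
    rw [logSquare, ← htd, ← hJ, mul_assoc, ← mul_assoc B (1 - J), hB1J, smul_mul_assoc,
      h.comm_oneAddInv_deriv ht ht2, mul_smul_comm, ← mul_assoc, ← hJ, hBJ,
      ← h.deriv_add ht2 ht2, add_halves]
    rfl
  have hBn : ‖B‖ ≤ 3 * M := by
    have h1 := h.norm_le _ ht2
    have h2 := h.norm_deriv_le _ ht2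
    calc ‖B‖ ≤ ‖T (t / 2)‖ + ‖(t : ℂ) • D (t / 2)‖ := norm_add_le _ _
      _ ≤ M + t * (M / (t / 2)) := by
        rw [norm_smul, Complex.norm_real, Real.norm_of_nonneg ht.le]
        gcongr
      _ = 3 * M := by
        field_simp
        norm_num
  change _ ≤ ENNReal.ofReal _ * _
  rw [← hBBP, ← ofReal_norm, ← ofReal_norm, ← ENNReal.ofReal_mul (by positivity)]
  refine ENNReal.ofReal_le_ofReal ?_
  rw [mul_apply_eq_comp]
  refine (B * B).le_of_opNorm_le ((norm_mul_le _ _).trans ?_) _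
  exact mul_le_mul hBn hBn (norm_nonneg _) (by positivity)

/-- Formally, tA applied to (1 + tA)⁻² = ∫ t⁻² s e^{-s/t} T(s) ds. The extra factor s compensates ‖A
T(s)‖ ≤ M/s, so the integral converges at 0. -/
theorem logSquare_apply_eq [CompleteSpace X] (h : IsAnalyticGenerator A T D M) {t : ℝ} (ht : 0 < t)
    (x : X) : ((1 - oneAddInv A t) * oneAddInv A t) x = ∫ s in Ioi (0 : ℝ),
      ((Real.exp (-(t⁻¹ * s)) * (t⁻¹ * s) : ℝ) : ℂ) • D s x := by
  set J := oneAddInv A t with hJ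
  set r := t⁻¹ with hr
  have hr0 : 0 < r := inv_pos.2 ht
  have hM := h.pos
  set y := x - J x with hy
  set z := J y with hz
  have hzP : ((1 - J) * J) x = z := by
    rw [hz, hy, map_sub, mul_apply_eq_comp]
    rfl
  set c : ℝ → ℂ := fun s => ((Real.exp (-(r * s)) : ℝ) : ℂ) with hc
  have hcd : ∀ s, HasDerivAt c (-(r : ℂ) * c s) s := by
    intro s
    have h1 : HasDerivAt (fun s : ℝ => Real.exp (-(r * s))) (-r * Real.exp (-(r * s))) s := by
      have := (((hasDerivAt_id s).const_mul r).neg).exp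
      refine this.congr_deriv ?_
      simp only [id, Pi.neg_apply]
      ring
    refine h1.ofReal_comp.congr_deriv ?_
    push_cast [hc]
    ring
  have hDJ : ∀ s, 0 < s → ∀ v, D s (J v) = (r : ℂ) • T s (v - J v) := by
    intro s hs v
    have h1 := DFunLike.congr_fun (h.deriv_mul_oneAddInv ht hs) v
    rw [smul_apply, mul_apply_eq_comp, mul_apply_eq_comp] at h1
    have h2 : (T s) ((1 - J) v) = T s (v - J v) := rfl
    rw [h2] at h1
    rw [← h1, smul_smul, hr, Complex.ofReal_inv, inv_mul_cancel₀ (by exact_mod_cast ht.ne'),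
      one_smul]
  -- An explicit antiderivative using y = (1 - (1 + tA)⁻¹) x and z = (1 + tA)⁻¹ y. Its limit at 0
  -- exists because z lies in D(A) and the coefficient of T(s) y vanishes there.
  have hd : ∀ s ∈ Ioi (0 : ℝ), HasDerivAt
      (fun s : ℝ => -((c s * (r * s : ℝ)) • T s y + c s • T s z))
      (((Real.exp (-(r * s)) * (r * s) : ℝ) : ℂ) • D s x) s := by
    intro s hs
    have h1 := (h.hasDerivAt s hs).clm_apply_const y
    have h2 := (h.hasDerivAt s hs).clm_apply_const z
    have h3 : HasDerivAt (fun s : ℝ => ((r * s : ℝ) : ℂ)) (r : ℂ) s := by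
      have := ((hasDerivAt_id s).const_mul r).ofReal_comp
      simpa using this
    have h4 := ((((hcd s).mul h3).smul h1).add ((hcd s).smul h2)).neg
    refine h4.congr_deriv ?_
    have e1 : D s y = D s x - (r : ℂ) • T s y := by
      rw [hy, map_sub, hDJ s hs x]
    have e2 : D s z = (r : ℂ) • T s y - (r : ℂ) • T s z := by
      rw [hz, hDJ s hs y, map_sub, smul_sub]
    simp only [neg_apply, e1, e2, Pi.mul_apply]
    push_cast [hc]
    module
  have hbdd : ∀ v : X, ∀ s ∈ Ioi (0 : ℝ), ‖T s v‖ ≤ M * ‖v‖ := fun v s hs =>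
    (T s).le_of_opNorm_le (h.norm_le s hs) v
  have hc0 : Tendsto c (𝓝[>] 0) (𝓝 1) := by
    have h1 : Continuous c := by fun_prop
    have h2 := h1.tendsto 0
    simp only [hc, mul_zero, neg_zero, Real.exp_zero, Complex.ofReal_one] at h2
    exact h2.mono_left nhdsWithin_le_nhds
  have hl0 : Tendsto (fun s : ℝ => -((c s * (r * s : ℝ)) • T s y + c s • T s z)) (𝓝[>] 0)
      (𝓝 (-z)) := by
    have h1 : Tendsto (fun s : ℝ => c s * (r * s : ℝ)) (𝓝[>] 0) (𝓝 0) := by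
      have h1 : Continuous fun s : ℝ => c s * (r * s : ℝ) := by fun_prop
      have h2 := h1.tendsto 0
      simp only [mul_zero, Complex.ofReal_zero] at h2
      exact h2.mono_left nhdsWithin_le_nhds
    have h2 : Tendsto (fun s : ℝ => (c s * (r * s : ℝ)) • T s y) (𝓝[>] 0) (𝓝 0) := by
      have h3 : Tendsto (fun s : ℝ => ‖c s * (r * s : ℝ)‖ * (M * ‖y‖)) (𝓝[>] 0) (𝓝 0) := by
        simpa using h1.norm.mul_const (M * ‖y‖)
      refine squeeze_zero_norm' ?_ h3
      filter_upwards [self_mem_nhdsWithin] with s hs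
      rw [norm_smul]
      exact mul_le_mul_of_nonneg_left (hbdd y s hs) (norm_nonneg _)
    have h3 := (h2.add (hc0.smul (h.tendsto_oneAddInv ht y))).neg
    rwa [zero_add, one_smul] at h3
  have hexp : Tendsto (fun s : ℝ => r * s) atTop atTop := tendsto_id.const_mul_atTop hr0
  have hcn : ∀ s, ‖c s‖ = Real.exp (-(r * s)) := fun s => by
    rw [hc, Complex.norm_real, Real.norm_of_nonneg (Real.exp_pos _).le]
  have hlT : Tendsto (fun s : ℝ => -((c s * (r * s : ℝ)) • T s y + c s • T s z)) atTop (𝓝 0) := by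
    have h1 : Tendsto (fun s : ℝ => Real.exp (-(r * s)) * (r * s) * (M * ‖y‖) +
        Real.exp (-(r * s)) * (M * ‖z‖)) atTop (𝓝 0) := by
      have h2 := (Real.tendsto_pow_mul_exp_neg_atTop_nhds_zero 1).comp hexp
      have h3 := Real.tendsto_exp_neg_atTop_nhds_zero.comp hexp
      have h4 := (h2.mul_const (M * ‖y‖)).add (h3.mul_const (M * ‖z‖))
      rw [zero_mul, zero_mul, add_zero] at h4
      refine h4.congr fun s => ?_
      simp only [Function.comp_apply, pow_one]
      ring
    refine squeeze_zero_norm' ?_ h1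
    filter_upwards [Ioi_mem_atTop 0] with s hs
    have hs0 : 0 < s := hs
    rw [norm_neg]
    refine (norm_add_le _ _).trans ?_
    rw [norm_smul, norm_smul, norm_mul, hcn, Complex.norm_real,
      Real.norm_of_nonneg (mul_nonneg hr0.le hs0.le)]
    exact add_le_add (mul_le_mul_of_nonneg_left (hbdd y s hs) (by positivity))
      (mul_le_mul_of_nonneg_left (hbdd z s hs) (by positivity))
  have hi : IntegrableOn (fun s : ℝ => ((Real.exp (-(r * s)) * (r * s) : ℝ) : ℂ) • D s x)
      (Ioi 0) := by
    have h1 : IntegrableOn (fun s : ℝ => r * M * ‖x‖ * Real.exp (-r * s)) (Ioi 0) :=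
      (exp_neg_integrableOn_Ioi 0 hr0).const_mul _
    refine h1.mono' ?_ ?_
    · refine ContinuousOn.aestronglyMeasurable ?_ measurableSet_Ioi
      exact (by fun_prop : Continuous fun s : ℝ =>
        ((Real.exp (-(r * s)) * (r * s) : ℝ) : ℂ)).continuousOn.smul
          (h.continuousOn_deriv.clm_apply continuousOn_const)
    · filter_upwards [ae_restrict_mem measurableSet_Ioi] with s hs
      have hs0 : 0 < s := hs
      rw [norm_smul, Complex.norm_real, Real.norm_of_nonneg (by positivity)]
      have h2 := (D s).le_of_opNorm_le (h.norm_deriv_le s hs) x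
      calc _ ≤ Real.exp (-(r * s)) * (r * s) * (M / s * ‖x‖) := by gcongr
        _ = _ := by
          rw [neg_mul]
          field_simp
  rw [hzP, integral_Ioi_of_hasDerivAt_of_tendsto_nhdsGT hd hi hl0 hlT, zero_sub, neg_neg]

theorem kernelDominated_logSquare_scaledDeriv [CompleteSpace X] (h : IsAnalyticGenerator A T D M) :
    KernelDominated (logSquare A) (scaledDeriv D) := by
  refine ⟨1, 1, one_pos, fun τ x => ?_⟩
  rw [logSquare, h.logSquare_apply_eq (Real.exp_pos τ)]
  refine (enorm_integral_le_lintegral_enorm _).trans ?_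
  rw [lintegral_Ioi_eq_lintegral_exp, ENNReal.coe_one, one_mul]
  refine lintegral_mono fun s => ?_
  rw [scaledDeriv, smul_apply, enorm_smul, enorm_smul, ← mul_assoc (ENNReal.ofReal (Real.exp s)),
    ← mul_assoc (ENNReal.ofReal (Real.exp (-(1 * |τ - s|))))]
  refine mul_le_mul' ?_ le_rfl
  rw [← ofReal_norm, ← ofReal_norm, Complex.norm_real, Complex.norm_real,
    Real.norm_of_nonneg (Real.exp_pos s).le, Real.norm_of_nonneg (by positivity),
    ← ENNReal.ofReal_mul (Real.exp_pos _).le, ← ENNReal.ofReal_mul (Real.exp_pos _).le]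
  refine ENNReal.ofReal_le_ofReal ?_
  have h1 : (Real.exp τ)⁻¹ * Real.exp s = Real.exp (s - τ) := by
    rw [Real.exp_sub]
    ring
  rw [h1, mul_comm, ← Real.exp_add]
  -- With u = s - τ the kernel is exp(u - e^u), and u - e^u ≤ -|u|; for u ≥ 0 this is 2u ≤ 1 + u +
  -- u²/2 ≤ e^u.
  refine mul_le_mul_of_nonneg_right (Real.exp_le_exp.2 ?_) (Real.exp_pos s).le
  rw [one_mul, abs_sub_comm]
  have h2 := Real.add_one_le_exp (s - τ)
  rcases le_total 0 (s - τ) with h0 | h0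
  · rw [abs_of_nonneg h0]
    have h3 := Real.quadratic_le_exp_of_nonneg h0
    nlinarith [sq_nonneg (s - τ - 1)]
  · rw [abs_of_nonpos h0]
    have := Real.exp_pos (s - τ)
    linarith

end IsAnalyticGenerator

namespace SectorBound

variable {A : X →ₗ.[ℂ] X} {φ K ν ω C δ : ℝ} {g : ℂ → ℂ}

theorem continuous_logSquare (h : SectorBound A φ K) : Continuous (logSquare A) := by
  have h1 : ∀ τ : ℝ, oneAddInv A (Real.exp τ) =
      logResolvent A ((-τ : ℝ) + (Real.pi : ℝ) * Complex.I) := by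
    intro τ
    rw [logResolvent, oneAddInv, Complex.exp_add, Complex.exp_pi_mul_I, ← Complex.ofReal_exp,
      Real.exp_neg]
    congr 1
    push_cast
    ring
  have h2 : Continuous fun τ : ℝ => oneAddInv A (Real.exp τ) := by
    simp only [h1]
    rw [continuous_iff_continuousAt]
    intro τ
    have := h.lt
    have hpi := Real.pi_pos
    exact ContinuousAt.comp (f := fun s : ℝ => ((-s : ℝ) + (Real.pi : ℝ) * Complex.I : ℂ))
      (h.differentiableAt_logResolvent (by simp; linarith) (by simp; linarith)).continuousAt
      (by fun_prop)
  exact (continuous_const.sub h2).mul h2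

theorem aestronglyMeasurable_logCalc (h : SectorBound A φ K) (hg : StripDecay ω C δ g) (hν : φ < ν)
    (hν' : ν < ω) (hω : ω ≤ Real.pi / 2) :
    AEStronglyMeasurable (fun τ : ℝ => logCalc A ν fun w => g (w + τ)) volume := by
  have hpi := Real.pi_pos
  have hνabs : |ν| = ν := abs_of_pos (h.pos.trans hν)
  have hc : ∀ y : ℝ, |y| = ν → Continuous fun p : ℝ × ℝ =>
      g (p.2 + y * Complex.I + p.1) • logResolvent A (p.2 + y * Complex.I) := fun y hy =>
    (hg.continuous_shift (by rwa [hy])).smul ((h.continuous_logResolvent_line (y := y)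
      (by rwa [hy]) (by linarith)).comp continuous_snd)
  have h1 := ((hc (-ν) (by rwa [abs_neg])).sub (hc ν hνabs)).stronglyMeasurable
  exact (h1.integral_prod_right.const_smul (2 * Real.pi * Complex.I : ℂ)⁻¹).aestronglyMeasurable

end SectorBound

end Domination

/-! ### Assembly: from γ(tA) to the two conditions -/

section Final

variable {X : Type*} [NormedAddCommGroup X] [NormedSpace ℂ X]

theorem IsAnalyticGenerator.exists_sectorBound {A : X →ₗ.[ℂ] X} {T D : ℝ → X →L[ℂ] X} {M : ℝ}
    (h : IsAnalyticGenerator A T D M) {ν : ℝ} (hν : sectorialityAngle A < ν)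
    (hν' : ν < Real.pi / 2) : ∃ φ K, φ < ν ∧ SectorBound A φ K := by
  obtain ⟨φ, K, h1, h2, -, h3⟩ := h.exists_bound hν (by linarith [Real.pi_pos])
  exact ⟨φ, K, h2, h1, h2.trans hν', fun z hz hz' => (h3 z hz hz').1, fun z hz hz' => (h3 z hz hz').2⟩

theorem MemHInfZero.exists_stripDecay {ω : ℝ} {γ : ℂ → ℂ} (hγ : MemHInfZero ω γ)
    (hω : ω ≤ Real.pi / 2) : ∃ C δ, StripDecay ω C δ fun w => γ (Complex.exp w) := by
  obtain ⟨⟨hd, -⟩, C, α, hC, hα, hb⟩ := hγ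
  have hpi := Real.pi_pos
  have hmem : ∀ w : ℂ, |w.im| < ω → Complex.exp w ∈ sector ω := by
    intro w hw
    refine ⟨Complex.exp_ne_zero w, ?_⟩
    have h1 := abs_lt.1 hw
    rw [← Complex.log_im, Complex.log_exp (by linarith) (by linarith)]
    exact hw
  refine ⟨C, α, hα, hd.comp (by fun_prop) hmem, fun w hw => (hb _ (hmem w hw)).trans ?_⟩
  rw [Complex.norm_exp, ← Real.exp_mul, ← Real.exp_mul]
  refine mul_le_mul_of_nonneg_left ?_ hC.le
  rcases le_total 0 w.re with h | h
  · rw [abs_of_nonneg h]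
    exact (min_le_right _ _).trans (Real.exp_le_exp.2 (by linarith))
  · rw [abs_of_nonpos h]
    exact (min_le_left _ _).trans (Real.exp_le_exp.2 (by linarith))

/-- The substitution r = e^(s+τ) moves the dilation from the operator to the argument of γ, so the
resolvents of A alone remain. -/
theorem integral_resolventOp_ray (A : X →ₗ.[ℂ] X) (γ : ℂ → ℂ) (τ y : ℝ) :
    ∫ r in Ioi (0 : ℝ), (γ (r * Complex.exp (y * Complex.I)) * Complex.exp (y * Complex.I)) •
      resolventOp ((Real.exp τ : ℂ) • A) (r * Complex.exp (y * Complex.I)) =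
    ∫ s : ℝ, γ (Complex.exp (s + y * Complex.I + τ)) • logResolvent A (s + y * Complex.I) := by
  rw [integral_Ioi_eq_integral_exp, ← integral_add_right_eq_self _ τ]
  refine integral_congr_ae (Eventually.of_forall fun s => ?_)
  beta_reduce
  have hτ : ((Real.exp τ : ℝ) : ℂ) ≠ 0 := by exact_mod_cast (Real.exp_pos τ).ne'
  have h1 : ((Real.exp (s + τ) : ℝ) : ℂ) * Complex.exp (y * Complex.I) =
      (Real.exp τ : ℂ) * Complex.exp (s + y * Complex.I) := by
    rw [Complex.ofReal_exp, Complex.ofReal_exp, ← Complex.exp_add, ← Complex.exp_add]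
    congr 1
    push_cast
    ring
  have h2 : (Real.exp τ : ℂ) * Complex.exp (s + y * Complex.I) =
      Complex.exp (s + y * Complex.I + τ) := by
    rw [Complex.ofReal_exp, ← Complex.exp_add, add_comm]
  rw [h1, resolventOp_smul A hτ, logResolvent, zResolvent, ← h2, ← Complex.coe_smul, smul_smul,
    smul_smul, smul_smul]
  congr 1
  calc ((Real.exp (s + τ) : ℝ) : ℂ) * (γ ((Real.exp τ : ℂ) * Complex.exp (s + y * Complex.I)) *
        Complex.exp (y * Complex.I)) * (Real.exp τ : ℂ)⁻¹
      = γ ((Real.exp τ : ℂ) * Complex.exp (s + y * Complex.I)) * (Real.exp τ : ℂ)⁻¹ *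
          (((Real.exp (s + τ) : ℝ) : ℂ) * Complex.exp (y * Complex.I)) := by ring
    _ = _ := by
      rw [h1, mul_assoc, inv_mul_cancel_left₀ hτ]

theorem SectorBound.funCalc_eq {A : X →ₗ.[ℂ] X} {φ K ν ω C δ : ℝ} {γ : ℂ → ℂ}
    (h : SectorBound A φ K) (hg : StripDecay ω C δ fun w => γ (Complex.exp w)) (hν : φ < ν)
    (hν' : ν < ω) (hω : ω ≤ Real.pi / 2) (τ : ℝ) :
    funCalc ((Real.exp τ : ℂ) • A) ν γ = logCalc A ν fun w => γ (Complex.exp (w + τ)) := by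
  have hω0 : 0 < ω := (h.pos.trans hν).trans hν'
  have hνabs : |ν| = ν := abs_of_pos (h.pos.trans hν)
  have hpi := Real.pi_pos
  have h1 := integral_resolventOp_ray A γ τ ν
  have h2 := integral_resolventOp_ray A γ τ (-ν)
  have h3 := hg.comp_add hω0 τ
  rw [logCalc, integral_sub
    (h.integrable_smul_logResolvent h3 (by rwa [abs_neg, hνabs]) (by rwa [abs_neg, hνabs])
      (by linarith)) (h.integrable_smul_logResolvent h3 (by rwa [hνabs]) (by rwa [hνabs])
      (by linarith)), ← h1, ← h2, funCalc]
  simp only [Complex.ofReal_neg, neg_mul]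

/-- Equivalence of the norms of `γ(tA) x` and `t A T(t) x`. -/
theorem IsAnalyticGenerator.normDominated_logCalc [CompleteSpace X] {A : X →ₗ.[ℂ] X}
    {T D : ℝ → X →L[ℂ] X} {M : ℝ} (h : IsAnalyticGenerator A T D M) {φ K ω ν C δ : ℝ}
    (hS : SectorBound A φ K) (hω : ω ≤ Real.pi / 2) {g : ℂ → ℂ} (hg : StripDecay ω C δ g)
    {w : ℂ} (hw : |w.im| < ω) (hgw : g w ≠ 0) (hφ : φ < ν) (hν' : ν < ω) :
    NormDominated (fun τ : ℝ => logCalc A ν fun w => g (w + τ)) (scaledDeriv D) ∧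
      NormDominated (scaledDeriv D) (fun τ : ℝ => logCalc A ν fun w => g (w + τ)) := by
  have hω0 : 0 < ω := (hS.pos.trans hφ).trans hν'
  obtain ⟨k, hk⟩ := hg.exists_integral_ne_zero hω0 hw hgw
  have hmeas : ∀ F : ℝ → X →L[ℂ] X, AEStronglyMeasurable F volume → ∀ x,
      AEMeasurable fun τ => ‖F τ x‖ₑ := fun F hF x =>
    (hF.clm_apply_complex aestronglyMeasurable_const).enorm
  have k1 := (hS.kernelDominated_logCalc hg hφ hν' hω).normDominated
    (hmeas _ hS.continuous_logSquare.aestronglyMeasurable)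
  have k2 := h.kernelDominated_logSquare_scaledDeriv.normDominated
    (hmeas _ h.continuous_scaledDeriv.aestronglyMeasurable)
  have k3 := (hS.kernelDominated_logSquare hg hφ hν' hω hk).normDominated
    (hmeas _ (hS.aestronglyMeasurable_logCalc hg hφ hν' hω))
  exact ⟨k1.trans k2, h.normDominated_scaledDeriv_logSquare.trans k3⟩

theorem IsAnalyticGenerator.normDominated_funCalc [CompleteSpace X] {A : X →ₗ.[ℂ] X}
    {T D : ℝ → X →L[ℂ] X} {M : ℝ} (h : IsAnalyticGenerator A T D M) {ω ν : ℝ}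
    (hω : ω ≤ Real.pi / 2) {γ : ℂ → ℂ} (hγ : MemHInfZero ω γ) (hγ0 : ∃ z ∈ sector ω, γ z ≠ 0)
    (hν : sectorialityAngle A < ν) (hν' : ν < ω) :
    NormDominated (fun τ : ℝ => funCalc ((Real.exp τ : ℂ) • A) ν γ) (scaledDeriv D) ∧
      NormDominated (scaledDeriv D) (fun τ : ℝ => funCalc ((Real.exp τ : ℂ) • A) ν γ) := by
  obtain ⟨φ, K, hφ, hS⟩ := h.exists_sectorBound hν (hν'.trans_le hω)
  obtain ⟨C, δ, hg⟩ := hγ.exists_stripDecay hω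
  obtain ⟨z, ⟨hz0, hz⟩, hγz⟩ := hγ0
  have e : (fun τ : ℝ => funCalc ((Real.exp τ : ℂ) • A) ν γ) =
      fun τ : ℝ => logCalc A ν fun w => γ (Complex.exp (w + τ)) :=
    funext fun τ => hS.funCalc_eq hg hφ hν' hω τ
  have e2 : |(Complex.log z).im| < ω := by rw [Complex.log_im]; exact hz
  have e3 : γ (Complex.exp (Complex.log z)) ≠ 0 := by rw [Complex.exp_log hz0]; exact hγz
  have k := h.normDominated_logCalc hS hω hg e2 e3 hφ hν'
  rw [e]
  exact k

theorem lintegral_funCalc_eq (A : X →ₗ.[ℂ] X) (ν : ℝ) (γ : ℂ → ℂ) (x : X) :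
    ∫⁻ t in Ioi (0 : ℝ), ‖(t : ℂ)⁻¹ • funCalc ((t : ℂ) • A) ν γ x‖ₑ =
      ∫⁻ τ : ℝ, ‖funCalc ((Real.exp τ : ℂ) • A) ν γ x‖ₑ := by
  rw [lintegral_Ioi_eq_lintegral_exp]
  refine lintegral_congr fun s => ?_
  rw [enorm_smul, ← mul_assoc]
  have h1 : ENNReal.ofReal (Real.exp s) * ‖((Real.exp s : ℝ) : ℂ)⁻¹‖ₑ = 1 := by
    rw [← ofReal_norm, ← ENNReal.ofReal_mul (Real.exp_pos s).le, norm_inv, Complex.norm_real,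
      Real.norm_of_nonneg (Real.exp_pos s).le, mul_inv_cancel₀ (Real.exp_pos s).ne',
      ENNReal.ofReal_one]
  rw [h1, one_mul]

theorem IsAnalyticGenerator.hasMaximalRegularity_one_iff_l1Condition [CompleteSpace X]
    {A : X →ₗ.[ℂ] X} {T D : ℝ → X →L[ℂ] X} {M : ℝ} (h : IsAnalyticGenerator A T D M) {ω ν : ℝ}
    (hω : ω ≤ Real.pi / 2) {γ : ℂ → ℂ} (hγ : MemHInfZero ω γ) (hγ0 : ∃ z ∈ sector ω, γ z ≠ 0)
    (hν : sectorialityAngle A < ν) (hν' : ν < ω) :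
    HasMaximalRegularity A 1 ↔ L1Condition A ν γ := by
  obtain ⟨⟨C₁, h₁⟩, ⟨C₂, h₂⟩⟩ := h.normDominated_funCalc hω hγ hγ0 hν hν'
  rw [h.hasMaximalRegularity_one_iff, L1Condition]
  simp only [lintegral_deriv_eq, lintegral_funCalc_eq]
  constructor
  · rintro ⟨C, hC⟩
    refine ⟨C₁ * C, fun x => (h₁ x).1.trans ?_⟩
    rw [ENNReal.coe_mul, mul_assoc]
    exact mul_le_mul' le_rfl (hC x)
  · rintro ⟨C, hC⟩
    refine ⟨C₂ * C, fun x => (h₂ x).1.trans ?_⟩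
    rw [ENNReal.coe_mul, mul_assoc]
    exact mul_le_mul' le_rfl (hC x)

theorem IsAnalyticGenerator.derivSupCondition_iff_lInfCondition [CompleteSpace X]
    {A : X →ₗ.[ℂ] X} {T D : ℝ → X →L[ℂ] X} {M : ℝ} (h : IsAnalyticGenerator A T D M) {ω ν : ℝ}
    (hω : ω ≤ Real.pi / 2) {γ : ℂ → ℂ} (hγ : MemHInfZero ω γ) (hγ0 : ∃ z ∈ sector ω, γ z ≠ 0)
    (hν : sectorialityAngle A < ν) (hν' : ν < ω) :
    DerivSupCondition T D ↔ LInfCondition A T ν γ := by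
  obtain ⟨⟨C₁, h₁⟩, ⟨C₂, h₂⟩⟩ := h.normDominated_funCalc hω hγ hγ0 hν hν'
  have e1 : ∀ x, ⨆ t ∈ Ioi (0 : ℝ), ‖(t : ℂ) • D t x‖ₑ = ⨆ τ, ‖scaledDeriv D τ x‖ₑ := fun x =>
    iSup_Ioi_eq_iSup_exp _
  have e2 : ∀ x, ⨆ t ∈ Ioi (0 : ℝ), ‖funCalc ((t : ℂ) • A) ν γ x‖ₑ =
      ⨆ τ : ℝ, ‖funCalc ((Real.exp τ : ℂ) • A) ν γ x‖ₑ := fun x => iSup_Ioi_eq_iSup_exp _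
  simp only [DerivSupCondition, LInfCondition, e1, e2]
  constructor
  · rintro ⟨C, hC⟩
    refine ⟨C * C₂, fun x => (hC x).trans (add_le_add ?_ le_rfl)⟩
    rw [ENNReal.coe_mul, mul_assoc]
    exact mul_le_mul' le_rfl (h₂ x).2
  · rintro ⟨C, hC⟩
    refine ⟨C * C₁, fun x => (hC x).trans (add_le_add ?_ le_rfl)⟩
    rw [ENNReal.coe_mul, mul_assoc]
    exact mul_le_mul' le_rfl (h₁ x).2

/-! ### The function `z (1 + z)^(-1-ε)` -/

theorem re_pos_of_mem_sector {ω : ℝ} (hω : ω ≤ Real.pi / 2) {z : ℂ} (hz : z ∈ sector ω) :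
    0 < z.re := by
  rcases lt_or_ge 0 z.re with h | h
  · exact h
  · have h1 := Complex.abs_arg_lt_pi_div_two_iff.1 (hz.2.trans_le hω)
    exact h1.resolve_right hz.1

/-- On Re z > 0 both 1 and |z| are at most |1 + z|, so the modulus is at most |z| and at most |1 +
z|^(-ε). The exponent is therefore 1 near 0 and ε near infinity. -/
theorem memHInfZero_mul_cpow {ω : ℝ} (hω : ω ≤ Real.pi / 2) {ε : ℝ} (hε : 0 < ε) :
    MemHInfZero ω fun z : ℂ => z * (1 + z) ^ (-1 - ε : ℂ) := by
  have hre : ∀ z ∈ sector ω, 0 < z.re := fun z hz => re_pos_of_mem_sector hω hz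
  have hslit : ∀ z ∈ sector ω, 1 + z ∈ Complex.slitPlane := fun z hz => by
    refine Complex.mem_slitPlane_iff.2 (Or.inl ?_)
    rw [Complex.add_re, Complex.one_re]
    linarith [hre z hz]
  have hone : ∀ z ∈ sector ω, 1 ≤ ‖1 + z‖ ∧ ‖z‖ ≤ ‖1 + z‖ := by
    intro z hz
    have h0 := hre z hz
    constructor
    · refine le_trans ?_ (Complex.re_le_norm _)
      rw [Complex.add_re, Complex.one_re]
      linarith
    · rw [← sq_le_sq₀ (norm_nonneg _) (norm_nonneg _), ← Complex.normSq_eq_norm_sq,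
        ← Complex.normSq_eq_norm_sq, Complex.normSq_apply, Complex.normSq_apply]
      simp only [Complex.add_re, Complex.one_re, Complex.add_im, Complex.one_im, zero_add]
      nlinarith
  have hnorm : ∀ z ∈ sector ω, ‖z * (1 + z) ^ (-1 - ε : ℂ)‖ = ‖z‖ * ‖1 + z‖ ^ (-1 - ε) := by
    intro z hz
    rw [norm_mul, show (-1 - ε : ℂ) = ((-1 - ε : ℝ) : ℂ) by push_cast; ring,
      Complex.norm_cpow_real]
  have hb : ∀ z ∈ sector ω, ‖z * (1 + z) ^ (-1 - ε : ℂ)‖ ≤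
      1 * min (‖z‖ ^ min 1 ε) (‖z‖ ^ (-min 1 ε)) := by
    intro z hz
    obtain ⟨h1, h2⟩ := hone z hz
    have hz0 : 0 < ‖z‖ := norm_pos_iff.2 hz.1
    have hα : 0 < min 1 ε := lt_min one_pos hε
    rw [hnorm z hz, one_mul, le_min_iff]
    have hsplit : ‖1 + z‖ ^ (-1 - ε) = ‖1 + z‖ ^ (-1 : ℝ) * ‖1 + z‖ ^ (-ε) := by
      rw [← Real.rpow_add (by linarith)]
      ring_nf
    have hle1 : ‖z‖ * ‖1 + z‖ ^ (-1 - ε) ≤ ‖z‖ := by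
      refine mul_le_of_le_one_right hz0.le (Real.rpow_le_one_of_one_le_of_nonpos h1 (by linarith))
    have hle2 : ‖z‖ * ‖1 + z‖ ^ (-1 - ε) ≤ ‖1 + z‖ ^ (-ε) := by
      rw [hsplit, ← mul_assoc]
      refine mul_le_of_le_one_left (Real.rpow_nonneg (norm_nonneg _) _) ?_
      rw [Real.rpow_neg_one, ← div_eq_mul_inv]
      exact div_le_one_of_le₀ h2 (norm_nonneg _)
    have hle3 : ‖z‖ * ‖1 + z‖ ^ (-1 - ε) ≤ 1 :=
      hle2.trans (Real.rpow_le_one_of_one_le_of_nonpos h1 (by linarith))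
    rcases le_total ‖z‖ 1 with h | h
    · constructor
      · refine hle1.trans ?_
        conv_lhs => rw [← Real.rpow_one ‖z‖]
        exact Real.rpow_le_rpow_of_exponent_ge hz0 h (min_le_left _ _)
      · exact hle3.trans (Real.one_le_rpow_of_pos_of_le_one_of_nonpos hz0 h (by linarith))
    · constructor
      · exact hle3.trans (Real.one_le_rpow h hα.le)
      · refine hle2.trans ?_
        refine (Real.rpow_le_rpow_of_nonpos hz0 h2 (by linarith)).trans ?_
        exact Real.rpow_le_rpow_of_exponent_le h (neg_le_neg (min_le_right _ _))
  refine ⟨⟨?_, 1, fun z hz => (hb z hz).trans ?_⟩, 1, min 1 ε, one_pos, lt_min one_pos hε, hb⟩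
  · intro z hz
    have := hslit z hz
    refine DifferentiableAt.differentiableWithinAt ?_
    exact differentiableAt_id.mul ((differentiableAt_id.const_add 1).cpow_const this)
  · rw [one_mul]
    have hz0 : 0 < ‖z‖ := norm_pos_iff.2 hz.1
    have hα : 0 < min 1 ε := lt_min one_pos hε
    rcases le_total ‖z‖ 1 with h | h
    · exact (min_le_left _ _).trans (Real.rpow_le_one hz0.le h hα.le)
    · exact (min_le_right _ _).trans (Real.rpow_le_one_of_one_le_of_nonpos h (by linarith))

theorem mul_cpow_ne_zero {ω : ℝ} (hω : 0 < ω) (ε : ℝ) :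
    ∃ z ∈ sector ω, z * (1 + z) ^ (-1 - ε : ℂ) ≠ 0 := by
  refine ⟨1, ⟨one_ne_zero, by simpa⟩, ?_⟩
  rw [one_mul, Ne, Complex.cpow_eq_zero_iff]
  norm_num

/-! ### Integrability of the resolvent on the half-line -/

/-- The integrand is ‖x - (1 + tA)⁻¹ x‖ / t. If J x ≠ x its numerator stays away from 0 for t ≥ 1,
and 1/t is not integrable at infinity; so J = 1. -/
theorem IsAnalyticGenerator.eq_zero_of_lintegral_le {A : X →ₗ.[ℂ] X} {T D : ℝ → X →L[ℂ] X} {M : ℝ}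
    (h : IsAnalyticGenerator A T D M) {C : ℝ≥0} (hC : ∀ x : X,
      ∫⁻ t in Ioi (0 : ℝ), ‖opApply A (resolventOp (-((t : ℂ) • A)) 1 x)‖ₑ ≤ C * ‖x‖ₑ) :
    A = 0 := by
  have hM := h.pos
  have hres : ∀ t : ℝ, 0 < t → resolventOp (-((t : ℂ) • A)) 1 = oneAddInv A t := by
    intro t ht
    have ht0 : (t : ℂ) ≠ 0 := by exact_mod_cast ht.ne'
    have h1 := resolventOp_smul A (t := -(t : ℂ)) (neg_ne_zero.2 ht0) (-(t : ℂ)⁻¹)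
    have h2 : -((t : ℂ) • A) = (-(t : ℂ)) • A :=
      LinearPMap.ext rfl fun x _ _ => (neg_smul (t : ℂ) (A ⟨x, _⟩)).symm
    rw [neg_mul_neg, mul_inv_cancel₀ ht0, inv_neg] at h1
    rw [h2]
    exact h1
  have hop : ∀ t : ℝ, 0 < t → ∀ x, opApply A (resolventOp (-((t : ℂ) • A)) 1 x) =
      (t : ℂ)⁻¹ • (x - oneAddInv A t x) := by
    intro t ht x
    have ht0 : (t : ℂ) ≠ 0 := by exact_mod_cast ht.ne'
    obtain ⟨h1, h2⟩ := h.oneAddInv_mem ht x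
    rw [hres t ht, opApply, dif_pos h1, eq_inv_smul_iff₀ ht0, eq_sub_iff_add_eq', h2]
  have hid : ∀ x, oneAddInv A 1 x = x := by
    intro x
    by_contra hne
    set c := ‖x - oneAddInv A 1 x‖ with hc
    have hc0 : 0 < c := norm_pos_iff.2 (sub_ne_zero.2 (Ne.symm hne))
    have hlow : ∀ s : ℝ, 1 ≤ s → c / (1 + 2 * M) ≤ ‖x - oneAddInv A s x‖ := by
      intro s hs
      have hs0 : 0 < s := one_pos.trans_le hs
      obtain ⟨h1, h2⟩ := h.oneAddInv_mem hs0 x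
      set y := oneAddInv A s x with hy
      have h3 := h.oneAddInv_apply_add one_pos ⟨y, h1⟩
      have h4 : y - oneAddInv A 1 y = (s : ℂ)⁻¹ • oneAddInv A 1 (x - y) := by
        rw [← map_smul, show (s : ℂ)⁻¹ • (x - y) = A ⟨y, h1⟩ by
          rw [inv_smul_eq_iff₀ (by exact_mod_cast hs0.ne'), sub_eq_iff_eq_add', h2],
          sub_eq_iff_eq_add', ← map_add]
        rw [Complex.ofReal_one, one_smul] at h3
        exact h3.symm
      -- With y = (1 + sA)⁻¹ x, the vector x - J x is recovered from x - y by operators of total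
      -- norm at most 1 + 2M when s ≥ 1.
      have h5 : x - oneAddInv A 1 x = (x - y) - oneAddInv A 1 (x - y) +
          (s : ℂ)⁻¹ • oneAddInv A 1 (x - y) := by
        rw [← h4, map_sub]
        abel
      have h6 : ‖oneAddInv A 1 (x - y)‖ ≤ M * ‖x - y‖ :=
        (oneAddInv A 1).le_of_opNorm_le (h.norm_oneAddInv_le one_pos) _
      rw [div_le_iff₀ (by positivity), hc, h5]
      calc _ ≤ ‖x - y‖ + ‖oneAddInv A 1 (x - y)‖ + ‖(s : ℂ)⁻¹ • oneAddInv A 1 (x - y)‖ :=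
            (norm_add_le _ _).trans (add_le_add (norm_sub_le _ _) le_rfl)
        _ ≤ ‖x - y‖ + M * ‖x - y‖ + 1 * (M * ‖x - y‖) := by
          rw [norm_smul, norm_inv, Complex.norm_real, Real.norm_of_nonneg hs0.le]
          have h7 : s⁻¹ ≤ 1 := inv_le_one_of_one_le₀ hs
          gcongr
        _ = _ := by ring
    have h1 := hC x
    rw [lintegral_Ioi_eq_lintegral_exp] at h1
    have h2 : ∫⁻ _ in Ioi (0 : ℝ), ENNReal.ofReal (c / (1 + 2 * M)) ≤ C * ‖x‖ₑ := by
      refine le_trans (le_trans (setLIntegral_mono' measurableSet_Ioi fun s hs => ?_)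
        (setLIntegral_le_lintegral (Ioi 0) _)) h1
      rw [hop _ (Real.exp_pos s), ← ofReal_norm, ← ENNReal.ofReal_mul (Real.exp_pos s).le,
        norm_smul, norm_inv, Complex.norm_real, Real.norm_of_nonneg (Real.exp_pos s).le,
        mul_inv_cancel_left₀ (Real.exp_pos s).ne']
      exact ENNReal.ofReal_le_ofReal (hlow _ (Real.one_le_exp (le_of_lt hs)))
    rw [setLIntegral_const, Real.volume_Ioi, ENNReal.mul_top] at h2
    · exact absurd (top_le_iff.1 h2) (ENNReal.mul_ne_top ENNReal.coe_ne_top enorm_ne_top)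
    · exact (ENNReal.ofReal_pos.2 (by positivity)).ne'
  have hdom : A.domain = ⊤ := by
    refine eq_top_iff.2 fun x _ => ?_
    rw [← hid x]
    exact (h.oneAddInv_mem one_pos x).1
  refine LinearPMap.ext hdom fun x hx hx' => ?_
  have h1 := h.oneAddInv_apply_add one_pos ⟨x, hx⟩
  rw [hid, Complex.ofReal_one, one_smul] at h1
  exact add_eq_left.1 h1

end Final

end

theorem proposition2p20 {X : Type*} [NormedAddCommGroup X] [NormedSpace ℂ X] [CompleteSpace X]
    (A : X →ₗ.[ℂ] X) (T : ℝ → X →L[ℂ] X)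
    (hT : IsBoundedAnalyticSemigroup T) (hA : IsGenerator (-A) T)
    (ω : ℝ) (hω : sectorialityAngle A < ω) (hω' : ω < Real.pi / 2)
    (γ : ℂ → ℂ) (hγ : MemHInfZero ω γ) (hγ0 : ∃ z ∈ sector ω, γ z ≠ 0)
    -- `ν` is the angle of the contour that defines `γ(tA)`; every admissible angle is covered
    (ν : ℝ) (hν : sectorialityAngle A < ν) (hν' : ν < ω) :
    -- (i)
    (HasMaximalRegularity A 1 ↔ L1Condition A ν γ) ∧
    (∀ ε : ℝ, 0 < ε →
      MemHInfZero ω (fun z : ℂ => z * (1 + z) ^ (-1 - ε : ℂ)) ∧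
      (∃ z ∈ sector ω, z * (1 + z) ^ (-1 - ε : ℂ) ≠ 0) ∧
      (HasMaximalRegularity A 1 ↔ L1Condition A ν (fun z : ℂ => z * (1 + z) ^ (-1 - ε : ℂ)))) ∧
    ((∃ C : ℝ≥0, ∀ x : X,
        ∫⁻ t in Ioi (0 : ℝ), ‖opApply A (resolventOp (-((t : ℂ) • A)) 1 x)‖ₑ ≤ C * ‖x‖ₑ) →
      A = 0) ∧
    -- (ii)
    (LInfCondition A T ν γ → HasMaximalRegularity A ∞) ∧
    (IsC0Semigroup T → (HasMaximalRegularity A ∞ ↔ LInfCondition A T ν γ)) := by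
  obtain ⟨D, M, h⟩ := hT.exists_isAnalyticGenerator hA
  -- Positivity of ω is not a hypothesis; the sector bound below ν is stated with a positive angle.
  have hω0 : 0 < ω := by
    obtain ⟨φ, K, hφ, hS⟩ := h.exists_sectorBound hν (hν'.trans hω')
    exact (hS.pos.trans hφ).trans hν'
  have hsup := h.derivSupCondition_iff_lInfCondition hω'.le hγ hγ0 hν hν'
  refine ⟨h.hasMaximalRegularity_one_iff_l1Condition hω'.le hγ hγ0 hν hν', fun ε hε => ?_,
    fun ⟨C, hC⟩ => h.eq_zero_of_lintegral_le hC,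
    fun hc => h.hasMaximalRegularity_top_of_derivSupCondition (hsup.2 hc), fun hC0 => ?_⟩
  · have h1 := memHInfZero_mul_cpow hω'.le hε
    have h2 := mul_cpow_ne_zero hω0 ε
    exact ⟨h1, h2, h.hasMaximalRegularity_one_iff_l1Condition hω'.le h1 h2 hν hν'⟩
  · exact ⟨fun hMR => hsup.1 (h.derivSupCondition_of_hasMaximalRegularity_top hMR hC0.2),
      fun hc => h.hasMaximalRegularity_top_of_derivSupCondition (hsup.2 hc)⟩
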